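/- Let $k$ be a field and let $kQ$ denote the path coalgebra of a (possibly infinite) quiver $Q$: it is spanned by all paths, with $\Delta(p)=\sum_{p=p_2p_1}p_2\otimes p_1$ (trivial factors included) and $\varepsilon(p)=\delta_{|p|,0}$. Let $C$ be a $k$-coalgebra whose basic coalgebra is an admissible subcoalgebra $B\subseteq kQ$; that is, $B$ contains all vertices and arrows of $Q$ and the categories of right comodules over $C$ and over $B$ are equivalent as $k$-linear categories. Suppose that $C$ is a string coalgebra: (S1) every vertex of $Q$ is the start of at most two arrows and the end of at most two arrows; (S2) for every arrow $\beta$ there is at most one arrow $\alpha$ such that $\alpha\beta$ lies in the support of some element of $B$, and at most one arrow $\gamma$ such that $\beta\gamma$ lies in the support of some element of $B$; (S3) $B$ is spanned by a set of paths. A letter is an arrow of $Q$ or a formal inverse of an arrow; a word $w=w_n\cdots w_1$ ($n\ge 0$, with one empty word for each vertex) is a sequence of letters such that $w_i$ ends where $w_{i+1}$ starts and $w_{i+1}\ne w_i^{-1}$. A string is a word $w$ such that every path occurring as a subword of $w$ or of $w^{-1}$ lies in $B$. A band is a word of positive length, not a proper power of a word, all of whose powers are words in which every path occurring as a subword of the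 power or of its inverse lies in $B$. The string module $\mathrm{St}(w)$ is the representation of $Q$ with basis $v_0,\dots,v_n$, where $v_i$ lies at the $i$-th vertex of $w$; for each $i$, if $w_{i+1}=\alpha$ is an arrow, then $\alpha v_i=v_{i+1}$, and if $w_{i+1}=\alpha^{-1}$, then $\alpha v_{i+1}=v_i$; all other actions of arrows on basis vectors are zero. For a band $w$ of length $n$ and an automorphism $\varphi$ of a nonzero finite-dimensional vector space $V$ such that $V$ is indecomposable as a $k[T,T^{-1}]$-module with $T$ acting by $\varphi$, the band module has one copy $V_i$ of $V$ at the start of each letter $w_{i+1}$ ($i\in\mathbb Z/n$); if $w_{i+1}=\alpha$, then $\alpha$ maps $V_i$ to $V_{i+1}$, and if $w_{i+1}=\alpha^{-1}$, then $\alpha$ maps $V_{i+1}$ to $V_i$, by the identity, except that for the letter $w_1$ the map is $\varphi$, respectively $\varphi^{-1}$; all other actions are zero. A right $B$-comodule, with coaction $x\mapsto\sum_p x_p\otimes p$ ($p$ running over the paths of $Q$), is regarded as a representation of $Q$ in which each path $p$ acts by $x\mapsto x_p$. A right $C$-comodule is called a string comodule (band comodule) if the corresponding $B$-comodule is isomorphic,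 as a representation of $Q$, to the string module of a string (to the band module of a band $w$ and some $\varphi$ as above). Then every finite-dimensional indecomposable right $C$-comodule is a string comodule or a band comodule. -/

import Mathlib

open CategoryTheory TensorProduct

universe u

noncomputable section

/-! ## Right comodules over a coalgebra -/

/-- A right comodule over the `k`-coalgebra `C`. -/
structure RightComod (k : Type u) [Field k] (C : Type u) [AddCommGroup C] [Module k C]
    [Coalgebra k C] where
  carrier : Type u
  [addCommGroup : AddCommGroup carrier]
  [module : Module k carrier]
  /-- the coaction `M → M ⊗ C` -/
  coact : carrier →ₗ[k] carrier ⊗[k] C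
  coassoc : (TensorProduct.assoc k carrier C C).toLinearMap ∘ₗ coact.rTensor C ∘ₗ coact =
    (Coalgebra.comul (R := k) (A := C)).lTensor carrier ∘ₗ coact
  counit_coact : (TensorProduct.rid k carrier).toLinearMap ∘ₗ
    (Coalgebra.counit (R := k) (A := C)).lTensor carrier ∘ₗ coact = LinearMap.id

namespace RightComod

section Category

variable {k : Type u} [Field k] {C : Type u} [AddCommGroup C] [Module k C] [Coalgebra k C]

instance : CoeSort (RightComod k C) (Type u) := ⟨RightComod.carrier⟩

instance (M : RightComod k C) : AddCommGroup M := M.addCommGroup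

instance (M : RightComod k C) : Module k M := M.module

/-- The space of comodule homomorphisms: linear maps that commute with the coactions. -/
def homs (M N : RightComod k C) : Submodule k (M →ₗ[k] N) where
  carrier := {f | f.rTensor C ∘ₗ M.coact = N.coact ∘ₗ f}
  add_mem' := by
    intro f g hf hg
    simp only [Set.mem_ofPred_eq] at hf hg ⊢
    rw [LinearMap.rTensor_add, LinearMap.add_comp, hf, hg, LinearMap.comp_add]
  zero_mem' := by simp
  smul_mem' := by
    intro a f hf
    simp only [Set.mem_ofPred_eq] at hf ⊢
    rw [LinearMap.rTensor_smul, LinearMap.smul_comp, hf, LinearMap.comp_smul]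

/-- The category of right `C`-comodules. -/
instance : Category.{u} (RightComod k C) where
  Hom M N := homs M N
  id M := ⟨LinearMap.id, by simp [homs]⟩
  comp {L M N} f g := ⟨g.1 ∘ₗ f.1, by
    have hf : f.1.rTensor C ∘ₗ L.coact = M.coact ∘ₗ f.1 := f.2
    have hg : g.1.rTensor C ∘ₗ M.coact = N.coact ∘ₗ g.1 := g.2
    change (g.1 ∘ₗ f.1).rTensor C ∘ₗ L.coact = N.coact ∘ₗ (g.1 ∘ₗ f.1)
    rw [LinearMap.rTensor_comp, LinearMap.comp_assoc, hf, ← LinearMap.comp_assoc, hg,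
      LinearMap.comp_assoc]⟩
  id_comp _ := rfl
  comp_id _ := rfl
  assoc _ _ _ := rfl

instance : Preadditive (RightComod k C) where
  homGroup M N := inferInstanceAs (AddCommGroup (homs M N))
  add_comp _ _ _ f f' g := Subtype.ext (LinearMap.comp_add f.1 f'.1 g.1)
  comp_add _ _ _ f g g' := Subtype.ext (LinearMap.add_comp f.1 g'.1 g.1)

instance : Linear k (RightComod k C) where
  homModule M N := inferInstanceAs (Module k (homs M N))
  smul_comp _ _ _ r f g := Subtype.ext (LinearMap.comp_smul g.1 r f.1)
  comp_smul _ _ _ f r g := Subtype.ext (LinearMap.smul_comp r g.1 f.1)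

end Category

section Indecomposable

variable {k : Type u} [Field k] {C : Type u} [AddCommGroup C] [Module k C] [Coalgebra k C]

/-- `N` is a subcomodule of `M`: the coaction maps `N` into (the image of) `N ⊗ C`. -/
def IsSubcomodule (M : RightComod k C) (N : Submodule k M) : Prop :=
  ∀ x ∈ N, M.coact x ∈ LinearMap.range (N.subtype.rTensor C)

/-- `M` is nonzero and is not the direct sum of two nonzero subcomodules. -/
def IsIndecomposable (M : RightComod k C) : Prop :=
  Nontrivial M ∧ ∀ N₁ N₂ : Submodule k M, M.IsSubcomodule N₁ → M.IsSubcomodule N₂ →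
    IsCompl N₁ N₂ → N₁ = ⊥ ∨ N₂ = ⊥

end Indecomposable

end RightComod

/-! ## The path coalgebra of a quiver -/

/-- A path of the quiver `Q`, with arbitrary end points. -/
structure QPath (Q : Type u) [Quiver.{u} Q] : Type u where
  {source : Q}
  {target : Q}
  path : Quiver.Path source target

namespace QPath

/-- The sum of `f p₁ p₂` over all factorizations of `p` into an initial part `p₁` and a
terminal part `p₂` (trivial parts allowed). -/
def cutSum {Q : Type u} [Quiver.{u} Q] {A : Type u} [AddCommMonoid A] {a : Q} :
    {b : Q} → Quiver.Path a b → (∀ c : Q, Quiver.Path a c → Quiver.Path c b → A) → A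
  | _, .nil, f => f a .nil .nil
  | b, .cons p e, f => f b (p.cons e) .nil + cutSum p (fun c p₁ p₂ => f c p₁ (p₂.cons e))

section Lemmas

variable {Q : Type u} [Quiver.{u} Q] {A A' : Type u} [AddCommMonoid A] [AddCommMonoid A']

theorem cutSum_add {a b : Q} (p : Quiver.Path a b)
    (f g : ∀ c : Q, Quiver.Path a c → Quiver.Path c b → A) :
    cutSum p (fun c p₁ p₂ => f c p₁ p₂ + g c p₁ p₂) = cutSum p f + cutSum p g := by
  induction p with
  | nil => rfl
  | cons p e ih => simp only [cutSum, ih]; exact add_add_add_comm _ _ _ _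

theorem cutSum_zero {a b : Q} (p : Quiver.Path a b) :
    cutSum p (fun _ _ _ => (0 : A)) = 0 := by
  induction p with
  | nil => rfl
  | cons p e ih => simp only [cutSum, ih, add_zero]

theorem map_cutSum {a b : Q} (φ : A →+ A') (p : Quiver.Path a b)
    (f : ∀ c : Q, Quiver.Path a c → Quiver.Path c b → A) :
    φ (cutSum p f) = cutSum p (fun c p₁ p₂ => φ (f c p₁ p₂)) := by
  induction p with
  | nil => rfl
  | cons p e ih => simp only [cutSum, map_add, ih]

theorem cutSum_assoc {a b : Q} (p : Quiver.Path a b)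
    (F : ∀ c d : Q, Quiver.Path a c → Quiver.Path c d → Quiver.Path d b → A) :
    cutSum p (fun c p₁ p₂ => cutSum p₂ (fun d q₁ q₂ => F c d p₁ q₁ q₂)) =
      cutSum p (fun d r p₃ => cutSum r (fun c q₁ q₂ => F c d q₁ q₂ p₃)) := by
  induction p with
  | nil => rfl
  | @cons b' b'' p e ih =>
    simp only [cutSum, cutSum_add]
    rw [ih (fun c d p₁ q₁ q₂ => F c d p₁ q₁ (q₂.cons e)), add_assoc]

end Lemmas

end QPath

/-- The underlying vector space of the path coalgebra `kQ`: the span of all paths. -/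
def PathCoalgebra (k : Type u) [Field k] (Q : Type u) [Quiver.{u} Q] : Type u := QPath Q →₀ k

namespace PathCoalgebra

variable {k : Type u} [Field k] {Q : Type u} [Quiver.{u} Q]

instance : AddCommGroup (PathCoalgebra k Q) := inferInstanceAs (AddCommGroup (QPath Q →₀ k))

instance : Module k (PathCoalgebra k Q) := inferInstanceAs (Module k (QPath Q →₀ k))

/-- A path as an element of `kQ`. -/
def ofPath (k : Type u) [Field k] {Q : Type u} [Quiver.{u} Q] {a b : Q}
    (p : Quiver.Path a b) : PathCoalgebra k Q := Finsupp.single ⟨p⟩ 1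

/-- The linear map on `kQ` with prescribed values on the paths. -/
def liftPath {V : Type u} [AddCommGroup V] [Module k V] (f : QPath Q → V) :
    PathCoalgebra k Q →ₗ[k] V := Finsupp.linearCombination k f

@[simp] theorem liftPath_ofPath {V : Type u} [AddCommGroup V] [Module k V] (f : QPath Q → V)
    {a b : Q} (p : Quiver.Path a b) : liftPath f (ofPath k p) = f ⟨p⟩ :=
  (Finsupp.linearCombination_single k (1 : k) (⟨p⟩ : QPath Q)).trans (one_smul k _)

theorem hom_ext {V : Type u} [AddCommGroup V] [Module k V] {f g : PathCoalgebra k Q →ₗ[k] V}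
    (h : ∀ (a b : Q) (p : Quiver.Path a b), f (ofPath k p) = g (ofPath k p)) : f = g := by
  refine Finsupp.lhom_ext' (fun p => LinearMap.ext_ring ?_)
  exact h _ _ p.path

/-- The coefficient of the path `p`, as a linear form on `kQ`. -/
def coeff (k : Type u) [Field k] {Q : Type u} [Quiver.{u} Q] {a b : Q}
    (p : Quiver.Path a b) : PathCoalgebra k Q →ₗ[k] k := Finsupp.lapply ⟨p⟩

/-- `Δ(p) = ∑ p₂ ⊗ p₁` over all factorizations of `p` as `p₁` followed by `p₂`, trivial ones
included; `ε(p) = 1` if `p` has length `0`, and `ε(p) = 0` otherwise. -/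
instance : CoalgebraStruct k (PathCoalgebra k Q) where
  comul := liftPath fun p => QPath.cutSum p.path fun _ p₁ p₂ => ofPath k p₂ ⊗ₜ[k] ofPath k p₁
  counit := liftPath fun p => if p.path.length = 0 then 1 else 0

theorem comul_ofPath {a b : Q} (p : Quiver.Path a b) :
    Coalgebra.comul (R := k) (ofPath k p) =
      QPath.cutSum p fun _ p₁ p₂ => ofPath k p₂ ⊗ₜ[k] ofPath k p₁ :=
  liftPath_ofPath _ p

theorem counit_ofPath {a b : Q} (p : Quiver.Path a b) :
    Coalgebra.counit (R := k) (ofPath k p) = if p.length = 0 then 1 else 0 :=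
  liftPath_ofPath _ p

theorem map_cutSum {V W : Type u} [AddCommGroup V] [Module k V] [AddCommGroup W] [Module k W]
    {a b : Q} (φ : V →ₗ[k] W) (p : Quiver.Path a b)
    (f : ∀ c : Q, Quiver.Path a c → Quiver.Path c b → V) :
    φ (QPath.cutSum p f) = QPath.cutSum p (fun c p₁ p₂ => φ (f c p₁ p₂)) :=
  QPath.map_cutSum φ.toAddMonoidHom p f

theorem cutSum_counit_left {a b : Q} (p : Quiver.Path a b) :
    QPath.cutSum p (fun _ p₁ p₂ =>
      (if p₂.length = 0 then (1 : k) else 0) ⊗ₜ[k] ofPath k p₁) = 1 ⊗ₜ[k] ofPath k p := by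
  cases p with
  | nil => simp [QPath.cutSum]
  | cons p e => simp [QPath.cutSum, QPath.cutSum_zero]

theorem cutSum_counit_right {V : Type u} [AddCommGroup V] [Module k V] {a b : Q}
    (p : Quiver.Path a b) (f : ∀ c : Q, Quiver.Path c b → V) :
    QPath.cutSum p (fun c p₁ p₂ =>
      f c p₂ ⊗ₜ[k] (if p₁.length = 0 then (1 : k) else 0)) = f a p ⊗ₜ[k] 1 := by
  induction p with
  | nil => simp [QPath.cutSum]
  | cons p e ih => simp [QPath.cutSum, ih (fun c q => f c (q.cons e))]

instance : Coalgebra k (PathCoalgebra k Q) where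
  coassoc := by
    apply hom_ext
    intro a b p
    simp only [LinearMap.comp_apply, LinearEquiv.coe_coe, comul_ofPath, map_cutSum,
      LinearMap.rTensor_tmul, LinearMap.lTensor_tmul]
    have h1 : ∀ {c d : Q} (q : Quiver.Path c d) (y : PathCoalgebra k Q),
        (TensorProduct.assoc k _ _ _)
          ((QPath.cutSum q fun _ p₁ p₂ => ofPath k p₂ ⊗ₜ[k] ofPath k p₁) ⊗ₜ[k] y) =
        QPath.cutSum q fun _ p₁ p₂ => ofPath k p₂ ⊗ₜ[k] (ofPath k p₁ ⊗ₜ[k] y) := by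
      intro c d q y
      exact map_cutSum ((TensorProduct.assoc k (PathCoalgebra k Q) (PathCoalgebra k Q)
        (PathCoalgebra k Q)).toLinearMap ∘ₗ (TensorProduct.mk k _ _).flip y) q _
    have h2 : ∀ {c d : Q} (q : Quiver.Path c d) (y : PathCoalgebra k Q),
        y ⊗ₜ[k] (QPath.cutSum q fun _ p₁ p₂ => ofPath k p₂ ⊗ₜ[k] ofPath k p₁) =
        QPath.cutSum q fun _ p₁ p₂ => y ⊗ₜ[k] (ofPath k p₂ ⊗ₜ[k] ofPath k p₁) := by
      intro c d q y
      exact map_cutSum (TensorProduct.mk k _ _ y) q _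
    simp only [h1, h2]
    exact QPath.cutSum_assoc p
      (fun _ _ p₁ q₁ q₂ => ofPath k q₂ ⊗ₜ[k] (ofPath k q₁ ⊗ₜ[k] ofPath k p₁))
  rTensor_counit_comp_comul := by
    apply hom_ext
    intro a b p
    simp only [LinearMap.comp_apply, comul_ofPath, map_cutSum, LinearMap.rTensor_tmul,
      counit_ofPath, TensorProduct.mk_apply]
    exact cutSum_counit_left p
  lTensor_counit_comp_comul := by
    apply hom_ext
    intro a b p
    simp only [LinearMap.comp_apply, comul_ofPath, map_cutSum, LinearMap.lTensor_tmul,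
      counit_ofPath, LinearMap.flip_apply, TensorProduct.mk_apply]
    exact cutSum_counit_right p (fun _ q => ofPath k q)

end PathCoalgebra

/-! ## Admissible subcoalgebras of path coalgebras and string coalgebras -/

/-- An identification of the coalgebra `B` with an admissible subcoalgebra of `kQ`, that is, with
a subcoalgebra that contains all vertices and all arrows of `Q`. -/
structure AdmissibleEmbedding (k : Type u) [Field k] (B : Type u) [AddCommGroup B] [Module k B]
    [Coalgebra k B] (Q : Type u) [Quiver.{u} Q] where
  incl : B →ₗc[k] PathCoalgebra k Q
  injective : Function.Injective incl
  vertex_mem : ∀ g : Q, PathCoalgebra.ofPath k (Quiver.Path.nil : Quiver.Path g g) ∈ Set.range incl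
  arrow_mem : ∀ (g h : Q) (α : g ⟶ h), PathCoalgebra.ofPath k α.toPath ∈ Set.range incl

namespace AdmissibleEmbedding

section

variable {k : Type u} [Field k] {B : Type u} [AddCommGroup B] [Module k B] [Coalgebra k B]
  {Q : Type u} [Quiver.{u} Q]

/-- The path `p` is an element of `B ⊆ kQ`. -/
def Contains (ι : AdmissibleEmbedding k B Q) {g h : Q} (p : Quiver.Path g h) : Prop :=
  PathCoalgebra.ofPath k p ∈ Set.range ι.incl

/-- The path `p` appears in `B`, i.e. lies in the support of some element of `B`. -/
def Appears (ι : AdmissibleEmbedding k B Q) {g h : Q} (p : Quiver.Path g h) : Prop :=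
  ∃ b : B, PathCoalgebra.coeff k p (ι.incl b) ≠ 0

/-- The conditions on an admissible subcoalgebra `B` of `kQ` in the definition of a string
coalgebra. -/
structure IsString (ι : AdmissibleEmbedding k B Q) : Prop where
  /-- every vertex is the start of at most two arrows -/
  starts : ∀ g : Q, ENat.card ((h : Q) × (g ⟶ h)) ≤ 2
  /-- every vertex is the end of at most two arrows -/
  ends : ∀ g : Q, ENat.card ((h : Q) × (h ⟶ g)) ≤ 2
  /-- for every arrow `β` there is at most one arrow `α` such that `β` followed by `α` appears -/
  after : ∀ (g h : Q) (β : g ⟶ h),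
    {α : (l : Q) × (h ⟶ l) | ι.Appears (β.toPath.comp α.2.toPath)}.Subsingleton
  /-- for every arrow `β` there is at most one arrow `γ` such that `γ` followed by `β` appears -/
  before : ∀ (g h : Q) (β : g ⟶ h),
    {γ : (l : Q) × (l ⟶ g) | ι.Appears (γ.2.toPath.comp β.toPath)}.Subsingleton
  /-- `B` is spanned by a set of paths -/
  spanned : ∃ S : Set (QPath Q),
    LinearMap.range (ι.incl : B →ₗ[k] PathCoalgebra k Q) =
      Submodule.span k ((fun p : QPath Q => PathCoalgebra.ofPath k p.path) '' S)

/-- The operator on a right `B`-comodule `M` given by the path `p`: if the coaction is written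
`x ↦ ∑ₚ xₚ ⊗ p`, with `p` running over the paths of `Q`, then it sends `x` to `xₚ`.
For vertices and arrows these operators are the representation of `Q` attached to `M`. -/
def pathOp (ι : AdmissibleEmbedding k B Q) (M : RightComod k B) {g h : Q}
    (p : Quiver.Path g h) : M →ₗ[k] M :=
  (TensorProduct.rid k M).toLinearMap ∘ₗ
    (PathCoalgebra.coeff k p ∘ₗ (ι.incl : B →ₗ[k] PathCoalgebra k Q)).lTensor M ∘ₗ M.coact

end

end AdmissibleEmbedding

/-- A presentation of the basic coalgebra of `C`: an admissible subcoalgebra `B` of the path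
coalgebra of a quiver `Q`, with a Morita-Takeuchi equivalence, that is, a `k`-linear equivalence
between the categories of right comodules over `C` and over `B`. (Then `B` is the basic coalgebra
of `C`, and `Q` is the Gabriel quiver of `C`.) -/
structure BasicPresentation (k : Type u) [Field k] (C : Type u) [AddCommGroup C] [Module k C]
    [Coalgebra k C] where
  Q : Type u
  [quiver : Quiver.{u} Q]
  B : Type u
  [addCommGroup : AddCommGroup B]
  [module : Module k B]
  [coalgebra : Coalgebra k B]
  emb : AdmissibleEmbedding k B Q
  equiv : RightComod k C ≌ RightComod k B
  additive : equiv.functor.Additive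
  linear : equiv.functor.Linear k

attribute [instance] BasicPresentation.quiver BasicPresentation.addCommGroup
  BasicPresentation.module BasicPresentation.coalgebra

/-- `C` is a string coalgebra, as witnessed by the given presentation of its basic coalgebra. -/
def BasicPresentation.IsString {k : Type u} [Field k] {C : Type u} [AddCommGroup C] [Module k C]
    [Coalgebra k C] (P : BasicPresentation k C) : Prop :=
  P.emb.IsString

/-! ## Letters, words, strings and bands -/

/-- A letter: an arrow of `Q` or the formal inverse of an arrow. -/
inductive Letter (Q : Type u) [Quiver.{u} Q] : Type u
  | dir (α : Quiver.Total Q) : Letter Q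
  | inv (α : Quiver.Total Q) : Letter Q

namespace Letter

/-- The start of a letter. -/
def src {Q : Type u} [Quiver.{u} Q] : Letter Q → Q
  | dir α => α.left
  | inv α => α.right

/-- The end of a letter. -/
def tgt {Q : Type u} [Quiver.{u} Q] : Letter Q → Q
  | dir α => α.right
  | inv α => α.left

/-- The formal inverse of a letter. -/
def inverse {Q : Type u} [Quiver.{u} Q] : Letter Q → Letter Q
  | dir α => inv α
  | inv α => dir α

end Letter

/-- A list `[w₁, …, wₙ]` is the letter sequence of a word `wₙ ⋯ w₁` if `wᵢ` ends where `wᵢ₊₁`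
starts and `wᵢ₊₁` is not the inverse of `wᵢ`. -/
def IsLetterSequence {Q : Type u} [Quiver.{u} Q] (w : List (Letter Q)) : Prop :=
  w.IsChain fun a b => a.tgt = b.src ∧ b ≠ a.inverse

/-- The letter sequence of the formally inverted word. -/
def inverseSequence {Q : Type u} [Quiver.{u} Q] (w : List (Letter Q)) : List (Letter Q) :=
  (w.map Letter.inverse).reverse

/-- The arrows of a path, read from its start to its end, as letters. -/
def pathLetters {Q : Type u} [Quiver.{u} Q] {g : Q} :
    {h : Q} → Quiver.Path g h → List (Letter Q)
  | _, .nil => []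
  | _, .cons p α => pathLetters p ++ [Letter.dir ⟨_, _, α⟩]

/-- Every path that occurs as a subword of `w` or of `w⁻¹` lies in `B`. -/
def SubpathsIn {k : Type u} [Field k] {B : Type u} [AddCommGroup B] [Module k B] [Coalgebra k B]
    {Q : Type u} [Quiver.{u} Q] (ι : AdmissibleEmbedding k B Q) (w : List (Letter Q)) : Prop :=
  ∀ (g h : Q) (p : Quiver.Path g h),
    (pathLetters p <:+: w ∨ pathLetters p <:+: inverseSequence w) → ι.Contains p

/-- A word; the start vertex is recorded so that there is one empty word for every vertex. -/
structure QWord (Q : Type u) [Quiver.{u} Q] : Type u where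
  start : Q
  letters : List (Letter Q)
  start_eq : ∀ a ∈ letters.head?, a.src = start
  isLetterSequence : IsLetterSequence letters

/-- The `i`-th vertex along the word, `0 ≤ i ≤ n`. -/
def QWord.vertex {Q : Type u} [Quiver.{u} Q] (w : QWord Q) (i : Fin (w.letters.length + 1)) : Q :=
  Fin.cases w.start (fun j => (w.letters.get j).tgt) i

/-- The list `w` is the letter sequence of a band: `w` is not empty and not a proper power, all
its powers are words, and all subpaths of these powers lie in `B`. -/
structure IsBand {k : Type u} [Field k] {B : Type u} [AddCommGroup B] [Module k B]
    [Coalgebra k B] {Q : Type u} [Quiver.{u} Q] (ι : AdmissibleEmbedding k B Q)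
    (w : List (Letter Q)) : Prop where
  ne_nil : w ≠ []
  powers : ∀ m : ℕ, IsLetterSequence (List.replicate m w).flatten
  primitive : ∀ (v : List (Letter Q)) (m : ℕ), w = (List.replicate m v).flatten → m = 1
  subpaths : ∀ m : ℕ, SubpathsIn ι (List.replicate m w).flatten

/-! ## String modules and band modules -/

/-- A representation of the quiver `Q` with total space `V`, in the form of the operators on `V`
given by the vertices (the projections on the spaces `V_g`) and by the arrows. -/
structure QuiverOps (k : Type u) [Field k] (Q : Type u) [Quiver.{u} Q] (V : Type u)
    [AddCommGroup V] [Module k V] where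
  vertex : Q → V →ₗ[k] V
  arrow : Quiver.Total Q → V →ₗ[k] V

/-- Isomorphism of representations. -/
def QuiverOps.Iso {k : Type u} [Field k] {Q : Type u} [Quiver.{u} Q] {V W : Type u}
    [AddCommGroup V] [Module k V] [AddCommGroup W] [Module k W]
    (X : QuiverOps k Q V) (Y : QuiverOps k Q W) : Prop :=
  ∃ e : V ≃ₗ[k] W,
    (∀ (g : Q) (x : V), e (X.vertex g x) = Y.vertex g (e x)) ∧
    (∀ (α : Quiver.Total Q) (x : V), e (X.arrow α x) = Y.arrow α (e x))

/-- The representation of `Q` attached to a right `B`-comodule, where `B ⊆ kQ`. -/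
def AdmissibleEmbedding.rep {k : Type u} [Field k] {B : Type u} [AddCommGroup B] [Module k B]
    [Coalgebra k B] {Q : Type u} [Quiver.{u} Q] (ι : AdmissibleEmbedding k B Q)
    (M : RightComod k B) : QuiverOps k Q M where
  vertex g := ι.pathOp M (Quiver.Path.nil : Quiver.Path g g)
  arrow α := ι.pathOp M α.hom.toPath

open Classical in
/-- The string module `St(w)`, with basis `v₀, …, vₙ`: the basis vector `vᵢ` belongs to the `i`-th
vertex of `w`; if the letter between `vᵢ` and `vᵢ₊₁` is an arrow `α`, then `α` maps `vᵢ` to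
`vᵢ₊₁`; if it is `α⁻¹`, then `α` maps `vᵢ₊₁` to `vᵢ`; everything else is zero. -/
def stringModule (k : Type u) [Field k] {Q : Type u} [Quiver.{u} Q] (w : QWord Q) :
    QuiverOps k Q (Fin (w.letters.length + 1) → k) where
  vertex g := ∑ i, if w.vertex i = g then
    LinearMap.single k (fun _ => k) i ∘ₗ LinearMap.proj i else 0
  arrow α := ∑ i : Fin w.letters.length,
    ((if w.letters.get i = Letter.dir α then
        LinearMap.single k (fun _ => k) i.succ ∘ₗ LinearMap.proj i.castSucc else 0) +
      (if w.letters.get i = Letter.inv α then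
        LinearMap.single k (fun _ => k) i.castSucc ∘ₗ LinearMap.proj i.succ else 0))

/-- The cyclic successor of a position in a list. -/
def cyclicSucc {X : Type u} {l : List X} (i : Fin l.length) : Fin l.length :=
  ⟨(i.1 + 1) % l.length, Nat.mod_lt _ (Nat.lt_of_le_of_lt (Nat.zero_le _) i.2)⟩

/-- The identification of the `i`-th with the next copy of `V` in a band module: the automorphism
`φ` at the first letter, and the identity at the other letters. -/
def bandTransport {k : Type u} [Field k] {V : Type u} [AddCommGroup V] [Module k V]
    (φ : V ≃ₗ[k] V) (i : ℕ) : V ≃ₗ[k] V :=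
  if i = 0 then φ else LinearEquiv.refl k V

open Classical in
/-- The band module of the cyclic word `w` and the automorphism `φ` of `V`. There is one copy `Vᵢ`
of `V` for every letter, at the vertex where this letter starts. If the letter between `Vᵢ` and the
cyclically next copy is an arrow `α`, then `α` maps `Vᵢ` there by `bandTransport φ i`; if it
is `α⁻¹`, then `α` maps that copy to `Vᵢ` by the inverse; everything else is zero. -/
def bandModule {k : Type u} [Field k] {Q : Type u} [Quiver.{u} Q] (w : List (Letter Q))
    {V : Type u} [AddCommGroup V] [Module k V] (φ : V ≃ₗ[k] V) :
    QuiverOps k Q (Fin w.length → V) where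
  vertex g := ∑ i, if (w.get i).src = g then
    LinearMap.single k (fun _ => V) i ∘ₗ LinearMap.proj i else 0
  arrow α := ∑ i : Fin w.length,
    ((if w.get i = Letter.dir α then
        LinearMap.single k (fun _ => V) (cyclicSucc i) ∘ₗ
          (bandTransport φ i).toLinearMap ∘ₗ LinearMap.proj i else 0) +
      (if w.get i = Letter.inv α then
        LinearMap.single k (fun _ => V) i ∘ₗ
          (bandTransport φ i).symm.toLinearMap ∘ₗ LinearMap.proj (cyclicSucc i) else 0))

/-- `(V, φ)` is indecomposable as a module over the Laurent polynomial ring. -/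
def IsIndecomposableAut {k : Type u} [Field k] {V : Type u} [AddCommGroup V] [Module k V]
    (φ : V ≃ₗ[k] V) : Prop :=
  Nontrivial V ∧ ∀ U W : Submodule k V, U.map φ.toLinearMap = U → W.map φ.toLinearMap = W →
    IsCompl U W → U = ⊥ ∨ W = ⊥

section Comodules

variable {k : Type u} [Field k] {C : Type u} [AddCommGroup C] [Module k C] [Coalgebra k C]

/-- `M` is a string comodule: the comodule over the basic coalgebra that corresponds to `M` is,
as a representation of `Q`, isomorphic to the string module of a string. -/
def BasicPresentation.IsStringComodule (P : BasicPresentation k C) (M : RightComod k C) : Prop :=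
  ∃ w : QWord P.Q, SubpathsIn P.emb w.letters ∧
    (P.emb.rep (P.equiv.functor.obj M)).Iso (stringModule k w)

/-- `M` is a band comodule: the comodule over the basic coalgebra that corresponds to `M` is,
as a representation of `Q`, isomorphic to the band module given by a band and an indecomposable
automorphism of a nonzero finite-dimensional vector space. -/
def BasicPresentation.IsBandComodule (P : BasicPresentation k C) (M : RightComod k C) : Prop :=
  ∃ (w : List (Letter P.Q)) (d : ℕ) (φ : (Fin d → k) ≃ₗ[k] (Fin d → k)),
    IsBand P.emb w ∧ IsIndecomposableAut φ ∧
    (P.emb.rep (P.equiv.functor.obj M)).Iso (bandModule w φ)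

end Comodules

end

/-! The equivalence of comodule categories preserves nonvanishing, finite dimension and idempotent
endomorphisms. It therefore suffices to treat a finite-dimensional `B`-comodule without nontrivial
idempotents, viewed as a representation `M` of `Q`. By (S1) and (S2) the arrows at every vertex can
be distributed on two sides, so that each side has at most one arrow ending and at most one arrow
starting there, and two consecutive arrows on the same side of a vertex compose to zero on `M`
(`exists_polarization`). The rest is the method of functorial filtrations of Gelfand, Ponomarev and
Ringel.

A letter acts on `M` as a linear relation. If `β` ends and `α` starts on a given side of a vertex,
then `0 ≤ im β ≤ ker α ≤ M_g`. The three steps belong to words that begin with the inverse letter of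
`β`, that end here, or that begin with `α`. Refining the first and the third step recursively along
the letters, one obtains intervals indexed by infinite sequences of digits in lexicographic order
(`RelSystem`). The filtrations from the two sides of a vertex have a nonzero common subquotient
(`exists_isGood`); it belongs to a word extending in both directions, and it stays nonzero when the
position moves along that word (`IsGood.move`).

If the word ends in both directions, a vector of the subquotient and a dual form are continued to
chains along the word, and these span a string module (`IsGood.exists_string`). If the word is
infinite in one direction, a position recurs, because subquotients at different positions are
independent (`eq_zero_of_isPlaced`, `exists_repetition`). The relation of one period then induces an
automorphism of a nonzero subquotient, which splits off (`exists_automorphism_summand`) and yields a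
band module (`IsGood.exists_band`).

In both cases the chains of vectors give a morphism into `M` and the chains of forms a morphism out
of `M`. Their composite is unitriangular for the lexicographic order, hence injective, so the module
is a direct summand and therefore all of `M` (`IsPattern.iso`). The vectors along the word are
nonzero, so the paths in it act nontrivially on `M`; they appear in `B`, and by (S3) they lie in
`B`. -/

noncomputable section

/-! ## Linear relations -/

namespace LinRel

variable {k : Type*} [Field k] {V : Type*} [AddCommGroup V] [Module k V]
  {G : Type*} [AddCommGroup G] [Module k G]

/-- Here `Z` is the graph of a partial linear map, which over a field extends to the whole space.
Linear forms are constructed below by prescribing values and checking consistency. -/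
theorem exists_linearMap_of_singleValued (Z : Submodule k (V × G))
    (hZ : ∀ g, ((0 : V), g) ∈ Z → g = 0) : ∃ f : V →ₗ[k] G, ∀ z ∈ Z, f z.1 = z.2 := by
  have hinj : LinearMap.ker (LinearMap.fst k V G ∘ₗ Z.subtype) = ⊥ := by
    rw [LinearMap.ker_eq_bot']
    rintro ⟨⟨v, g⟩, hz⟩ h
    obtain rfl : v = 0 := h
    obtain rfl := hZ g hz
    rfl
  obtain ⟨r, hr⟩ := LinearMap.exists_leftInverse_of_injective _ hinj
  refine ⟨LinearMap.snd k V G ∘ₗ Z.subtype ∘ₗ r, fun z hz => ?_⟩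
  have := LinearMap.congr_fun hr ⟨z, hz⟩
  simp only [LinearMap.comp_apply, LinearMap.id_apply, LinearMap.fst_apply,
    Submodule.subtype_apply] at this
  simp [this]

/-- Over a field the projection of `Z` onto `G` has a linear section, so pointwise choices can be
made linearly in `g`. -/
theorem exists_linearMap_of_total (Z : Submodule k (G × V))
    (hZ : ∀ g, ∃ v, (g, v) ∈ Z) : ∃ f : G →ₗ[k] V, ∀ g, (g, f g) ∈ Z := by
  have hsurj : LinearMap.range (LinearMap.fst k G V ∘ₗ Z.subtype) = ⊤ := by
    rw [LinearMap.range_eq_top]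
    intro g
    obtain ⟨v, hv⟩ := hZ g
    exact ⟨⟨_, hv⟩, rfl⟩
  obtain ⟨r, hr⟩ := LinearMap.exists_rightInverse_of_surjective _ hsurj
  refine ⟨LinearMap.snd k G V ∘ₗ Z.subtype ∘ₗ r, fun g => ?_⟩
  have h1 := LinearMap.congr_fun hr g
  simp only [LinearMap.comp_apply, LinearMap.id_apply, LinearMap.fst_apply,
    Submodule.subtype_apply] at h1
  have h2 := (r g).2
  simp only [LinearMap.comp_apply, LinearMap.snd_apply, Submodule.subtype_apply]
  nth_rewrite 1 [← h1]
  exact h2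

/-- The elements related by `R` to an element of `A`. -/
def img (R : Submodule k (V × V)) (A : Submodule k V) : Submodule k V :=
  (R ⊓ A.comap (LinearMap.snd k V V)).map (LinearMap.fst k V V)

theorem mem_img {R : Submodule k (V × V)} {A : Submodule k V} {x : V} :
    x ∈ img R A ↔ ∃ y ∈ A, (x, y) ∈ R := by
  simp only [img, Submodule.mem_map, Submodule.mem_inf, Submodule.mem_comap, LinearMap.snd_apply,
    LinearMap.fst_apply, Prod.exists]
  constructor
  · rintro ⟨a, b, ⟨h1, h2⟩, rfl⟩
    exact ⟨b, h2, h1⟩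
  · rintro ⟨y, h1, h2⟩
    exact ⟨x, y, ⟨h2, h1⟩, rfl⟩

theorem img_mono (R : Submodule k (V × V)) {A B : Submodule k V} (h : A ≤ B) :
    img R A ≤ img R B := by
  intro x hx
  obtain ⟨y, hy, hxy⟩ := mem_img.1 hx
  exact mem_img.2 ⟨y, h hy, hxy⟩

/-- The inverse relation. -/
def inv (R : Submodule k (V × V)) : Submodule k (V × V) :=
  R.comap ((LinearMap.snd k V V).prod (LinearMap.fst k V V))

@[simp] theorem mem_inv {R : Submodule k (V × V)} {x y : V} : (x, y) ∈ inv R ↔ (y, x) ∈ R :=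
  Iff.rfl

/-- Composition of relations. -/
def comp (R S : Submodule k (V × V)) : Submodule k (V × V) where
  carrier := {p | ∃ y, (p.1, y) ∈ R ∧ (y, p.2) ∈ S}
  add_mem' := by
    rintro a b ⟨y, h1, h2⟩ ⟨z, h3, h4⟩
    exact ⟨y + z, R.add_mem h1 h3, S.add_mem h2 h4⟩
  zero_mem' := ⟨0, R.zero_mem, S.zero_mem⟩
  smul_mem' := by
    rintro c a ⟨y, h1, h2⟩
    exact ⟨c • y, R.smul_mem c h1, S.smul_mem c h2⟩

theorem mem_comp {R S : Submodule k (V × V)} {x z : V} :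
    (x, z) ∈ comp R S ↔ ∃ y, (x, y) ∈ R ∧ (y, z) ∈ S := Iff.rfl

theorem comp_assoc (R S T : Submodule k (V × V)) : comp (comp R S) T = comp R (comp S T) := by
  ext ⟨x, z⟩
  simp only [mem_comp]
  constructor
  · rintro ⟨y, ⟨w, h1, h2⟩, h3⟩
    exact ⟨w, h1, y, h2, h3⟩
  · rintro ⟨w, h1, y, h2, h3⟩
    exact ⟨y, ⟨w, h1, h2⟩, h3⟩

theorem img_comp (R S : Submodule k (V × V)) (A : Submodule k V) :
    img (comp R S) A = img R (img S A) := by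
  ext x
  simp only [mem_img, mem_comp]
  constructor
  · rintro ⟨z, hz, y, h1, h2⟩
    exact ⟨y, ⟨z, hz, h2⟩, h1⟩
  · rintro ⟨y, ⟨z, hz, h2⟩, h1⟩
    exact ⟨z, hz, y, h1, h2⟩

theorem inv_comp (R S : Submodule k (V × V)) : inv (comp R S) = comp (inv S) (inv R) := by
  ext ⟨x, z⟩
  simp only [mem_comp, mem_inv]
  exact ⟨fun ⟨y, h1, h2⟩ => ⟨y, h2, h1⟩, fun ⟨y, h1, h2⟩ => ⟨y, h2, h1⟩⟩

/-- The composition of the first `n` relations of a sequence. -/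
def word (ρ : ℕ → Submodule k (V × V)) : ℕ → Submodule k (V × V)
  | 0 => LinearMap.graph LinearMap.id
  | n + 1 => comp (word ρ n) (ρ n)

theorem mem_word_zero {ρ : ℕ → Submodule k (V × V)} {x y : V} :
    (x, y) ∈ word ρ 0 ↔ y = x := by
  simp [word, LinearMap.mem_graph_iff]

theorem comp_word_zero (R : Submodule k (V × V)) (ρ : ℕ → Submodule k (V × V)) :
    comp R (word ρ 0) = R := by
  ext ⟨x, z⟩
  simp only [mem_comp, mem_word_zero]
  exact ⟨fun ⟨y, h1, h2⟩ => h2 ▸ h1, fun h => ⟨z, h, rfl⟩⟩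

theorem word_zero_comp (R : Submodule k (V × V)) (ρ : ℕ → Submodule k (V × V)) :
    comp (word ρ 0) R = R := by
  ext ⟨x, z⟩
  simp only [mem_comp, mem_word_zero]
  exact ⟨fun ⟨y, h1, h2⟩ => h1 ▸ h2, fun h => ⟨x, rfl, h⟩⟩

theorem img_word_zero (ρ : ℕ → Submodule k (V × V)) (A : Submodule k V) :
    img (word ρ 0) A = A := by
  ext x
  simp [mem_img, mem_word_zero]

theorem word_add (ρ : ℕ → Submodule k (V × V)) (m n : ℕ) :
    word ρ (m + n) = comp (word ρ m) (word (fun i => ρ (m + i)) n) := by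
  induction n with
  | zero => rw [comp_word_zero]; rfl
  | succ n ih =>
    change comp (word ρ (m + n)) (ρ (m + n)) = _
    rw [ih, comp_assoc]
    rfl

theorem word_succ' (ρ : ℕ → Submodule k (V × V)) (n : ℕ) :
    word ρ (n + 1) = comp (ρ 0) (word (fun i => ρ (i + 1)) n) := by
  rw [Nat.add_comm, word_add]
  congr 1
  · exact word_zero_comp _ _
  · congr 1
    funext i
    rw [Nat.add_comm]

theorem word_congr {ρ ρ' : ℕ → Submodule k (V × V)} {n : ℕ} (h : ∀ i < n, ρ i = ρ' i) :
    word ρ n = word ρ' n := by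
  induction n with
  | zero => rfl
  | succ n ih =>
    simp only [word]
    rw [ih (fun i hi => h i (by omega)), h n (by omega)]

theorem word_inv (ρ : ℕ → Submodule k (V × V)) (n : ℕ) :
    inv (word ρ n) = word (fun i => inv (ρ (n - 1 - i))) n := by
  induction n with
  | zero =>
    ext ⟨x, y⟩
    simp only [mem_inv, mem_word_zero, eq_comm]
  | succ n ih =>
    rw [show word ρ (n + 1) = comp (word ρ n) (ρ n) from rfl, inv_comp, ih, word_succ']
    congr 1
    refine word_congr fun i hi => ?_
    congr 2
    omega

/-- Relations between two linear families of vectors are composed of linear families of chains. -/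
theorem exists_chain {ρ : ℕ → Submodule k (V × V)} {n : ℕ} {s t : G →ₗ[k] V}
    (h : ∀ g, (s g, t g) ∈ word ρ n) :
    ∃ x : ℕ → G →ₗ[k] V, x 0 = s ∧ x n = t ∧ ∀ i < n, ∀ g, (x i g, x (i + 1) g) ∈ ρ i := by
  induction n generalizing t with
  | zero =>
    refine ⟨fun _ => s, rfl, ?_, fun i hi => absurd hi (Nat.not_lt_zero i)⟩
    ext g
    exact (mem_word_zero.1 (h g)).symm
  | succ n ih =>
    -- The vector before the last relation is chosen linearly in `g`; the induction hypothesis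
    -- supplies the earlier ones.
    let Z : Submodule k (G × V) :=
      (word ρ n).comap ((s ∘ₗ LinearMap.fst k G V).prod (LinearMap.snd k G V)) ⊓
      (ρ n).comap ((LinearMap.snd k G V).prod (t ∘ₗ LinearMap.fst k G V))
    obtain ⟨f, hf⟩ := exists_linearMap_of_total Z (fun g => by
      obtain ⟨y, h1, h2⟩ := h g
      exact ⟨y, h1, h2⟩)
    obtain ⟨x, h0, hn, hx⟩ := ih (t := f) (fun g => (hf g).1)
    refine ⟨fun i => if i ≤ n then x i else t, by simp [h0], by simp, fun i hi g => ?_⟩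
    rcases Nat.lt_succ_iff_lt_or_eq.1 hi with hi' | rfl
    · simp only [hi'.le, if_true, Nat.succ_le_of_lt hi']
      exact hx i hi' g
    · simp only [le_refl, if_true, show ¬ (i + 1 ≤ i) by omega, if_false, hn]
      exact (hf g).2

/-- Linear forms that are compatible with a composition of relations are parts of compatible
families. -/
theorem exists_cochain {ρ : ℕ → Submodule k (V × V)} {n : ℕ} {p q : V →ₗ[k] G}
    (h : ∀ x y, (x, y) ∈ word ρ n → p x = q y) :
    ∃ π : ℕ → V →ₗ[k] G, π 0 = p ∧ π n = q ∧
      ∀ i < n, ∀ x y, (x, y) ∈ ρ i → π i x = π (i + 1) y := by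
  induction n generalizing q with
  | zero =>
    refine ⟨fun _ => p, rfl, ?_, fun i hi => absurd hi (Nat.not_lt_zero i)⟩
    ext x
    exact h x x (mem_word_zero.2 rfl)
  | succ n ih =>
    -- The form before the last relation must equal `p x` at every `y` reached from `x` through
    -- `word ρ n`, and `q z` at every `y` related to `z` by `ρ n`. The hypothesis on the whole
    -- composition says that these prescriptions agree.
    let Z₁ : Submodule k (V × G) :=
      (word ρ n).map ((LinearMap.snd k V V).prod (p ∘ₗ LinearMap.fst k V V))
    let Z₂ : Submodule k (V × G) :=
      (ρ n).map ((LinearMap.fst k V V).prod (q ∘ₗ LinearMap.snd k V V))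
    obtain ⟨f, hf⟩ := exists_linearMap_of_singleValued (Z₁ ⊔ Z₂) (by
      intro g hg
      obtain ⟨_, ⟨⟨x, y⟩, hxy, rfl⟩, _, ⟨⟨y', z⟩, hyz, rfl⟩, hsum⟩ := Submodule.mem_sup.1 hg
      simp only [LinearMap.prod_apply, Function.prod_apply, LinearMap.snd_apply, LinearMap.comp_apply,
        LinearMap.fst_apply, Prod.mk_add_mk, Prod.mk.injEq] at hsum
      obtain ⟨h1, rfl⟩ := hsum
      have hy : y' = -y := by rw [eq_neg_iff_add_eq_zero, add_comm]; exact h1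
      subst hy
      have h2 : (y, -z) ∈ ρ n := by simpa using (ρ n).neg_mem hyz
      have := h x (-z) ⟨y, hxy, h2⟩
      rw [this, map_neg, neg_add_cancel])
    obtain ⟨π, h0, hn, hπ⟩ := ih (q := f) (fun x y hxy =>
      (hf (y, p x) (Submodule.mem_sup_left ⟨(x, y), hxy, rfl⟩)).symm)
    refine ⟨fun i => if i ≤ n then π i else q, by simp [h0], by simp, fun i hi x y hxy => ?_⟩
    rcases Nat.lt_succ_iff_lt_or_eq.1 hi with hi' | rfl
    · simp only [hi'.le, if_true, Nat.succ_le_of_lt hi']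
      exact hπ i hi' x y hxy
    · simp only [le_refl, if_true, show ¬ (i + 1 ≤ i) by omega, if_false, hn]
      exact hf (x, q y) (Submodule.mem_sup_right ⟨(x, y), hxy, rfl⟩)

/-- A matrix of operators that is unitriangular for a partial order is injective. -/
theorem injective_of_unitriangular {ι : Type*} [Fintype ι] {γ : Type*} [PartialOrder γ]
    (c : ι → γ) (T : ι → ι → G →ₗ[k] G) (hdiag : ∀ i, T i i = LinearMap.id)
    (hT : ∀ i j, i ≠ j → T j i ≠ 0 → c j < c i) (v : ι → G)
    (hv : ∀ j, ∑ i, T j i (v i) = 0) : v = 0 := by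
  classical
  by_contra hne
  obtain ⟨i₀, hi₀⟩ := Function.ne_iff.1 hne
  -- A nonzero coordinate with maximal `c j`: in row `j` any other nonzero term would come from an
  -- index with a still larger value of `c`.
  obtain ⟨j, hj, hmax⟩ := (Finset.univ.filter fun i => v i ≠ 0).exists_maximalFor c
    ⟨i₀, by simpa using hi₀⟩
  simp only [Finset.mem_filter, Finset.mem_univ, true_and] at hj hmax
  have h := hv j
  rw [Finset.sum_eq_single j, hdiag] at h
  · exact hj h
  · intro i _ hij
    by_contra h1
    have hvi : v i ≠ 0 := fun h2 => h1 (by rw [h2, map_zero])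
    have hTi : T j i ≠ 0 := fun h2 => h1 (by rw [h2, LinearMap.zero_apply])
    have hlt := hT i j hij hTi
    exact (hlt.trans_le (hmax hvi hlt.le)).false
  · simp

end LinRel

end

/-! ### Splitting off the automorphism part of a linear relation -/

noncomputable section

namespace LinRel

variable {k : Type*} [Field k] {V : Type*} [AddCommGroup V] [Module k V]
  {G : Type*} [AddCommGroup G] [Module k G]

theorem iterate_img_mono (R : Submodule k (V × V)) (n : ℕ) {A B : Submodule k V} (h : A ≤ B) :
    (img R)^[n] A ≤ (img R)^[n] B :=
  (show Monotone (img R) from fun _ _ => img_mono R).iterate n h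

theorem iterate_img_bot_mono (R : Submodule k (V × V)) : Monotone fun n => (img R)^[n] ⊥ :=
  monotone_nat_of_le_succ fun n => by
    rw [Function.iterate_succ_apply]; exact iterate_img_mono R n bot_le

theorem iterate_img_top_anti (R : Submodule k (V × V)) : Antitone fun n => (img R)^[n] ⊤ :=
  antitone_nat_of_succ_le fun n => by
    rw [Function.iterate_succ_apply]; exact iterate_img_mono R n le_top

theorem exists_stable (R : Submodule k (V × V)) [FiniteDimensional k V] :
    ∃ N, ∀ n ≥ N, (img R)^[n] ⊥ = (img R)^[N] ⊥ ∧ (img R)^[n] ⊤ = (img R)^[N] ⊤ := by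
  obtain ⟨N₁, h₁⟩ := WellFoundedGT.monotone_chain_condition
    (⟨_, iterate_img_bot_mono R⟩ : ℕ →o Submodule k V)
  obtain ⟨N₂, h₂⟩ := WellFoundedGT.monotone_chain_condition
    (⟨fun n => OrderDual.toDual ((img R)^[n] ⊤), fun m n h =>
      iterate_img_top_anti R h⟩ : ℕ →o (Submodule k V)ᵒᵈ)
  refine ⟨max N₁ N₂, fun n hn => ⟨?_, ?_⟩⟩
  · exact (h₁ n (le_trans (le_max_left _ _) hn)).symm.trans (h₁ _ (le_max_left _ _))
  · exact (h₂ n (le_trans (le_max_right _ _) hn)).symm.trans (h₂ _ (le_max_right _ _))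

/-- Solution of a twisted linear equation for values that are annihilated by a power of `R`. -/
theorem exists_solution (R : Submodule k (V × V)) (φ : G ≃ₗ[k] G) (N : ℕ) (e : G →ₗ[k] V)
    (he : ∀ g, e g ∈ (img R)^[N] ⊥) :
    ∃ h : G →ₗ[k] V, (∀ g, h g ∈ (img R)^[N] ⊥) ∧ ∀ g, (h g, h (φ g) + e g) ∈ R := by
  induction N generalizing e with
  | zero =>
    refine ⟨0, fun g => Submodule.zero_mem _, fun g => ?_⟩
    have : e g = 0 := he g
    rw [this, LinearMap.zero_apply, LinearMap.zero_apply, add_zero]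
    exact R.zero_mem
  | succ N ih =>
    -- A linear choice `e'` of elements related to the error `e` is one step closer to zero. If `h₂`
    -- solves the equation for `e' ∘ φ⁻¹`, subtracting the related pairs formed by `e` and `e'`
    -- shows that `h₂ - e ∘ φ⁻¹` solves it for `e`.
    let Z : Submodule k (G × V) :=
      R.comap ((e ∘ₗ LinearMap.fst k G V).prod (LinearMap.snd k G V)) ⊓
      ((img R)^[N] ⊥).comap (LinearMap.snd k G V)
    obtain ⟨e', he'⟩ := exists_linearMap_of_total Z (fun g => by
      have h1 := he g
      rw [Function.iterate_succ_apply'] at h1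
      obtain ⟨y, hy, h2⟩ := mem_img.1 h1
      exact ⟨y, h2, hy⟩)
    obtain ⟨h₂, hm, hR⟩ := ih (e' ∘ₗ φ.symm.toLinearMap) (fun g => (he' (φ.symm g)).2)
    refine ⟨h₂ - e ∘ₗ φ.symm.toLinearMap, fun g => ?_, fun g => ?_⟩
    · exact Submodule.sub_mem _ (iterate_img_bot_mono R (Nat.le_succ N) (hm g)) (he _)
    · have h1 : (e (φ.symm g), e' (φ.symm g)) ∈ R := (he' (φ.symm g)).1
      have h2 := R.sub_mem (hR g) h1
      simpa using h2

/-- Solution of a twisted linear equation for forms that vanish on the image of a power of `R`. -/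
theorem exists_cosolution (R : Submodule k (V × V)) (φ : G ≃ₗ[k] G) (N : ℕ) (e : V →ₗ[k] G)
    (he : ∀ x ∈ (img R)^[N] ⊤, e x = 0) :
    ∃ h : V →ₗ[k] G, (∀ x ∈ (img R)^[N] ⊤, h x = 0) ∧
      ∀ x y, (x, y) ∈ R → h y = φ (h x) - e y := by
  induction N generalizing e with
  | zero =>
    refine ⟨0, fun x _ => rfl, fun x y _ => ?_⟩
    simp [he y (by simp)]
  | succ N ih =>
    -- Dually, `e'` is to satisfy `e' y = e x` on `R` and to vanish on the `N`-th image of `R`. This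
    -- is consistent because `e` vanishes on the next image. A solution `h` for `φ ∘ e'` yields the
    -- solution `h - e` for `e`.
    let Z₁ : Submodule k (V × G) :=
      R.map ((LinearMap.snd k V V).prod (e ∘ₗ LinearMap.fst k V V))
    let Z₂ : Submodule k (V × G) := ((img R)^[N] ⊤).map (LinearMap.inl k V G)
    obtain ⟨e', he'⟩ := exists_linearMap_of_singleValued (Z₁ ⊔ Z₂) (by
      intro g hg
      obtain ⟨_, ⟨⟨x, y⟩, hxy, rfl⟩, _, ⟨z, hz, rfl⟩, hsum⟩ := Submodule.mem_sup.1 hg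
      simp only [LinearMap.prod_apply, Function.prod_apply, LinearMap.snd_apply, LinearMap.comp_apply,
        LinearMap.fst_apply, LinearMap.inl_apply, Prod.mk_add_mk, Prod.mk.injEq, add_zero] at hsum
      obtain ⟨h1, rfl⟩ := hsum
      apply he
      rw [Function.iterate_succ_apply']
      refine mem_img.2 ⟨y, ?_, hxy⟩
      rw [eq_neg_of_add_eq_zero_left h1]
      exact Submodule.neg_mem _ hz)
    have h₁ : ∀ x y, (x, y) ∈ R → e' y = e x := fun x y hxy =>
      he' (y, e x) (Submodule.mem_sup_left ⟨(x, y), hxy, rfl⟩)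
    have h₂ : ∀ z ∈ (img R)^[N] ⊤, e' z = 0 := fun z hz =>
      he' (z, 0) (Submodule.mem_sup_right ⟨z, hz, rfl⟩)
    obtain ⟨h, h3, h4⟩ := ih (φ.toLinearMap ∘ₗ e') (fun x hx => by simp [h₂ x hx])
    refine ⟨h - e, fun x hx => ?_, fun x y hxy => ?_⟩
    · rw [LinearMap.sub_apply, he x hx, h3 x (iterate_img_top_anti R (Nat.le_succ N) hx), sub_zero]
    · have := h4 x y hxy
      simp only [LinearMap.sub_apply, this, map_sub, LinearMap.comp_apply, LinearEquiv.coe_coe,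
        h₁ x y hxy]

/-- A form that is zero on `A` and equals `e` on `B` is well defined because `e` vanishes on the
intersection; its difference from `e` then vanishes on `B`. -/
theorem exists_add_of_vanishing (A B : Submodule k V) (e : V →ₗ[k] G)
    (he : ∀ x ∈ A ⊓ B, e x = 0) :
    ∃ e₁ e₂ : V →ₗ[k] G, e = e₁ + e₂ ∧ (∀ x ∈ A, e₁ x = 0) ∧ (∀ x ∈ B, e₂ x = 0) := by
  let Z₁ : Submodule k (V × G) := A.map (LinearMap.inl k V G)
  let Z₂ : Submodule k (V × G) := B.map (LinearMap.id.prod e)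
  obtain ⟨f, hf⟩ := exists_linearMap_of_singleValued (Z₁ ⊔ Z₂) (by
    intro g hg
    obtain ⟨_, ⟨a, ha, rfl⟩, _, ⟨b, hb, rfl⟩, hsum⟩ := Submodule.mem_sup.1 hg
    simp only [LinearMap.inl_apply, LinearMap.prod_apply, Function.prod_apply, LinearMap.id_apply,
      Prod.mk_add_mk, Prod.mk.injEq, zero_add] at hsum
    obtain ⟨h1, rfl⟩ := hsum
    refine he b ⟨?_, hb⟩
    rw [eq_neg_of_add_eq_zero_right h1]
    exact Submodule.neg_mem _ ha)
  refine ⟨f, e - f, by simp, fun x hx => hf (x, 0) (Submodule.mem_sup_left ⟨x, hx, rfl⟩),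
    fun x hx => ?_⟩
  have := hf (x, e x) (Submodule.mem_sup_right ⟨x, hx, rfl⟩)
  simp only at this
  simp [this]

theorem exists_add_of_mem_sup (A B : Submodule k V) (e : G →ₗ[k] V)
    (he : ∀ g, e g ∈ A ⊔ B) :
    ∃ e₁ e₂ : G →ₗ[k] V, e = e₁ + e₂ ∧ (∀ g, e₁ g ∈ A) ∧ (∀ g, e₂ g ∈ B) := by
  let Z : Submodule k (G × V) := A.comap (LinearMap.snd k G V) ⊓
    B.comap (e ∘ₗ LinearMap.fst k G V - LinearMap.snd k G V)
  obtain ⟨f, hf⟩ := exists_linearMap_of_total Z (fun g => by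
    obtain ⟨a, ha, b, hb, hab⟩ := Submodule.mem_sup.1 (he g)
    refine ⟨a, ha, ?_⟩
    simp [← hab, hb])
  exact ⟨f, e - f, by simp, fun g => (hf g).1, fun g => (hf g).2⟩

/-- The maps `s` and `t` make `φ` compatible with `R` only up to the nilpotent parts of `R` and of
its inverse. The discrepancy is split into these two parts, and each is removed by a twisted
equation, one for `R` and `φ`, the other for `inv R` and `φ⁻¹`. -/
theorem exists_section_of_mem_sup (R : Submodule k (V × V)) (φ : G ≃ₗ[k] G) (N : ℕ)
    (s t : G →ₗ[k] V) (hst : ∀ g, (s g, t g) ∈ R)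
    (h : ∀ g, t g - s (φ g) ∈ (img R)^[N] ⊥ ⊔ (img (inv R))^[N] ⊥) :
    ∃ s' : G →ₗ[k] V, (∀ g, s' g - s g ∈ (img R)^[N] ⊥ ⊔ (img (inv R))^[N] ⊥) ∧
      ∀ g, (s' g, s' (φ g)) ∈ R := by
  obtain ⟨e₁, e₂, he, h₁, h₂⟩ := exists_add_of_mem_sup _ _ (s ∘ₗ φ.toLinearMap - t) (fun g => by
    have := Submodule.neg_mem _ (h g)
    rwa [neg_sub] at this)
  obtain ⟨a, ha, haR⟩ := exists_solution R φ N e₁ h₁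
  obtain ⟨b, hb, hbR⟩ := exists_solution (inv R) φ.symm N (-(e₂ ∘ₗ φ.symm.toLinearMap))
    (fun g => Submodule.neg_mem _ (h₂ _))
  refine ⟨s + a + (b ∘ₗ φ.symm.toLinearMap - e₂ ∘ₗ φ.symm.toLinearMap), fun g => ?_, fun g => ?_⟩
  · have : (s + a + (b ∘ₗ φ.symm.toLinearMap - e₂ ∘ₗ φ.symm.toLinearMap)) g - s g =
        a g + (b (φ.symm g) - e₂ (φ.symm g)) := by
      simp only [LinearMap.add_apply, LinearMap.sub_apply, LinearMap.comp_apply,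
        LinearEquiv.coe_coe]
      abel
    rw [this]
    exact Submodule.add_mem_sup (ha g) (Submodule.sub_mem _ (hb _) (h₂ _))
  · have hb' : (b (φ.symm g) + (-(e₂ ∘ₗ φ.symm.toLinearMap)) g, b g) ∈ R := hbR g
    have h1 := R.add_mem (R.add_mem (hst g) (haR g)) hb'
    have h2 : s (φ g) - t g = e₁ g + e₂ g := LinearMap.congr_fun he g
    convert h1 using 1
    ext
    · simp only [LinearMap.add_apply, LinearMap.comp_apply, LinearEquiv.coe_coe,
        LinearMap.neg_apply, Prod.fst_add, sub_eq_add_neg]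
    · simp only [LinearMap.add_apply, LinearMap.sub_apply, LinearMap.comp_apply,
        LinearEquiv.coe_coe, Prod.snd_add, LinearEquiv.symm_apply_apply]
      rw [show s (φ g) = e₁ g + e₂ g + t g by rw [← h2]; abel]
      abel

/-- Dual to `exists_section_of_mem_sup`: the defect `p - φ ∘ q` vanishes on the intersection of the
two stable images, so it splits into one form vanishing on each of them, and the two are corrected
separately by `exists_cosolution`. -/
theorem exists_retraction_of_vanishing (R : Submodule k (V × V)) (φ : G ≃ₗ[k] G) (N : ℕ)
    (p q : V →ₗ[k] G) (hpq : ∀ x y, (x, y) ∈ R → p x = q y)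
    (h : ∀ x ∈ (img R)^[N] ⊤ ⊓ (img (inv R))^[N] ⊤, p x = φ (q x)) :
    ∃ p' : V →ₗ[k] G, (∀ x ∈ (img R)^[N] ⊤ ⊓ (img (inv R))^[N] ⊤, p' x = p x) ∧
      ∀ x y, (x, y) ∈ R → p' y = φ (p' x) := by
  obtain ⟨e₁, e₂, he, h₁, h₂⟩ := exists_add_of_vanishing ((img R)^[N] ⊤) ((img (inv R))^[N] ⊤)
    (p - φ.toLinearMap ∘ₗ q)
    (fun x hx => by simp [h x hx])
  obtain ⟨a, ha, haR⟩ := exists_cosolution R φ N e₁ h₁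
  obtain ⟨b, hb, hbR⟩ := exists_cosolution (inv R) φ.symm N (-e₂)
    (fun x hx => by simp [h₂ x hx])
  refine ⟨p + a + (b - e₂), fun x hx => ?_, fun x y hxy => ?_⟩
  · simp [ha x hx.1, hb x hx.2, h₂ x hx.2]
  · have h1 := haR x y hxy
    have h2 := hbR y x hxy
    have h3 : p y - φ (q y) = e₁ y + e₂ y := LinearMap.congr_fun he y
    have h5 : φ (b x) = b y + φ (e₂ x) := by
      rw [h2]; simp
    simp only [LinearMap.add_apply, LinearMap.sub_apply, map_add, map_sub, h1, h5]
    rw [hpq x y hxy, show p y = e₁ y + e₂ y + φ (q y) by rw [← h3]; abel]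
    abel

/-- A linear relation on a finite-dimensional space has a largest subquotient on which it is an
automorphism; this subquotient is a direct summand. -/
theorem exists_automorphism_summand [FiniteDimensional k V] (R : Submodule k (V × V))
    (hR : ∀ N, ¬ ((img R)^[N] ⊤ ⊓ (img (inv R))^[N] ⊤ ≤
      (img R)^[N] ⊥ ⊔ (img (inv R))^[N] ⊥)) :
    ∃ (d : ℕ) (φ : (Fin d → k) ≃ₗ[k] (Fin d → k)) (s : (Fin d → k) →ₗ[k] V)
      (p : V →ₗ[k] (Fin d → k)), 0 < d ∧ p ∘ₗ s = LinearMap.id ∧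
      (∀ g, (s g, s (φ g)) ∈ R) ∧ ∀ x y, (x, y) ∈ R → p y = φ (p x) := by
  obtain ⟨N₁, hN₁⟩ := exists_stable R
  obtain ⟨N₂, hN₂⟩ := exists_stable (inv R)
  -- Beyond `N` all four chains are stationary. `Dp` consists of the vectors from which `N` steps of
  -- `R` are possible, `Dm` of those for which these steps can end at zero; `Pp` and `Pm` are the
  -- same for the inverse relation. The bound `1 ≤ N` puts the kernel `img R ⊥` into `Dm`.
  obtain ⟨N, hN, h1⟩ : ∃ N, max N₁ N₂ ≤ N ∧ 1 ≤ N := ⟨max N₁ N₂ + 1, by omega, by omega⟩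
  have hst : ∀ (S : Submodule k (V × V)) (N' : ℕ), N' ≤ N → (∀ n ≥ N', (img S)^[n] ⊥ =
      (img S)^[N'] ⊥ ∧ (img S)^[n] ⊤ = (img S)^[N'] ⊤) →
      img S ((img S)^[N] ⊥) = (img S)^[N] ⊥ ∧ img S ((img S)^[N] ⊤) = (img S)^[N] ⊤ := by
    intro S N' hle h
    rw [← Function.iterate_succ_apply' (img S), ← Function.iterate_succ_apply' (img S)]
    exact ⟨(h _ (by omega)).1.trans (h _ (by omega)).1.symm,
      (h _ (by omega)).2.trans (h _ (by omega)).2.symm⟩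
  obtain ⟨hDm, hDp⟩ := hst R N₁ (by omega) hN₁
  obtain ⟨hPm, hPp⟩ := hst (inv R) N₂ (by omega) hN₂
  have hPle : (img (inv R))^[N] ⊥ ≤ (img (inv R))^[N] ⊤ := iterate_img_mono (inv R) N bot_le
  have hker : img R ⊥ ≤ (img R)^[N] ⊥ := iterate_img_bot_mono R h1
  have hRN := hR N
  set Dm := (img R)^[N] ⊥ with hDm_def
  set Pm := (img (inv R))^[N] ⊥ with hPm_def
  set Dp := (img R)^[N] ⊤ with hDp_def
  set Pp := (img (inv R))^[N] ⊤ with hPp_def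
  -- on the intersection of the images, `R` respects the sum of the two nilpotent parts
  have hback : ∀ u y, (u, y) ∈ R → u ∈ Dp ⊓ Pp → y ∈ Pp → y ∈ Dm ⊔ Pm → u ∈ Dm ⊔ Pm := by
    intro u y huy hu hyP hy
    obtain ⟨a, ha, a', ha', rfl⟩ := Submodule.mem_sup.1 hy
    have haP : a ∈ Pp := by simpa using Submodule.sub_mem _ hyP (hPle ha')
    obtain ⟨b, hb, hba⟩ := mem_img.1 (hPp.ge haP)
    obtain ⟨b', hb', hba'⟩ := mem_img.1 (hPm.ge ha')
    have hbD : b ∈ Dm := hDm.le (mem_img.2 ⟨a, ha, hba⟩)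
    have hc : u - (b + b') ∈ Dm := hker (mem_img.2 ⟨0, rfl, by
      simpa using R.sub_mem huy (R.add_mem hba hba')⟩)
    have : u = (u - (b + b') + b) + b' := by abel
    rw [this]
    exact Submodule.add_mem_sup (Submodule.add_mem _ hc hbD) hb'
  have hnext : ∀ u ∈ Dp ⊓ Pp, ∃ y ∈ Dp ⊓ Pp, (u, y) ∈ R := by
    rintro u ⟨hu1, hu2⟩
    obtain ⟨y, hy, huy⟩ := mem_img.1 (hDp.ge hu1)
    exact ⟨y, ⟨hy, hPp.le (mem_img.2 ⟨u, hu2, huy⟩)⟩, huy⟩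
  -- A space `U` of representatives of `Dp ⊓ Pp` modulo its intersection with `Dm ⊔ Pm`; on this
  -- subquotient `R` becomes an automorphism.
  obtain ⟨U', hU'⟩ := Submodule.exists_isCompl ((Dm ⊔ Pm) ⊓ (Dp ⊓ Pp))
  obtain ⟨U, hUC, hUK, hU⟩ : ∃ U : Submodule k V, U ≤ Dp ⊓ Pp ∧ (∀ u ∈ U, u ∈ Dm ⊔ Pm → u = 0) ∧
      ∀ x ∈ Dp ⊓ Pp, ∃ u ∈ U, x - u ∈ Dm ⊔ Pm := by
    refine ⟨U' ⊓ (Dp ⊓ Pp), inf_le_right, fun u hu hu' => ?_, fun x hx => ?_⟩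
    · exact Submodule.disjoint_def.1 hU'.disjoint u ⟨hu', hu.2⟩ hu.1
    · obtain ⟨a, ha, u, hu, rfl⟩ := Submodule.mem_sup.1 (hU'.codisjoint.eq_top.ge
        (Submodule.mem_top (x := x)))
      refine ⟨u, ⟨hu, ?_⟩, by simpa using ha.1⟩
      simpa using Submodule.sub_mem _ hx ha.2
  -- The relation induced by `R` on the representatives, modulo `Dm ⊔ Pm`. It is total by `hnext`,
  -- and a linear selection from it is injective by `hback`, hence bijective in finite dimension.
  let Z : Submodule k (U × U) :=
    ((R ⊓ (Dp ⊓ Pp).comap (LinearMap.snd k V V)).prod (⊤ : Submodule k V) ⊓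
      (Dm ⊔ Pm).comap (LinearMap.snd k V V ∘ₗ LinearMap.fst k (V × V) V - LinearMap.snd k (V × V) V)
      ).map (LinearMap.prodMap (LinearMap.fst k V V) LinearMap.id) |>.comap
        (LinearMap.prodMap U.subtype U.subtype)
  have hZ : ∀ u u' : U, (u, u') ∈ Z ↔ ∃ y ∈ Dp ⊓ Pp, ((u : V), y) ∈ R ∧ y - u' ∈ Dm ⊔ Pm := by
    intro u u'
    constructor
    · rintro ⟨⟨⟨a, y⟩, b⟩, ⟨⟨⟨h1, h2⟩, -⟩, h3⟩, h4⟩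
      obtain ⟨h5, h6⟩ := Prod.mk.inj h4
      change a = u at h5
      change b = u' at h6
      subst h5 h6
      exact ⟨y, h2, h1, h3⟩
    · rintro ⟨y, h1, h2, h3⟩
      exact ⟨⟨⟨u, y⟩, u'⟩, ⟨⟨⟨h2, h1⟩, trivial⟩, h3⟩, rfl⟩
  obtain ⟨f, hf⟩ := exists_linearMap_of_total Z (fun u => by
    obtain ⟨y, hy, huy⟩ := hnext u (hUC u.2)
    obtain ⟨u', hu', hyu⟩ := hU y hy
    exact ⟨⟨u', hu'⟩, (hZ _ _).2 ⟨y, hy, huy, hyu⟩⟩)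
  have hfinj : Function.Injective f := by
    rw [← LinearMap.ker_eq_bot, LinearMap.ker_eq_bot']
    intro u hu
    obtain ⟨y, hy, huy, hyu⟩ := (hZ _ _).1 (hf u)
    rw [hu, ZeroMemClass.coe_zero, sub_zero] at hyu
    exact Subtype.ext (hUK u u.2 (hback u y huy (hUC u.2) hy.2 hyu))
  let φ : U ≃ₗ[k] U := LinearEquiv.ofInjectiveEndo f hfinj
  have hφ : ∀ u, φ u = f u := fun u => rfl
  obtain ⟨t, ht⟩ := exists_linearMap_of_total
    (R.comap ((U.subtype ∘ₗ LinearMap.fst k U V).prod (LinearMap.snd k U V)) ⊓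
      (Dm ⊔ Pm).comap (LinearMap.snd k U V - U.subtype ∘ₗ f ∘ₗ LinearMap.fst k U V)) (fun u => by
    obtain ⟨y, -, huy, hyu⟩ := (hZ _ _).1 (hf u)
    exact ⟨y, huy, hyu⟩)
  obtain ⟨s, hsU, hsR⟩ := exists_section_of_mem_sup R φ N U.subtype t (fun u => (ht u).1)
    (fun u => (ht u).2)
  rw [← hDm_def, ← hPm_def] at hsU
  have hsD : ∀ n u, s u ∈ (img R)^[n] ⊤ := by
    intro n
    induction n with
    | zero => exact fun u => trivial
    | succ n ih =>
      intro u
      rw [Function.iterate_succ_apply']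
      exact mem_img.2 ⟨_, ih _, hsR u⟩
  have hsP : ∀ n u, s u ∈ (img (inv R))^[n] ⊤ := by
    intro n
    induction n with
    | zero => exact fun u => trivial
    | succ n ih =>
      intro u
      rw [Function.iterate_succ_apply']
      have := hsR (φ.symm u)
      rw [φ.apply_symm_apply] at this
      exact mem_img.2 ⟨_, ih _, this⟩
  -- the retraction
  have hsK : ∀ u, s u ∈ Dm ⊔ Pm → u = 0 := by
    intro u hu
    have : (u : V) ∈ Dm ⊔ Pm := by simpa using Submodule.sub_mem _ hu (hsU u)
    exact Subtype.ext (hUK u u.2 this)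
  obtain ⟨p₀, hp₀⟩ := exists_linearMap_of_singleValued
    ((Dm ⊔ Pm).map (LinearMap.inl k V U) ⊔ (LinearMap.range (s.prod LinearMap.id))) (by
    intro g hg
    obtain ⟨_, ⟨a, ha, rfl⟩, _, ⟨u, rfl⟩, hsum⟩ := Submodule.mem_sup.1 hg
    simp only [LinearMap.inl_apply, LinearMap.prod_apply, Function.prod_apply, LinearMap.id_apply,
      Prod.mk_add_mk, Prod.mk.injEq, zero_add] at hsum
    obtain ⟨h1, rfl⟩ := hsum
    refine hsK u ?_
    rw [eq_neg_of_add_eq_zero_right h1]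
    exact Submodule.neg_mem _ ha)
  have hp₀K : ∀ x ∈ Dm ⊔ Pm, p₀ x = 0 := fun x hx =>
    hp₀ (x, 0) (Submodule.mem_sup_left ⟨x, hx, rfl⟩)
  have hp₀s : ∀ u, p₀ (s u) = u := fun u => hp₀ (s u, u) (Submodule.mem_sup_right ⟨u, rfl⟩)
  -- The form `q₀` transports `p₀` along `R` and vanishes on `Dm`. This is consistent: whatever `R`
  -- relates to an element of `Dm` lies in `Dm` again, where `p₀` is zero.
  obtain ⟨q₀, hq₀⟩ := exists_linearMap_of_singleValued
    (Dm.map (LinearMap.inl k V U) ⊔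
      R.map ((LinearMap.snd k V V).prod (p₀ ∘ₗ LinearMap.fst k V V))) (by
    intro g hg
    obtain ⟨_, ⟨a, ha, rfl⟩, _, ⟨⟨x, y⟩, hxy, rfl⟩, hsum⟩ := Submodule.mem_sup.1 hg
    simp only [LinearMap.inl_apply, LinearMap.prod_apply, Function.prod_apply, LinearMap.comp_apply,
      LinearMap.fst_apply, LinearMap.snd_apply, Prod.mk_add_mk, Prod.mk.injEq, zero_add] at hsum
    obtain ⟨h1, rfl⟩ := hsum
    refine hp₀K x (Submodule.mem_sup_left (hDm.le (mem_img.2 ⟨y, ?_, hxy⟩)))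
    rw [eq_neg_of_add_eq_zero_right h1]
    exact Submodule.neg_mem _ ha)
  have hq₀R : ∀ x y, (x, y) ∈ R → p₀ x = q₀ y := fun x y hxy =>
    (hq₀ (y, p₀ x) (Submodule.mem_sup_right ⟨(x, y), hxy, rfl⟩)).symm
  have hq₀K : ∀ x ∈ Dm ⊔ Pm, q₀ x = 0 := by
    intro x hx
    obtain ⟨a, ha, b, hb, rfl⟩ := Submodule.mem_sup.1 hx
    obtain ⟨c, hc, hcb⟩ := mem_img.1 (hPm.ge hb)
    rw [map_add, hq₀ (a, 0) (Submodule.mem_sup_left ⟨a, ha, rfl⟩), ← hq₀R c b hcb,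
      hp₀K c (Submodule.mem_sup_right hc), add_zero]
  have hq₀s : ∀ u, φ (q₀ (s u)) = u := by
    intro u
    have := hsR (φ.symm u)
    rw [φ.apply_symm_apply] at this
    rw [← hq₀R _ _ this, hp₀s, φ.apply_symm_apply]
  -- Modulo `Dm ⊔ Pm`, where both forms vanish, every element of `Dp ⊓ Pp` is of the form `s u`, and
  -- there `p₀` and `φ ∘ q₀` agree.
  obtain ⟨p, hp, hpR⟩ := exists_retraction_of_vanishing R φ N p₀ q₀ hq₀R (fun x hx => by
    obtain ⟨u, hu, hxu⟩ := hU x hx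
    have h2 : x = s ⟨u, hu⟩ + (x - s ⟨u, hu⟩) := by abel
    have h3 : x - s ⟨u, hu⟩ ∈ Dm ⊔ Pm := by
      have := Submodule.sub_mem _ hxu (hsU ⟨u, hu⟩)
      simpa using this
    rw [h2, map_add, map_add, map_add, hp₀s, hq₀s, hp₀K _ h3, hq₀K _ h3, map_zero])
  let b := Module.finBasis k U
  refine ⟨Module.finrank k U, b.equivFun.symm ≪≫ₗ φ ≪≫ₗ b.equivFun,
    s ∘ₗ b.equivFun.symm.toLinearMap, b.equivFun.toLinearMap ∘ₗ p, ?_, ?_, fun g => ?_,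
    fun x y hxy => ?_⟩
  · rw [Module.finrank_pos_iff]
    by_contra hcon
    rw [not_nontrivial_iff_subsingleton] at hcon
    refine hRN fun x hx => ?_
    obtain ⟨u, hu, hxu⟩ := hU x hx
    have h0 : (⟨u, hu⟩ : U) = 0 := Subsingleton.elim _ _
    have : u = 0 := congrArg Subtype.val h0
    simpa [this] using hxu
  · refine LinearMap.ext fun g => ?_
    simp only [LinearMap.comp_apply, LinearEquiv.coe_coe, LinearMap.id_apply]
    rw [hp _ ⟨hsD N _, hsP N _⟩, hp₀s, LinearEquiv.apply_symm_apply]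
  · simpa using hsR (b.equivFun.symm g)
  · simp [hpR x y hxy]

end LinRel

end

/-! ### Filtrations indexed by sequences of digits -/

noncomputable section

namespace LinRel

variable {k : Type*} [Field k] {V : Type*} [AddCommGroup V] [Module k V]

/-- For `B ≤ A` and `L ≤ U` this says that the subquotients cut out on the two ends of `r` vanish
simultaneously. One subtracts related pairs to pass a decomposition from one end to the other. This
is what moves subquotients along letters. -/
theorem img_inf_le_iff (r : Submodule k (V × V)) (A B U L : Submodule k V) :
    img r A ⊓ U ≤ img r B ⊔ L ↔ A ⊓ img (inv r) U ≤ B ⊔ img (inv r) L := by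
  constructor
  · rintro h x' ⟨hx', hx⟩
    obtain ⟨x, hxU, hxx⟩ := mem_img.1 hx
    obtain ⟨b, hb, l, hl, rfl⟩ := Submodule.mem_sup.1 (h ⟨mem_img.2 ⟨x', hx', hxx⟩, hxU⟩)
    obtain ⟨b', hb', hbb⟩ := mem_img.1 hb
    refine Submodule.mem_sup.2 ⟨b', hb', x' - b', mem_img.2 ⟨l, hl, ?_⟩, by abel⟩
    simpa using r.sub_mem hxx hbb
  · rintro h x ⟨hx, hxU⟩
    obtain ⟨a, ha, hxa⟩ := mem_img.1 hx
    obtain ⟨b, hb, l', hl', rfl⟩ := Submodule.mem_sup.1 (h ⟨ha, mem_img.2 ⟨x, hxU, hxa⟩⟩)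
    obtain ⟨l, hl, hll⟩ := mem_img.1 hl'
    refine Submodule.mem_sup.2 ⟨x - l, mem_img.2 ⟨b, hb, ?_⟩, l, hl, by abel⟩
    simpa using r.sub_mem hxa hll

/-- In finite dimension both chains become stationary, so one vector and one form serve for all `n`.
-/
theorem exists_separating [FiniteDimensional k V] {A B : ℕ → Submodule k V} (hA : Antitone A)
    (hB : Monotone B) (h : ∀ n, ¬ A n ≤ B n) :
    ∃ (x : V) (ξ : V →ₗ[k] k), (∀ n, x ∈ A n) ∧ (∀ n, ∀ y ∈ B n, ξ y = 0) ∧ ξ x = 1 := by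
  obtain ⟨N₁, h₁⟩ := WellFoundedGT.monotone_chain_condition (⟨B, hB⟩ : ℕ →o Submodule k V)
  obtain ⟨N₂, h₂⟩ := WellFoundedGT.monotone_chain_condition
    (⟨fun n => OrderDual.toDual (A n), fun m n h => hA h⟩ : ℕ →o (Submodule k V)ᵒᵈ)
  set N := max N₁ N₂
  obtain ⟨x, hxA, hxB⟩ := SetLike.not_le_iff_exists.1 (h N)
  have hA' : ∀ n, A N ≤ A n := fun n => by
    rcases le_total n N with hn | hn
    · exact hA hn
    · have e : A N₂ = A N := h₂ N (le_max_right _ _)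
      have e' : A N₂ = A n := h₂ n ((le_max_right _ _).trans hn)
      exact (e.symm.trans e').le
  have hB' : ∀ n, B n ≤ B N := fun n => by
    rcases le_total n N with hn | hn
    · exact hB hn
    · have e : B N₁ = B N := h₁ N (le_max_left _ _)
      have e' : B N₁ = B n := h₁ n ((le_max_left _ _).trans hn)
      exact (e'.symm.trans e).le
  obtain ⟨ξ, hξ⟩ := exists_linearMap_of_singleValued
    ((B N).map (LinearMap.inl k V k) ⊔ Submodule.span k {(x, (1 : k))}) (by
    intro g hg
    obtain ⟨_, ⟨a, ha, rfl⟩, z, hz, hsum⟩ := Submodule.mem_sup.1 hg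
    obtain ⟨c, rfl⟩ := Submodule.mem_span_singleton.1 hz
    simp only [LinearMap.inl_apply, Prod.smul_mk, smul_eq_mul, mul_one, Prod.mk_add_mk,
      Prod.mk.injEq, zero_add] at hsum
    obtain ⟨h1, rfl⟩ := hsum
    by_contra hc
    refine hxB ?_
    have h2 : c • x ∈ B N := by
      rw [eq_neg_of_add_eq_zero_right h1]
      exact Submodule.neg_mem _ ha
    exact ((B N).smul_mem_iff hc).1 h2)
  refine ⟨x, ξ, fun n => hA' n hxA, fun n y hy => ?_, ?_⟩
  · exact hξ (y, 0) (Submodule.mem_sup_left ⟨y, hB' n hy, rfl⟩)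
  · exact hξ (x, 1) (Submodule.mem_sup_right (Submodule.mem_span_singleton_self _))

end LinRel

/-- A deterministic automaton with three transitions for every state, each of them equipped with a
linear relation; the transitions subdivide the space `X σ` of a state `σ` into three intervals. -/
structure RelSystem (k : Type*) [Field k] (V : Type*) [AddCommGroup V] [Module k V]
    (S : Type*) where
  X : S → Submodule k V
  nx : S → Fin 3 → S
  R : S → Fin 3 → Submodule k (V × V)
  img_zero_bot : ∀ σ, LinRel.img (R σ 0) ⊥ = ⊥
  img_zero : ∀ σ, LinRel.img (R σ 0) (X (nx σ 0)) = LinRel.img (R σ 1) ⊥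
  img_one : ∀ σ, LinRel.img (R σ 1) (X (nx σ 1)) = LinRel.img (R σ 2) ⊥
  img_two : ∀ σ, LinRel.img (R σ 2) (X (nx σ 2)) = X σ

namespace RelSystem

open LinRel

variable {k : Type*} [Field k] {V : Type*} [AddCommGroup V] [Module k V] {S : Type*}
  (A : RelSystem k V S)

/-- The state after `n` transitions. -/
def st (σ : S) (D : ℕ → Fin 3) : ℕ → S
  | 0 => σ
  | n + 1 => A.nx (st σ D n) (D n)

/-- The relations along a sequence of transitions. -/
def rels (σ : S) (D : ℕ → Fin 3) (n : ℕ) : Submodule k (V × V) := A.R (A.st σ D n) (D n)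

/-- The upper bound of the interval of the filtration given by the first `n` digits of `D`. -/
def up (σ : S) (D : ℕ → Fin 3) (n : ℕ) : Submodule k V :=
  img (word (A.rels σ D) n) (A.X (A.st σ D n))

/-- The lower bound of the interval of the filtration given by the first `n` digits of `D`. -/
def lo (σ : S) (D : ℕ → Fin 3) (n : ℕ) : Submodule k V := img (word (A.rels σ D) n) ⊥

theorem st_succ' (σ : S) (D : ℕ → Fin 3) (n : ℕ) :
    A.st σ D (n + 1) = A.st (A.nx σ (D 0)) (fun i => D (i + 1)) n := by
  induction n with
  | zero => rfl
  | succ n ih => rw [st, ih]; rfl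

theorem rels_succ' (σ : S) (D : ℕ → Fin 3) (n : ℕ) :
    A.rels σ D (n + 1) = A.rels (A.nx σ (D 0)) (fun i => D (i + 1)) n := by
  rw [rels, st_succ']; rfl

theorem word_rels_succ' (σ : S) (D : ℕ → Fin 3) (n : ℕ) :
    word (A.rels σ D) (n + 1) =
      comp (A.R σ (D 0)) (word (A.rels (A.nx σ (D 0)) (fun i => D (i + 1))) n) := by
  rw [word_succ']
  congr 2
  funext i
  exact A.rels_succ' σ D i

theorem up_zero (σ : S) (D : ℕ → Fin 3) : A.up σ D 0 = A.X σ := img_word_zero _ _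

theorem lo_zero (σ : S) (D : ℕ → Fin 3) : A.lo σ D 0 = ⊥ := img_word_zero _ _

theorem up_succ' (σ : S) (D : ℕ → Fin 3) (n : ℕ) :
    A.up σ D (n + 1) = img (A.R σ (D 0)) (A.up (A.nx σ (D 0)) (fun i => D (i + 1)) n) := by
  rw [up, word_rels_succ', img_comp, st_succ']; rfl

theorem lo_succ' (σ : S) (D : ℕ → Fin 3) (n : ℕ) :
    A.lo σ D (n + 1) = img (A.R σ (D 0)) (A.lo (A.nx σ (D 0)) (fun i => D (i + 1)) n) := by
  rw [lo, word_rels_succ', img_comp]; rfl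

theorem up_succ (σ : S) (D : ℕ → Fin 3) (n : ℕ) :
    A.up σ D (n + 1) = img (word (A.rels σ D) n)
      (img (A.R (A.st σ D n) (D n)) (A.X (A.nx (A.st σ D n) (D n)))) := by
  rw [← img_comp]; rfl

theorem lo_succ (σ : S) (D : ℕ → Fin 3) (n : ℕ) :
    A.lo σ D (n + 1) = img (word (A.rels σ D) n) (img (A.R (A.st σ D n) (D n)) ⊥) := by
  rw [← img_comp]; rfl

theorem img_le_img (σ : S) {d d' : Fin 3} (h : d < d') :
    img (A.R σ d) (A.X (A.nx σ d)) ≤ img (A.R σ d') ⊥ := by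
  have h01 := (A.img_zero σ).le
  have h12 := (A.img_one σ).le
  have h1 : img (A.R σ 1) ⊥ ≤ img (A.R σ 1) (A.X (A.nx σ 1)) := img_mono _ bot_le
  fin_cases d <;> fin_cases d' <;> simp at h
  · exact h01
  · exact h01.trans (h1.trans h12)
  · exact h12

theorem img_le (σ : S) (d : Fin 3) : img (A.R σ d) (A.X (A.nx σ d)) ≤ A.X σ := by
  have h2 := (A.img_two σ).le
  have h : img (A.R σ 2) ⊥ ≤ img (A.R σ 2) (A.X (A.nx σ 2)) := img_mono _ bot_le
  by_cases hd : d = 2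
  · subst hd; exact h2
  · exact (A.img_le_img σ (show d < 2 by omega)).trans (h.trans h2)

theorem up_antitone (σ : S) (D : ℕ → Fin 3) : Antitone (A.up σ D) :=
  antitone_nat_of_succ_le fun n => by
    rw [up_succ]
    exact img_mono _ (A.img_le _ _)

theorem lo_monotone (σ : S) (D : ℕ → Fin 3) : Monotone (A.lo σ D) :=
  monotone_nat_of_le_succ fun n => by
    rw [lo_succ]
    exact img_mono _ bot_le

theorem st_congr {σ : S} {D D' : ℕ → Fin 3} {n : ℕ} (h : ∀ i < n, D i = D' i) :
    A.st σ D n = A.st σ D' n := by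
  induction n with
  | zero => rfl
  | succ n ih => rw [st, st, ih fun i hi => h i (by omega), h n (by omega)]

/-- At the first different digit both sequences are in the same state, where the interval of the
smaller digit lies below that of the larger one. The common initial part transports this inclusion.
-/
theorem up_le_lo {σ : S} {D D' : ℕ → Fin 3} (h : toLex D < toLex D') :
    ∃ n, A.up σ D n ≤ A.lo σ D' n := by
  obtain ⟨n, hn, hlt⟩ := h
  have hn' : ∀ i < n, D i = D' i := hn
  have hlt' : D n < D' n := hlt
  refine ⟨n + 1, ?_⟩
  have hw : word (A.rels σ D) n = word (A.rels σ D') n := word_congr fun i hi => by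
    rw [rels, rels, A.st_congr fun j hj => hn' j (by omega), hn' i hi]
  rw [up_succ, lo_succ, hw, A.st_congr hn']
  exact img_mono _ (A.img_le_img _ hlt')

/-- The source of triangularity: a vector placed at `D` that is not killed by a form vanishing on
the lower bounds of `D'` forces `D' ≤ D`. -/
theorem toLex_le_of_mem {σ : S} {D D' : ℕ → Fin 3} {x : V} (hx : ∀ n, x ∈ A.up σ D n)
    (hx' : ∀ n, x ∉ A.lo σ D' n) : toLex D' ≤ toLex D := by
  by_contra h
  obtain ⟨n, hn⟩ := A.up_le_lo (σ := σ) (not_le.1 h)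
  exact hx' n (hn (hx n))

/-- The three intervals fill `X σ` from zero upwards. If each of them had zero trace on `U` modulo
`L`, descending through their bounds would give `X σ ⊓ U ≤ L`. -/
theorem exists_digit {σ : S} {U L : Submodule k V} (hLU : L ≤ U) (h : ¬ A.X σ ⊓ U ≤ L) :
    ∃ d, ¬ A.X (A.nx σ d) ⊓ img (inv (A.R σ d)) U ≤ img (inv (A.R σ d)) L := by
  by_contra! hcon
  have h' : ∀ d, img (A.R σ d) (A.X (A.nx σ d)) ⊓ U ≤ img (A.R σ d) ⊥ ⊔ L := fun d => by
    rw [img_inf_le_iff, bot_sup_eq]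
    exact hcon d
  have h0 := h' 0
  have h1 := h' 1
  have h2 := h' 2
  rw [A.img_zero_bot, A.img_zero, bot_sup_eq] at h0
  rw [A.img_one] at h1
  rw [A.img_two] at h2
  have step : ∀ {B C : Submodule k V}, B ⊓ U ≤ C ⊔ L → C ⊓ U ≤ L → B ⊓ U ≤ L := by
    rintro B C hBC hC x hx
    obtain ⟨c, hc, l, hl, rfl⟩ := Submodule.mem_sup.1 (hBC hx)
    have hcU : c ∈ U := by simpa using U.sub_mem hx.2 (hLU hl)
    exact L.add_mem (hC ⟨hc, hcU⟩) hl
  exact h (step h2 (step h1 h0))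

/-- An interval that is not contained in a given one meets one of the intervals of the filtration
given by infinite sequences of transitions. -/
theorem exists_sequence {σ : S} {U L : Submodule k V} (hLU : L ≤ U) (h : ¬ A.X σ ⊓ U ≤ L) :
    ∃ D : ℕ → Fin 3, ∀ n, ¬ A.up σ D n ⊓ U ≤ A.lo σ D n ⊔ L := by
  -- The choice of a digit is iterated, with `U` and `L` pulled back along the chosen transition
  -- each time; `T` consists of the data for which a further choice is possible.
  let T := {t : S × Submodule k V × Submodule k V // t.2.2 ≤ t.2.1 ∧ ¬ A.X t.1 ⊓ t.2.1 ≤ t.2.2}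
  choose d hd using fun t : T => A.exists_digit t.2.1 t.2.2
  let F : T → T := fun t => ⟨(A.nx t.1.1 (d t), img (inv (A.R t.1.1 (d t))) t.1.2.1,
    img (inv (A.R t.1.1 (d t))) t.1.2.2), img_mono _ t.2.1, hd t⟩
  have key : ∀ (n : ℕ) (t : T), ¬ A.up t.1.1 (fun i => d (F^[i] t)) n ⊓ t.1.2.1 ≤
      A.lo t.1.1 (fun i => d (F^[i] t)) n ⊔ t.1.2.2 := by
    intro n
    induction n with
    | zero =>
      intro t
      rw [up_zero, lo_zero, bot_sup_eq]
      exact t.2.2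
    | succ n ih =>
      intro t
      rw [up_succ', lo_succ', img_inf_le_iff]
      exact ih (F t)
  exact ⟨_, fun n => key n ⟨(σ, U, L), hLU, h⟩⟩

end RelSystem

end

noncomputable section

/-! ## Polarized representations -/

/-- A distribution of the arrows at every vertex of a quiver on two sides of that vertex, such that
on every side there is at most one arrow that ends, and at most one arrow that starts there. -/
structure Polarization (Q : Type u) [Quiver.{u} Q] where
  sin : Quiver.Total Q → Bool
  sout : Quiver.Total Q → Bool
  sin_inj : ∀ α β, α.right = β.right → sin α = sin β → α = β
  sout_inj : ∀ α β, α.left = β.left → sout α = sout β → α = β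

/-- A representation in which the composition of two arrows on the same side of a vertex is zero. -/
structure QuiverOps.IsPolarized {k : Type u} [Field k] {Q : Type u} [Quiver.{u} Q] {V : Type u}
    [AddCommGroup V] [Module k V] (M : QuiverOps k Q V) (pol : Polarization Q) : Prop where
  vertex_vertex : ∀ g x, M.vertex g (M.vertex g x) = M.vertex g x
  vertex_ne : ∀ g h x, g ≠ h → M.vertex g (M.vertex h x) = 0
  vertex_arrow : ∀ (α : Quiver.Total Q) x, M.vertex α.right (M.arrow α x) = M.arrow α x
  arrow_vertex : ∀ (α : Quiver.Total Q) x, M.arrow α (M.vertex α.left x) = M.arrow α x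
  arrow_arrow : ∀ (α β : Quiver.Total Q) x, β.right = α.left → pol.sin β = pol.sout α →
    M.arrow α (M.arrow β x) = 0

/-- The other side of the same vertex. -/
def oppositeSide {Q : Type u} (τ : Q × Bool) : Q × Bool := (τ.1, !τ.2)

@[simp] theorem oppositeSide_snd {Q : Type u} (τ : Q × Bool) : (oppositeSide τ).2 = !τ.2 := rfl

@[simp] theorem oppositeSide_oppositeSide {Q : Type u} (τ : Q × Bool) :
    oppositeSide (oppositeSide τ) = τ := by
  simp [oppositeSide]

theorem oppositeSide_ne {Q : Type u} (τ : Q × Bool) : oppositeSide τ ≠ τ := fun h => by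
  have := congrArg Prod.snd h
  simp at this

theorem eq_or_eq_oppositeSide {Q : Type u} {τ σ : Q × Bool} (h : τ.1 = σ.1) :
    τ = σ ∨ τ = oppositeSide σ := by
  by_cases hs : τ.2 = σ.2
  · exact Or.inl (Prod.ext h hs)
  · refine Or.inr (Prod.ext h ?_)
    revert hs
    simp only [oppositeSide_snd]
    cases τ.2 <;> cases σ.2 <;> simp

namespace Letter

variable {Q : Type u} [Quiver.{u} Q]

@[simp] theorem inverse_inverse (ℓ : Letter Q) : ℓ.inverse.inverse = ℓ := by cases ℓ <;> rfl

/-- The side of the start of a letter on which the letter lies. -/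
def first (pol : Polarization Q) : Letter Q → Q × Bool
  | dir α => (α.left, pol.sout α)
  | inv α => (α.right, pol.sin α)

/-- The side of the end of a letter that is opposite to the letter. -/
def last (pol : Polarization Q) : Letter Q → Q × Bool
  | dir α => (α.right, !pol.sin α)
  | inv α => (α.left, !pol.sout α)

/-- The position of a letter in the order of the words that start on a given side. -/
def digit : Letter Q → Fin 3
  | dir _ => 2
  | inv _ => 0

variable (pol : Polarization Q)

theorem first_fst (ℓ : Letter Q) : (ℓ.first pol).1 = ℓ.src := by cases ℓ <;> rfl

theorem last_fst (ℓ : Letter Q) : (ℓ.last pol).1 = ℓ.tgt := by cases ℓ <;> rfl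

theorem first_inverse (ℓ : Letter Q) : ℓ.inverse.first pol = oppositeSide (ℓ.last pol) := by
  cases ℓ <;> simp [first, last, inverse, oppositeSide]

theorem last_inverse (ℓ : Letter Q) : ℓ.inverse.last pol = oppositeSide (ℓ.first pol) := by
  cases ℓ <;> simp [first, last, inverse, oppositeSide]

theorem digit_inverse (ℓ : Letter Q) : ℓ.inverse.digit = Fin.rev ℓ.digit := by
  cases ℓ <;> rfl

theorem digit_ne_one (ℓ : Letter Q) : ℓ.digit ≠ 1 := by
  cases ℓ <;> simp [digit]

/-- At most one arrow starts and at most one ends on every side, so a word is determined by its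
initial side and its digits. -/
theorem ext_of_first {ℓ ℓ' : Letter Q} (h : ℓ.first pol = ℓ'.first pol)
    (h' : ℓ.digit = ℓ'.digit) : ℓ = ℓ' := by
  cases ℓ <;> cases ℓ' <;> simp only [first, digit, Prod.mk.injEq] at h h'
  · rw [pol.sout_inj _ _ h.1 h.2]
  · exact absurd h' (by decide)
  · exact absurd h' (by decide)
  · rw [pol.sin_inj _ _ h.1 h.2]

end Letter

namespace QuiverOps

open LinRel

variable {k : Type u} [Field k] {Q : Type u} [Quiver.{u} Q] {V : Type u}
    [AddCommGroup V] [Module k V] (M : QuiverOps k Q V) (pol : Polarization Q)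

/-- The relation given by a letter. -/
def letterRel : Letter Q → Submodule k (V × V)
  | .dir α => (LinearMap.ker (M.vertex α.left - LinearMap.id)).comap (LinearMap.fst k V V) ⊓
      LinearMap.graph (M.arrow α)
  | .inv α => LinRel.inv ((LinearMap.ker (M.vertex α.left - LinearMap.id)).comap
      (LinearMap.fst k V V) ⊓ LinearMap.graph (M.arrow α))

theorem mem_letterRel_dir {α : Quiver.Total Q} {x y : V} :
    (x, y) ∈ M.letterRel (.dir α) ↔ M.vertex α.left x = x ∧ y = M.arrow α x := by
  simp [letterRel, LinearMap.mem_graph_iff, sub_eq_zero]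

theorem mem_letterRel_inv {α : Quiver.Total Q} {x y : V} :
    (x, y) ∈ M.letterRel (.inv α) ↔ M.vertex α.left y = y ∧ x = M.arrow α y := by
  simp [letterRel, LinearMap.mem_graph_iff, sub_eq_zero]

theorem letterRel_inverse (ℓ : Letter Q) : M.letterRel ℓ.inverse = LinRel.inv (M.letterRel ℓ) := by
  cases ℓ <;> rfl

/-- The space of a state. -/
def stateSpace : Option (Q × Bool) → Submodule k V
  | none => ⊤
  | some τ => LinearMap.range (M.vertex τ.1)

variable {M pol}

theorem IsPolarized.mem_stateSpace (hM : M.IsPolarized pol) {τ : Q × Bool} {x : V} :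
    x ∈ M.stateSpace (some τ) ↔ M.vertex τ.1 x = x := by
  constructor
  · rintro ⟨y, rfl⟩
    exact hM.vertex_vertex _ _
  · exact fun h => ⟨x, h⟩

theorem IsPolarized.mem_of_mem_letterRel (hM : M.IsPolarized pol) {ℓ : Letter Q} {x y : V}
    (h : (x, y) ∈ M.letterRel ℓ) : M.vertex ℓ.src x = x ∧ M.vertex ℓ.tgt y = y := by
  cases ℓ with
  | dir α =>
    obtain ⟨h1, rfl⟩ := M.mem_letterRel_dir.1 h
    exact ⟨h1, hM.vertex_arrow α x⟩
  | inv α =>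
    obtain ⟨h1, rfl⟩ := M.mem_letterRel_inv.1 h
    exact ⟨hM.vertex_arrow α y, h1⟩

variable (M pol)

open Classical in
/-- The letter that starts on a given side and has a given digit. -/
def letterAt (σ : Option (Q × Bool)) (d : Fin 3) : Option (Letter Q) :=
  if h : ∃ ℓ : Letter Q, σ = some (ℓ.first pol) ∧ ℓ.digit = d then some h.choose else none

variable {pol} in
theorem letterAt_eq_some {σ : Option (Q × Bool)} {d : Fin 3} {ℓ : Letter Q} :
    letterAt pol σ d = some ℓ ↔ σ = some (ℓ.first pol) ∧ ℓ.digit = d := by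
  unfold letterAt
  split_ifs with h
  · rw [Option.some_inj]
    constructor
    · rintro rfl
      exact h.choose_spec
    · rintro ⟨h1, h2⟩
      refine Letter.ext_of_first pol ?_ (h.choose_spec.2.trans h2.symm)
      exact Option.some_inj.1 (h.choose_spec.1.symm.trans h1)
  · refine ⟨fun h' => by simp at h', fun h' => absurd ⟨ℓ, h'⟩ h⟩

/-- The next state. -/
def nextState (σ : Option (Q × Bool)) (d : Fin 3) : Option (Q × Bool) :=
  (letterAt pol σ d).map (Letter.last pol)

/-- The relation of the digits `0` and `2`. -/
def outerRel (σ : Option (Q × Bool)) (d : Fin 3) : Submodule k (V × V) :=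
  match letterAt pol σ d with
  | some ℓ => M.letterRel ℓ
  -- A missing letter must get an empty interval: for digit `0` both bounds become zero, for digit
  -- `2` both become the whole state space.
  | none => if d = 0 then ⊥ else (M.stateSpace σ).prod ⊤

/-- The relation of the digit `1`, at which a word ends. -/
def endRel (σ : Option (Q × Bool)) : Submodule k (V × V) :=
  -- This induces the identity on the kernel of the arrow that starts on the side modulo the image
  -- of the arrow that ends there. In the state `none`, where there are no letters, it is the
  -- equality relation.
  ((img (outerRel M pol σ 2) ⊥).prod (img (outerRel M pol σ 2) ⊥)) ⊓
    (img (outerRel M pol σ 0) ⊤).comap (LinearMap.fst k V V - LinearMap.snd k V V)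

theorem mem_endRel {σ : Option (Q × Bool)} {x y : V} : (x, y) ∈ endRel M pol σ ↔
    (x ∈ img (outerRel M pol σ 2) ⊥ ∧ y ∈ img (outerRel M pol σ 2) ⊥) ∧
      x - y ∈ img (outerRel M pol σ 0) ⊤ := Iff.rfl

variable {M pol}

/-- The vanishing of compositions on one side enters here: the image of the arrow that ends on the
side lies in the kernel of the arrow that starts there. -/
theorem IsPolarized.img_outerRel_le (hM : M.IsPolarized pol) (σ : Option (Q × Bool)) :
    img (outerRel M pol σ 0) ⊤ ≤ img (outerRel M pol σ 2) ⊥ := by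
  intro x hx
  obtain ⟨y, -, hy⟩ := mem_img.1 hx
  unfold outerRel at hy ⊢
  cases h0 : letterAt pol σ 0 with
  | none =>
    rw [h0] at hy
    simp only [if_true, Submodule.mem_bot, Prod.mk_eq_zero] at hy
    rw [hy.1]
    exact Submodule.zero_mem _
  | some ℓ =>
    rw [h0] at hy
    obtain ⟨h1, h2⟩ := letterAt_eq_some.1 h0
    simp only at hy
    have hx' : x ∈ M.stateSpace σ := by
      rw [h1, hM.mem_stateSpace, Letter.first_fst]
      exact (hM.mem_of_mem_letterRel hy).1
    cases ℓ with
    | dir α => exact absurd h2 (by simp [Letter.digit])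
    | inv α =>
      obtain ⟨h3, rfl⟩ := M.mem_letterRel_inv.1 hy
      cases h4 : letterAt pol σ 2 with
      | none =>
        exact mem_img.2 ⟨0, rfl, hx', trivial⟩
      | some ℓ =>
        obtain ⟨h5, h6⟩ := letterAt_eq_some.1 h4
        cases ℓ with
        | inv β => exact absurd h6 (by simp [Letter.digit])
        | dir β =>
          have h7 := Option.some_inj.1 (h1.symm.trans h5)
          simp only [Letter.first, Prod.mk.injEq] at h7
          refine mem_img.2 ⟨0, rfl, M.mem_letterRel_dir.2 ⟨?_, ?_⟩⟩
          · rw [← h7.1]; exact hM.vertex_arrow _ _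
          · exact (hM.arrow_arrow β α y h7.1 h7.2).symm

theorem img_outerRel_top (hM : M.IsPolarized pol) (σ : Option (Q × Bool)) (d : Fin 3) :
    img (outerRel M pol σ d) (M.stateSpace (nextState pol σ d)) =
      img (outerRel M pol σ d) ⊤ := by
  refine le_antisymm (img_mono _ le_top) fun x hx => ?_
  obtain ⟨y, -, hxy⟩ := mem_img.1 hx
  refine mem_img.2 ⟨y, ?_, hxy⟩
  unfold nextState
  unfold outerRel at hxy
  cases h : letterAt pol σ d with
  | none => exact trivial
  | some ℓ =>
    rw [h] at hxy
    rw [Option.map_some, hM.mem_stateSpace, Letter.last_fst]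
    exact (hM.mem_of_mem_letterRel hxy).2

theorem nextState_one (σ : Option (Q × Bool)) : nextState pol σ 1 = none := by
  unfold nextState
  cases h : letterAt pol σ 1 with
  | none => rfl
  | some ℓ => exact absurd (letterAt_eq_some.1 h).2 ℓ.digit_ne_one

/-- The automaton of a polarized representation. -/
def IsPolarized.system (hM : M.IsPolarized pol) : RelSystem k V (Option (Q × Bool)) where
  X := M.stateSpace
  nx := nextState pol
  R σ d := if d = 1 then endRel M pol σ else outerRel M pol σ d
  img_zero_bot σ := by
    rw [if_neg (by decide), eq_bot_iff]
    intro x hx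
    obtain ⟨y, rfl, hxy⟩ := mem_img.1 hx
    unfold outerRel at hxy
    cases h : letterAt pol σ 0 with
    | none =>
      rw [h] at hxy
      simpa using hxy
    | some ℓ =>
      rw [h] at hxy
      cases ℓ with
      | dir α => exact absurd (letterAt_eq_some.1 h).2 (by simp [Letter.digit])
      | inv α => simpa using (M.mem_letterRel_inv.1 hxy).2
  img_zero σ := by
    rw [if_neg (by decide), if_pos rfl, img_outerRel_top hM σ 0]
    ext x
    rw [mem_img (A := ⊥)]
    constructor
    · intro hx
      refine ⟨0, rfl, (mem_endRel M pol).2 ⟨⟨hM.img_outerRel_le σ hx, Submodule.zero_mem _⟩, ?_⟩⟩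
      rwa [sub_zero]
    · rintro ⟨y, rfl, h⟩
      simpa using ((mem_endRel M pol).1 h).2
  img_one σ := by
    rw [if_pos rfl, if_neg (by decide), nextState_one]
    ext x
    rw [mem_img (A := M.stateSpace none)]
    constructor
    · rintro ⟨y, -, h⟩
      exact ((mem_endRel M pol).1 h).1.1
    · intro h
      refine ⟨x, trivial, (mem_endRel M pol).2 ⟨⟨h, h⟩, ?_⟩⟩
      rw [sub_self]
      exact Submodule.zero_mem _
  img_two σ := by
    rw [if_neg (by decide), img_outerRel_top hM σ 2]
    unfold outerRel
    cases h : letterAt pol σ 2 with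
    | none =>
      ext x
      rw [mem_img]
      exact ⟨fun ⟨y, _, h1⟩ => h1.1, fun h1 => ⟨0, trivial, h1, trivial⟩⟩
    | some ℓ =>
      obtain ⟨rfl, h1⟩ := letterAt_eq_some.1 h
      ext x
      rw [hM.mem_stateSpace, Letter.first_fst, mem_img]
      constructor
      · rintro ⟨y, -, hxy⟩
        exact (hM.mem_of_mem_letterRel hxy).1
      · intro hx
        cases ℓ with
        | inv α => exact absurd h1 (by simp [Letter.digit])
        | dir α => exact ⟨_, trivial, M.mem_letterRel_dir.2 ⟨hx, rfl⟩⟩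

namespace IsPolarized

variable (hM : M.IsPolarized pol)

theorem system_R_letter (ℓ : Letter Q) :
    hM.system.R (some (ℓ.first pol)) ℓ.digit = M.letterRel ℓ := by
  have h : letterAt pol (some (ℓ.first pol)) ℓ.digit = some ℓ := letterAt_eq_some.2 ⟨rfl, rfl⟩
  change (if ℓ.digit = 1 then _ else _) = _
  rw [if_neg ℓ.digit_ne_one, outerRel, h]

theorem system_nx_letter (ℓ : Letter Q) :
    hM.system.nx (some (ℓ.first pol)) ℓ.digit = some (ℓ.last pol) := by
  have h : letterAt pol (some (ℓ.first pol)) ℓ.digit = some ℓ := letterAt_eq_some.2 ⟨rfl, rfl⟩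
  change nextState _ _ _ = _
  rw [nextState, h, Option.map_some]

theorem system_nx_one (σ : Option (Q × Bool)) : hM.system.nx σ 1 = none := nextState_one σ

/-- A digit that cuts out a nonzero interval belongs to a letter or to an end. -/
theorem eq_one_or_letter {σ : Option (Q × Bool)} {d : Fin 3}
    (h : ¬ img (hM.system.R σ d) (hM.system.X (hM.system.nx σ d)) ≤ img (hM.system.R σ d) ⊥) :
    d = 1 ∨ ∃ ℓ : Letter Q, σ = some (ℓ.first pol) ∧ ℓ.digit = d := by
  by_contra! hcon
  obtain ⟨h1, h2⟩ := hcon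
  have hnone : letterAt pol σ d = none := by
    by_contra h3
    obtain ⟨ℓ, hℓ⟩ := Option.ne_none_iff_exists'.1 h3
    obtain ⟨h4, h5⟩ := letterAt_eq_some.1 hℓ
    exact h2 ℓ h4 h5
  have hR : hM.system.R σ d = if d = 0 then ⊥ else (M.stateSpace σ).prod ⊤ := by
    change (if d = 1 then _ else _) = _
    rw [if_neg h1, outerRel, hnone]
  rw [hR] at h
  apply h
  intro x hx
  obtain ⟨y, hy, hxy⟩ := mem_img.1 hx
  split_ifs at hxy with h0
  · have : x = 0 := (Prod.mk_eq_zero.1 hxy).1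
    rw [this]
    exact Submodule.zero_mem _
  · rw [if_neg h0]
    exact mem_img.2 ⟨0, rfl, hxy.1, trivial⟩

end IsPolarized

end QuiverOps

end

/-! ### Positions in words and their subquotients -/

noncomputable section

theorem RelSystem.lo_le_up {k : Type*} [Field k] {V : Type*} [AddCommGroup V] [Module k V]
    {S : Type*} (A : RelSystem k V S) (σ : S) (D : ℕ → Fin 3) (m n : ℕ) :
    A.lo σ D m ≤ A.up σ D n :=
  (A.lo_monotone σ D (le_max_left m n)).trans
    ((LinRel.img_mono _ bot_le).trans (A.up_antitone σ D (le_max_right m n)))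

/-- A sequence of digits with one more digit in front. -/
def consDigit (d : Fin 3) (P : ℕ → Fin 3) : ℕ → Fin 3
  | 0 => d
  | n + 1 => P n

/-- A state, together with the two sequences of digits that lead away from it on both sides of its
vertex. -/
structure WordPosition (Q : Type u) : Type u where
  state : Option (Q × Bool)
  back : ℕ → Fin 3
  fwd : ℕ → Fin 3

namespace QuiverOps.IsPolarized

open LinRel

variable {k : Type u} [Field k] {Q : Type u} [Quiver.{u} Q] {V : Type u}
    [AddCommGroup V] [Module k V] {M : QuiverOps k Q V} {pol : Polarization Q}
    (hM : M.IsPolarized pol)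

/-- The move along the next letter. -/
def move (t : WordPosition Q) : WordPosition Q where
  state := hM.system.nx t.state (t.fwd 0)
  back := consDigit (Fin.rev (t.fwd 0)) t.back
  fwd := fun i => t.fwd (i + 1)

/-- The subquotient of the representation given by the position is not zero. -/
def IsGood (t : WordPosition Q) : Prop :=
  ∃ τ, t.state = some τ ∧ ∀ n,
    ¬ hM.system.up (some (oppositeSide τ)) t.back n ⊓ hM.system.up (some τ) t.fwd n ≤
      hM.system.lo (some (oppositeSide τ)) t.back n ⊔ hM.system.lo (some τ) t.fwd n

/-- The letter `ℓ` leads away from the position `t`. -/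
def IsNext (pol : Polarization Q) (t : WordPosition Q) (ℓ : Letter Q) : Prop :=
  t.state = some (ℓ.first pol) ∧ ℓ.digit = t.fwd 0

theorem IsNext.state_move {t : WordPosition Q} {ℓ : Letter Q} (h : IsNext pol t ℓ) :
    (hM.move t).state = some (ℓ.last pol) := by
  rw [← hM.system_nx_letter, ← h.1, h.2]
  rfl

theorem fwd_iterate_move (t : WordPosition Q) (i j : ℕ) :
    (hM.move^[i] t).fwd j = t.fwd (i + j) := by
  induction i generalizing j with
  | zero => rw [Nat.zero_add]; rfl
  | succ i ih =>
    rw [Function.iterate_succ_apply']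
    change (hM.move^[i] t).fwd (j + 1) = _
    rw [ih]
    congr 1
    omega

theorem state_iterate_move (t : WordPosition Q) (i : ℕ) :
    (hM.move^[i] t).state = hM.system.st t.state t.fwd i := by
  induction i with
  | zero => rfl
  | succ i ih =>
    rw [Function.iterate_succ_apply']
    change hM.system.nx (hM.move^[i] t).state ((hM.move^[i] t).fwd 0) = _
    rw [ih, fwd_iterate_move]
    rfl

variable {hM}

theorem IsGood.swap {τ : Q × Bool} {P D : ℕ → Fin 3} (h : hM.IsGood ⟨some τ, P, D⟩) :
    hM.IsGood ⟨some (oppositeSide τ), D, P⟩ := by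
  obtain ⟨τ', h1, h2⟩ := h
  obtain rfl := Option.some_inj.1 h1
  refine ⟨_, rfl, fun n => ?_⟩
  rw [oppositeSide_oppositeSide, inf_comm, sup_comm]
  exact h2 n

/-- A digit belonging to neither a letter nor an end has an empty interval, which would make the
subquotient of the position zero. -/
theorem IsGood.eq_one_or {t : WordPosition Q} (h : hM.IsGood t) (n : ℕ) :
    t.fwd n = 1 ∨ ∃ ℓ : Letter Q, hM.system.st t.state t.fwd n = some (ℓ.first pol) ∧
      ℓ.digit = t.fwd n := by
  apply hM.eq_one_or_letter
  obtain ⟨τ, h1, h2⟩ := h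
  intro hle
  refine h2 (n + 1) (inf_le_right.trans (le_trans ?_ le_sup_right))
  rw [hM.system.up_succ, hM.system.lo_succ, ← h1]
  exact img_mono _ hle

theorem IsGood.exists_next {t : WordPosition Q} (h : hM.IsGood t) (h0 : t.fwd 0 ≠ 1) :
    ∃ ℓ, IsNext pol t ℓ :=
  (h.eq_one_or 0).resolve_left h0

/-- The end leads to the state `none`, where no letter starts, so a good position can only continue
with ends. -/
theorem IsGood.fwd_eq_one {t : WordPosition Q} (h : hM.IsGood t) (h0 : t.fwd 0 = 1) (n : ℕ) :
    t.fwd n = 1 := by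
  suffices h1 : t.fwd n = 1 ∧ hM.system.st t.state t.fwd (n + 1) = none from h1.1
  induction n with
  | zero =>
    refine ⟨h0, ?_⟩
    change hM.system.nx _ (t.fwd 0) = none
    rw [h0, system_nx_one]
  | succ n ih =>
    have h2 : t.fwd (n + 1) = 1 := by
      rcases h.eq_one_or (n + 1) with h2 | ⟨ℓ, h2, -⟩
      · exact h2
      · rw [ih.2] at h2
        simp at h2
    refine ⟨h2, ?_⟩
    change hM.system.nx _ (t.fwd (n + 1)) = none
    rw [h2, system_nx_one]

variable (hM) in
theorem up_letter (ℓ : Letter Q) (D : ℕ → Fin 3) (hD : D 0 = ℓ.digit) (n : ℕ) :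
    hM.system.up (some (ℓ.first pol)) D (n + 1) =
      img (M.letterRel ℓ) (hM.system.up (some (ℓ.last pol)) (fun i => D (i + 1)) n) := by
  rw [hM.system.up_succ', hD, system_R_letter, system_nx_letter]

variable (hM) in
theorem lo_letter (ℓ : Letter Q) (D : ℕ → Fin 3) (hD : D 0 = ℓ.digit) (n : ℕ) :
    hM.system.lo (some (ℓ.first pol)) D (n + 1) =
      img (M.letterRel ℓ) (hM.system.lo (some (ℓ.last pol)) (fun i => D (i + 1)) n) := by
  rw [hM.system.lo_succ', hD, system_R_letter, system_nx_letter]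

-- Reversing a digit passes to the inverse letter, so the backward filtration after a step is
-- described by `up_letter` for that inverse.
variable (hM) in
theorem up_letter_inverse (ℓ : Letter Q) (P : ℕ → Fin 3) (n : ℕ) :
    hM.system.up (some (oppositeSide (ℓ.last pol))) (consDigit (Fin.rev ℓ.digit) P) (n + 1) =
      img (LinRel.inv (M.letterRel ℓ))
        (hM.system.up (some (oppositeSide (ℓ.first pol))) P n) := by
  rw [← Letter.first_inverse, ← Letter.last_inverse, ← letterRel_inverse,
    hM.up_letter ℓ.inverse _ (by rw [Letter.digit_inverse]; rfl)]
  rfl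

variable (hM) in
theorem lo_letter_inverse (ℓ : Letter Q) (P : ℕ → Fin 3) (n : ℕ) :
    hM.system.lo (some (oppositeSide (ℓ.last pol))) (consDigit (Fin.rev ℓ.digit) P) (n + 1) =
      img (LinRel.inv (M.letterRel ℓ))
        (hM.system.lo (some (oppositeSide (ℓ.first pol))) P n) := by
  rw [← Letter.first_inverse, ← Letter.last_inverse, ← letterRel_inverse,
    hM.lo_letter ℓ.inverse _ (by rw [Letter.digit_inverse]; rfl)]
  rfl

/-- By `img_inf_le_iff` the subquotients before and after the letter vanish together. A step
shortens the forward sequence and lengthens the backward one; monotonicity of the bounds absorbs the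
shift of the index. -/
theorem IsGood.move {t : WordPosition Q} (h : hM.IsGood t) (h0 : t.fwd 0 ≠ 1) :
    hM.IsGood (hM.move t) := by
  obtain ⟨ℓ, hℓ⟩ := h.exists_next h0
  obtain ⟨τ, h1, h2⟩ := h
  obtain rfl := Option.some_inj.1 (h1.symm.trans hℓ.1)
  refine ⟨_, hℓ.state_move hM, fun n hle => h2 (n + 1) ?_⟩
  rw [hM.up_letter ℓ _ hℓ.2.symm, hM.lo_letter ℓ _ hℓ.2.symm, inf_comm, sup_comm, img_inf_le_iff,
    ← up_letter_inverse, ← lo_letter_inverse, inf_comm, sup_comm, hℓ.2]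
  exact (inf_le_inf_right _ (hM.system.up_antitone _ _ (by omega))).trans
    (hle.trans (sup_le_sup_right (hM.system.lo_monotone _ _ (by omega)) _))

theorem IsGood.iterate_move {t : WordPosition Q} (h : hM.IsGood t) {n : ℕ}
    (hn : ∀ i < n, t.fwd i ≠ 1) : hM.IsGood (hM.move^[n] t) := by
  induction n with
  | zero => exact h
  | succ n ih =>
    rw [Function.iterate_succ_apply']
    refine (ih fun i hi => hn i (by omega)).move ?_
    rw [fwd_iterate_move]
    exact hn n (by omega)

theorem IsGood.exists_next_iterate {t : WordPosition Q} (h : hM.IsGood t) {n : ℕ}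
    (hn : ∀ i < n, t.fwd i ≠ 1) : ∀ i < n, ∃ ℓ, IsNext pol (hM.move^[i] t) ℓ := fun i hi =>
  (h.iterate_move fun j hj => hn j (by omega)).exists_next (by
    rw [fwd_iterate_move]; exact hn i hi)

variable (hM)

/-- The filtration from one side yields a sequence `P` with nonzero intervals. By finite dimension
its limit interval, from the union of the lower bounds to the intersection of the upper ones, is
still nonzero, and it is refined by the filtration from the other side. -/
theorem exists_isGood [FiniteDimensional k V] {g : Q} {x : V} (hx : M.vertex g x ≠ 0) :
    ∃ t, hM.IsGood t := by
  have hX : ∀ s, hM.system.X (some (g, s)) = LinearMap.range (M.vertex g) := fun s => rfl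
  have hne : ¬ hM.system.X (some (g, false)) ⊓ LinearMap.range (M.vertex g) ≤ ⊥ := fun h => by
    rw [hX, inf_idem] at h
    exact hx (h ⟨x, rfl⟩)
  obtain ⟨P, hP⟩ := hM.system.exists_sequence bot_le hne
  obtain ⟨y, ξ, hy, hξ, hyξ⟩ := exists_separating
    (fun m n h => inf_le_inf_right _ (hM.system.up_antitone (some (g, false)) P h))
    (fun m n h => sup_le_sup_right (hM.system.lo_monotone (some (g, false)) P h) _) hP
  have hne' : ¬ hM.system.X (some (g, true)) ⊓ ⨅ n, hM.system.up (some (g, false)) P n ≤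
      ⨆ n, hM.system.lo (some (g, false)) P n := fun h => by
    have h1 := h ⟨(hy 0).2, Submodule.mem_iInf _ |>.2 fun n => (hy n).1⟩
    have h2 : (⨆ n, hM.system.lo (some (g, false)) P n) ≤ LinearMap.ker ξ :=
      iSup_le fun n z hz => hξ n z (Submodule.mem_sup_left hz)
    have h3 : ξ y = 0 := h2 h1
    rw [h3] at hyξ
    exact zero_ne_one hyξ
  obtain ⟨D, hD⟩ := hM.system.exists_sequence
    (iSup_le fun m => le_iInf fun n => hM.system.lo_le_up _ _ m n) hne'
  refine ⟨⟨some (g, true), P, D⟩, _, rfl, fun n hle => hD n ?_⟩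
  rw [inf_comm, sup_comm]
  exact (inf_le_inf_right _ (iInf_le _ n)).trans (hle.trans (sup_le_sup_right
    (le_iSup (fun n => hM.system.lo (some (g, false)) P n) n) _))

/-- A word is different from its inverse. -/
theorem not_palindromic (m : ℕ) (t : WordPosition Q)
    (ht : ∀ i < m, ∃ ℓ, IsNext pol (hM.move^[i] t) ℓ) (τ : Q × Bool) (h1 : t.state = some τ)
    (h2 : (hM.move^[m] t).state = some (oppositeSide τ)) :
    t.fwd ≠ (hM.move^[m] t).back := by
  induction m using Nat.strong_induction_on generalizing t τ with
  | _ m ih =>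
    intro h3
    -- In a palindromic word the first letter is the inverse of the last. Removing both leaves a
    -- shorter palindromic word, until the word is empty and a side equals its opposite, or a single
    -- letter equals its own inverse.
    rcases m with _ | m
    · exact oppositeSide_ne τ (Option.some_inj.1 (h2.symm.trans h1))
    · obtain ⟨a, ha⟩ := ht 0 (by omega)
      obtain ⟨b, hb⟩ := ht m (by omega)
      rw [Function.iterate_succ_apply'] at h2 h3
      have ha' : IsNext pol t a := ha
      have h0 : t.fwd 0 = Fin.rev ((hM.move^[m] t).fwd 0) := congrFun h3 0
      rw [← hb.2, ← ha'.2, ← Letter.digit_inverse] at h0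
      have hab : a = b.inverse := by
        refine Letter.ext_of_first pol ?_ h0
        rw [Letter.first_inverse, ← Option.some_inj.1 (ha'.1.symm.trans h1).symm,
          Option.some_inj.1 ((hb.state_move hM).symm.trans h2), oppositeSide_oppositeSide]
      rcases m with _ | m
      · have : a = b := Letter.ext_of_first pol
          (Option.some_inj.1 (ha'.1.symm.trans hb.1)) (ha'.2.trans hb.2.symm)
        rw [hab] at this
        cases b <;> simp [Letter.inverse] at this
      · refine ih m (by omega) (hM.move t) (fun i hi => ?_) (a.last pol) (ha'.state_move hM) ?_ ?_
        · obtain ⟨ℓ, hℓ⟩ := ht (i + 1) (by omega)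
          exact ⟨ℓ, by rwa [Function.iterate_succ_apply] at hℓ⟩
        · rw [← Function.iterate_succ_apply, hb.1, hab, Letter.last_inverse,
            oppositeSide_oppositeSide]
        · rw [← Function.iterate_succ_apply]
          funext i
          exact congrFun h3 (i + 1)

/-- Families of vectors and of linear forms that represent a direct summand of the subquotient
given by a position. -/
structure IsPlaced {G : Type*} [AddCommGroup G] [Module k G] (τ : Q × Bool) (P D : ℕ → Fin 3)
    (x : G →ₗ[k] V) (p : V →ₗ[k] G) : Prop where
  mem_fwd : ∀ n g, x g ∈ hM.system.up (some τ) D n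
  mem_back : ∀ n g, x g ∈ hM.system.up (some (oppositeSide τ)) P n
  vanish_fwd : ∀ n, ∀ y ∈ hM.system.lo (some τ) D n, p y = 0
  vanish_back : ∀ n, ∀ y ∈ hM.system.lo (some (oppositeSide τ)) P n, p y = 0
  comp_eq : ∀ g, p (x g) = g

theorem IsGood.exists_isPlaced [FiniteDimensional k V] {τ : Q × Bool} {P D : ℕ → Fin 3}
    (h : hM.IsGood ⟨some τ, P, D⟩) :
    ∃ (x : k →ₗ[k] V) (p : V →ₗ[k] k), hM.IsPlaced τ P D x p := by
  obtain ⟨τ', h1, h2⟩ := h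
  obtain rfl := Option.some_inj.1 h1
  obtain ⟨x, ξ, hx, hξ, hxξ⟩ := exists_separating
    (fun m n h => inf_le_inf (hM.system.up_antitone _ _ h) (hM.system.up_antitone _ _ h))
    (fun m n h => sup_le_sup (hM.system.lo_monotone _ _ h) (hM.system.lo_monotone _ _ h)) h2
  refine ⟨LinearMap.toSpanSingleton k V x, ξ, fun n g => ?_, fun n g => ?_, fun n y hy => ?_,
    fun n y hy => ?_, fun g => ?_⟩
  · exact Submodule.smul_mem _ g (hx n).2
  · exact Submodule.smul_mem _ g (hx n).1
  · exact hξ n y (Submodule.mem_sup_right hy)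
  · exact hξ n y (Submodule.mem_sup_left hy)
  · simp [hxξ]

theorem IsPlaced.vertex_apply {G : Type*} [AddCommGroup G] [Module k G] {hM : M.IsPolarized pol}
    {τ : Q × Bool} {P D : ℕ → Fin 3} {x : G →ₗ[k] V} {p : V →ₗ[k] G}
    (h : hM.IsPlaced τ P D x p) (g : G) : M.vertex τ.1 (x g) = x g := by
  have := h.mem_fwd 0 g
  rw [hM.system.up_zero] at this
  exact hM.mem_stateSpace.1 this

/-- Families at different positions are independent. -/
theorem eq_zero_of_isPlaced {G : Type*} [AddCommGroup G] [Module k G] {ι : Type*} [Fintype ι]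
    (τ : ι → Q × Bool) (P D : ι → ℕ → Fin 3) (x : ι → G →ₗ[k] V) (p : ι → V →ₗ[k] G)
    (h : ∀ i, hM.IsPlaced (τ i) (P i) (D i) (x i) (p i))
    (hne : ∀ i j, i ≠ j → τ i = τ j → P i = P j → D i ≠ D j)
    (hne' : ∀ i j, τ j = oppositeSide (τ i) → D i = P j → P i ≠ D j)
    (v : ι → G) (hv : ∀ j, p j (M.vertex (τ j).1 (∑ i, x i (v i))) = 0) : v = 0 := by
  -- The pair of sequences on the `true` side and on the `false` side of the vertex, whichever of
  -- them is the forward one. If the form at `j` does not kill a vector at `i`, both sequences of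
  -- `j` are at most those of `i`, and the hypotheses exclude equality of the pairs.
  let c : ι → Lex (ℕ → Fin 3) × Lex (ℕ → Fin 3) := fun i =>
    (toLex (if (τ i).2 then D i else P i), toLex (if (τ i).2 then P i else D i))
  refine injective_of_unitriangular c (fun j i => p j ∘ₗ M.vertex (τ j).1 ∘ₗ x i) (fun i => ?_)
    (fun i j hij hT => ?_) v (fun j => ?_)
  · refine LinearMap.ext fun g => ?_
    simp only [LinearMap.comp_apply, LinearMap.id_apply, (h i).vertex_apply, (h i).comp_eq]
  · obtain ⟨g, hg⟩ : ∃ g, p j (M.vertex (τ j).1 (x i g)) ≠ 0 := by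
      by_contra! hcon
      exact hT (LinearMap.ext hcon)
    have hτ : (τ j).1 = (τ i).1 := by
      by_contra hcon
      apply hg
      rw [← (h i).vertex_apply, hM.vertex_ne _ _ _ hcon, map_zero]
    rw [hτ, (h i).vertex_apply] at hg
    have hlo : ∀ n, x i g ∉ hM.system.lo (some (τ j)) (D j) n := fun n hn =>
      hg ((h j).vanish_fwd n _ hn)
    have hlo' : ∀ n, x i g ∉ hM.system.lo (some (oppositeSide (τ j))) (P j) n := fun n hn =>
      hg ((h j).vanish_back n _ hn)
    have hup := fun n => (h i).mem_fwd n g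
    have hup' := fun n => (h i).mem_back n g
    have hle : c j ≤ c i ∧ c j ≠ c i := by
      by_cases hs : (τ j).2 = (τ i).2
      · have hτ' : τ j = τ i := Prod.ext hτ hs
        rw [hτ'] at hlo hlo'
        have h1 := hM.system.toLex_le_of_mem hup hlo
        have h2 := hM.system.toLex_le_of_mem hup' hlo'
        simp only [c, hτ']
        cases (τ i).2
        · exact ⟨⟨h2, h1⟩, fun he => hne j i hij.symm hτ' (congrArg Prod.fst he)
            (congrArg Prod.snd he)⟩
        · exact ⟨⟨h1, h2⟩, fun he => hne j i hij.symm hτ' (congrArg Prod.snd he)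
            (congrArg Prod.fst he)⟩
      · have hs' : (τ j).2 = !(τ i).2 := by
          revert hs; cases (τ j).2 <;> cases (τ i).2 <;> simp
        have hτ' : τ j = oppositeSide (τ i) := Prod.ext hτ hs'
        rw [hτ'] at hlo hlo'
        rw [oppositeSide_oppositeSide] at hlo'
        have h1 := hM.system.toLex_le_of_mem hup hlo'
        have h2 := hM.system.toLex_le_of_mem hup' hlo
        simp only [c, hs']
        cases (τ i).2
        · exact ⟨⟨h2, h1⟩, fun he => hne' i j hτ' (congrArg Prod.snd he).symm
            (congrArg Prod.fst he).symm⟩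
        · exact ⟨⟨h1, h2⟩, fun he => hne' i j hτ' (congrArg Prod.fst he).symm
            (congrArg Prod.snd he).symm⟩
    exact lt_of_le_of_ne hle.1 hle.2
  · have := hv j
    rw [map_sum, map_sum] at this
    exact this

/-- Along an infinite word some position is repeated. -/
theorem exists_repetition [FiniteDimensional k V] {t : WordPosition Q} (ht : hM.IsGood t)
    (hinf : ∀ i, t.fwd i ≠ 1) : ∃ i j, i < j ∧ hM.move^[i] t = hM.move^[j] t := by
  by_contra! hcon
  have hgood : ∀ i, hM.IsGood (hM.move^[i] t) := fun i => ht.iterate_move fun j _ => hinf j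
  have hnext : ∀ i, ∃ ℓ, IsNext pol (hM.move^[i] t) ℓ := fun i =>
    ht.exists_next_iterate (n := i + 1) (fun j _ => hinf j) i (Nat.lt_succ_self i)
  have hex : ∀ i : ℕ, ∃ (τ : Q × Bool) (x : k →ₗ[k] V) (p : V →ₗ[k] k),
      (hM.move^[i] t).state = some τ ∧
      hM.IsPlaced τ (hM.move^[i] t).back (hM.move^[i] t).fwd x p := by
    intro i
    obtain ⟨τ, hτ, -⟩ := hgood i
    have h1 := hgood i
    rw [show hM.move^[i] t = ⟨some τ, (hM.move^[i] t).back, (hM.move^[i] t).fwd⟩ by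
      rw [← hτ]] at h1
    obtain ⟨x, p, hxp⟩ := IsGood.exists_isPlaced hM h1
    exact ⟨τ, x, p, hτ, hxp⟩
  choose τ x p hτ hxp using hex
  have hpal : ∀ i j, i ≤ j → τ j = oppositeSide (τ i) →
      (hM.move^[i] t).fwd ≠ (hM.move^[j] t).back := by
    intro i j hij h1
    obtain ⟨m, rfl⟩ := Nat.exists_eq_add_of_le' hij
    rw [Function.iterate_add_apply]
    refine hM.not_palindromic m _ (fun l hl => ?_) (τ i) (hτ i) ?_
    · rw [← Function.iterate_add_apply]; exact hnext _
    · rw [← Function.iterate_add_apply, hτ, h1]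
  -- If no position recurred, the vectors at the first `finrank k V + 1` positions would be
  -- independent.
  let f : (Fin (Module.finrank k V + 1) → k) →ₗ[k] V :=
    ∑ i : Fin (Module.finrank k V + 1), x i ∘ₗ LinearMap.proj i
  have hf : Function.Injective f := by
    rw [← LinearMap.ker_eq_bot, LinearMap.ker_eq_bot']
    intro v hv
    have hv' : ∑ i : Fin (Module.finrank k V + 1), x i (v i) = 0 := by
      simpa [f] using hv
    refine hM.eq_zero_of_isPlaced (fun i : Fin (Module.finrank k V + 1) => τ i) _ _
      (fun i => x i) (fun i => p i) (fun i => hxp i) ?_ ?_ v (fun j => by rw [hv', map_zero, map_zero])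
    · intro i j hij h1 h2 h3
      have heq : hM.move^[i] t = hM.move^[j] t := by
        have hi := hτ i
        have hj := hτ j
        rw [h1, ← hj] at hi
        cases hA : hM.move^[i] t
        cases hB : hM.move^[j] t
        simp only [hA, hB] at hi h2 h3
        rw [hi, h2, h3]
      rcases lt_or_gt_of_ne (fun h => hij (Fin.ext h) : (i : ℕ) ≠ j) with h | h
      · exact hcon i j h heq
      · exact hcon j i h heq.symm
    · intro i j h1 h2 h3
      rcases le_total (i : ℕ) j with h | h
      · exact hpal i j h h1 h2
      · exact hpal j i h (by rw [h1, oppositeSide_oppositeSide]) h3.symm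
  have := LinearMap.finrank_le_finrank_of_injective hf
  simp at this

end QuiverOps.IsPolarized

end

/-! ### Patterns of placed vectors and forms as direct summands -/

noncomputable section

namespace QuiverOps

variable {k : Type u} [Field k] {Q : Type u} [Quiver.{u} Q] {V W : Type u}
    [AddCommGroup V] [Module k V] [AddCommGroup W] [Module k W]

/-- Homomorphisms of representations. -/
structure IsHom (X : QuiverOps k Q V) (Y : QuiverOps k Q W) (f : V →ₗ[k] W) : Prop where
  vertex : ∀ g x, f (X.vertex g x) = Y.vertex g (f x)
  arrow : ∀ α x, f (X.arrow α x) = Y.arrow α (f x)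

/-- The representation is nonzero and has no nontrivial idempotent endomorphisms. -/
structure IsConnected (X : QuiverOps k Q V) : Prop where
  nontrivial : Nontrivial V
  idempotent : ∀ f : V →ₗ[k] V, X.IsHom X f → f ∘ₗ f = f → f = 0 ∨ f = LinearMap.id

/-- A representation without nontrivial idempotents is isomorphic to each of its nonzero direct
summands. -/
theorem IsConnected.iso {X : QuiverOps k Q V} {Y : QuiverOps k Q W} (hX : X.IsConnected)
    [FiniteDimensional k W] [Nontrivial W] {f : W →ₗ[k] V} {r : V →ₗ[k] W} (hf : Y.IsHom X f)
    (hr : X.IsHom Y r) (hinj : Function.Injective (r ∘ₗ f)) : X.Iso Y := by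
  let u : W ≃ₗ[k] W := LinearEquiv.ofInjectiveEndo (r ∘ₗ f) hinj
  have hu : ∀ w, u w = r (f w) := fun w => rfl
  have hv : ∀ g w, u.symm (Y.vertex g w) = Y.vertex g (u.symm w) := fun g w => by
    rw [LinearEquiv.symm_apply_eq, hu, hf.vertex, hr.vertex, ← hu, LinearEquiv.apply_symm_apply]
  have ha : ∀ α w, u.symm (Y.arrow α w) = Y.arrow α (u.symm w) := fun α w => by
    rw [LinearEquiv.symm_apply_eq, hu, hf.arrow, hr.arrow, ← hu, LinearEquiv.apply_symm_apply]
  have hfinj : Function.Injective f := fun a b hab => hinj (congrArg r hab)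
  -- The endomorphism `f ∘ u⁻¹ ∘ r` is idempotent, and it is not zero because it fixes the image of
  -- the injective map `f`; hence it is the identity and `f` is surjective.
  rcases hX.idempotent (f ∘ₗ u.symm.toLinearMap ∘ₗ r)
    ⟨fun g x => by simp [hr.vertex, hv, hf.vertex], fun α x => by simp [hr.arrow, ha, hf.arrow]⟩
    (LinearMap.ext fun x => by simp [← hu]) with h | h
  · obtain ⟨w, hw⟩ := exists_ne (0 : W)
    refine absurd (hfinj ?_) hw
    have := LinearMap.congr_fun h (f w)
    simpa [← hu] using this
  · let e : W ≃ₗ[k] V := LinearEquiv.ofBijective f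
      ⟨hfinj, fun x => ⟨_, LinearMap.congr_fun h x⟩⟩
    have he : ∀ w, e w = f w := fun w => rfl
    refine ⟨e.symm, fun g x => ?_, fun α x => ?_⟩
    · rw [LinearEquiv.symm_apply_eq, he, hf.vertex, ← he, LinearEquiv.apply_symm_apply]
    · rw [LinearEquiv.symm_apply_eq, he, hf.arrow, ← he, LinearEquiv.apply_symm_apply]

namespace IsPolarized

open LinRel

variable {M : QuiverOps k Q V} {pol : Polarization Q} {hM : M.IsPolarized pol}
  {G : Type u} [AddCommGroup G] [Module k G]

/-- The intervals of the digits below `2` lie below the lower bound of digit `2`, which is the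
kernel of the arrow starting on this side. -/
theorem arrow_eq_zero_of_mem_up {τ : Q × Bool} {D : ℕ → Fin 3} {x : V}
    (hx : x ∈ hM.system.up (some τ) D 1) {α : Quiver.Total Q} (hα : (Letter.dir α).first pol = τ)
    (hD : D 0 ≠ 2) : M.arrow α x = 0 := by
  subst hα
  rw [hM.system.up_succ', hM.system.up_zero] at hx
  have h1 := hM.system.img_le_img _ (show D 0 < 2 by omega) hx
  obtain ⟨y, rfl, h2⟩ := mem_img.1 h1
  rw [show (2 : Fin 3) = (Letter.dir α).digit from rfl, hM.system_R_letter] at h2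
  exact (M.mem_letterRel_dir.1 h2).2.symm

/-- The interval of digit `0` fills the image of the arrow ending on this side, and the lower bounds
of the larger digits contain it. -/
theorem arrow_mem_lo {τ : Q × Bool} {D : ℕ → Fin 3} {α : Quiver.Total Q}
    (hα : (Letter.inv α).first pol = τ) (hD : D 0 ≠ 0) (y : V) :
    M.arrow α y ∈ hM.system.lo (some τ) D 1 := by
  subst hα
  rw [hM.system.lo_succ', hM.system.lo_zero]
  refine hM.system.img_le_img _ (show 0 < D 0 by omega) ?_
  rw [show (0 : Fin 3) = (Letter.inv α).digit from rfl, hM.system_R_letter, hM.system_nx_letter]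
  refine mem_img.2 ⟨M.vertex α.left y, hM.mem_stateSpace.2 (hM.vertex_vertex _ _),
    M.mem_letterRel_inv.2 ⟨hM.vertex_vertex _ _, (hM.arrow_vertex _ _).symm⟩⟩

/-- A family of placed vectors and forms that are connected by letters. -/
structure IsPattern (hM : M.IsPolarized pol) {ι κ : Type} (s t : κ → ι) (L : κ → Letter Q)
    (ψ : κ → G ≃ₗ[k] G) (τ : ι → Q × Bool) (P D : ι → ℕ → Fin 3) (x : ι → G →ₗ[k] V)
    (p : ι → V →ₗ[k] G) : Prop where
  placed : ∀ i, hM.IsPlaced (τ i) (P i) (D i) (x i) (p i)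
  ne : ∀ i j, i ≠ j → τ i = τ j → P i = P j → D i ≠ D j
  ne' : ∀ i j, τ j = oppositeSide (τ i) → D i = P j → P i ≠ D j
  s_inj : Function.Injective s
  t_inj : Function.Injective t
  first_eq : ∀ j, (L j).first pol = τ (s j)
  digit_eq : ∀ j, (L j).digit = D (s j) 0
  last_eq : ∀ j, (L j).last pol = τ (t j)
  rev_digit_eq : ∀ j, Fin.rev (L j).digit = P (t j) 0
  fwd_end : ∀ i, D i 0 ≠ 1 → ∃ j, s j = i
  back_end : ∀ i, P i 0 ≠ 1 → ∃ j, t j = i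
  chain : ∀ j c, (x (s j) c, x (t j) (ψ j c)) ∈ M.letterRel (L j)
  cochain : ∀ j u v, (u, v) ∈ M.letterRel (L j) → ψ j (p (s j) u) = p (t j) v

variable {ι κ : Type} {s t : κ → ι} {L : κ → Letter Q}
  {ψ : κ → G ≃ₗ[k] G} {τ : ι → Q × Bool} {P D : ι → ℕ → Fin 3} {x : ι → G →ₗ[k] V}
  {p : ι → V →ₗ[k] G}

namespace IsPattern

theorem fwd_letter (h : hM.IsPattern s t L ψ τ P D x p) {i : ι} {ℓ : Letter Q}
    (h1 : ℓ.first pol = τ i) (h2 : D i 0 = ℓ.digit) : ∃ j, s j = i ∧ L j = ℓ := by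
  obtain ⟨j, rfl⟩ := h.fwd_end i (by rw [h2]; exact ℓ.digit_ne_one)
  exact ⟨j, rfl, Letter.ext_of_first pol ((h.first_eq j).trans h1.symm)
    ((h.digit_eq j).trans h2)⟩

theorem back_letter (h : hM.IsPattern s t L ψ τ P D x p) {i : ι} {ℓ : Letter Q}
    (h1 : ℓ.first pol = oppositeSide (τ i)) (h2 : P i 0 = ℓ.digit) :
    ∃ j, t j = i ∧ L j = ℓ.inverse := by
  obtain ⟨j, rfl⟩ := h.back_end i (by rw [h2]; exact ℓ.digit_ne_one)
  refine ⟨j, rfl, ?_⟩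
  rw [← (L j).inverse_inverse]
  congr 1
  refine Letter.ext_of_first pol ?_ ?_
  · rw [Letter.first_inverse, h.last_eq, h1]
  · rw [Letter.digit_inverse, h.rev_digit_eq, h2]

-- An arrow that starts at the vertex of `x i` lies on one of its two sides. If the pattern
-- continues there along this arrow, `chain` gives its value; otherwise the digit on that side is
-- not `2` and the arrow kills `x i`. At most one summand survives, since the letters leading on and
-- leading back lie on opposite sides.
open Classical in
theorem arrow_apply [Fintype κ] (h : hM.IsPattern s t L ψ τ P D x p) (α : Quiver.Total Q) (i : ι)
    (c : G) : M.arrow α (x i c) = ∑ j,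
      ((if L j = Letter.dir α ∧ s j = i then x (t j) (ψ j c) else 0) +
        (if L j = Letter.inv α ∧ t j = i then x (s j) ((ψ j).symm c) else 0)) := by
  by_cases h1 : ∃ j, L j = Letter.dir α ∧ s j = i
  · obtain ⟨j, hj, rfl⟩ := h1
    rw [Finset.sum_eq_single j]
    · rw [if_pos ⟨hj, rfl⟩, if_neg (by rw [hj]; simp), add_zero]
      have := h.chain j c
      rw [hj] at this
      exact (M.mem_letterRel_dir.1 this).2.symm
    · intro j' _ hne
      rw [if_neg fun h2 => hne (h.s_inj h2.2), if_neg, add_zero]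
      rintro ⟨h2, h3⟩
      have h4 := h.last_eq j'
      have h5 := h.first_eq j
      rw [h3, ← h5, h2, hj] at h4
      simp [Letter.first, Letter.last] at h4
    · simp
  by_cases h2 : ∃ j, L j = Letter.inv α ∧ t j = i
  · obtain ⟨j, hj, rfl⟩ := h2
    rw [Finset.sum_eq_single j]
    · rw [if_neg (by rw [hj]; simp), if_pos ⟨hj, rfl⟩, zero_add]
      have := h.chain j ((ψ j).symm c)
      rw [hj, LinearEquiv.apply_symm_apply] at this
      exact (M.mem_letterRel_inv.1 this).2.symm
    · intro j' _ hne
      rw [if_neg fun h2 => h1 ⟨j', h2⟩, if_neg fun h2 => hne (h.t_inj h2.2), add_zero]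
    · simp
  rw [Finset.sum_eq_zero fun j _ => by
    rw [if_neg fun h3 => h1 ⟨j, h3⟩, if_neg fun h3 => h2 ⟨j, h3⟩, add_zero]]
  by_cases hg : α.left = (τ i).1
  · rcases eq_or_eq_oppositeSide (τ := (Letter.dir α).first pol) hg with h3 | h3
    · refine arrow_eq_zero_of_mem_up ((h.placed i).mem_fwd 1 c) h3 fun h4 => h1 ?_
      obtain ⟨j, h5, h6⟩ := h.fwd_letter h3 h4
      exact ⟨j, h6, h5⟩
    · refine arrow_eq_zero_of_mem_up ((h.placed i).mem_back 1 c) h3 fun h4 => h2 ?_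
      obtain ⟨j, h5, h6⟩ := h.back_letter h3 h4
      exact ⟨j, h6, h5⟩
  · rw [← hM.arrow_vertex, ← (h.placed i).vertex_apply, hM.vertex_ne _ _ _ hg, map_zero]

-- Dual to `arrow_apply`: an arrow that ends at the vertex and is not a letter of the pattern there
-- has its image in a lower bound, where the form vanishes.
open Classical in
theorem form_apply [Fintype κ] (h : hM.IsPattern s t L ψ τ P D x p) (α : Quiver.Total Q) (i : ι)
    (y : V) : p i (M.vertex (τ i).1 (M.arrow α y)) = ∑ j,
      ((if L j = Letter.dir α ∧ t j = i then ψ j (p (s j) (M.vertex (τ (s j)).1 y)) else 0) +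
        (if L j = Letter.inv α ∧ s j = i then
          (ψ j).symm (p (t j) (M.vertex (τ (t j)).1 y)) else 0)) := by
  by_cases h1 : ∃ j, L j = Letter.dir α ∧ t j = i
  · obtain ⟨j, hj, rfl⟩ := h1
    have e1 : (τ (s j)).1 = α.left := by rw [← h.first_eq, hj]; rfl
    have e2 : (τ (t j)).1 = α.right := by rw [← h.last_eq, hj]; rfl
    rw [Finset.sum_eq_single j]
    · rw [if_pos ⟨hj, rfl⟩, if_neg (by rw [hj]; simp), add_zero, e1, e2, hM.vertex_arrow,
        h.cochain j (M.vertex α.left y) (M.arrow α y)]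
      rw [hj]
      exact M.mem_letterRel_dir.2 ⟨hM.vertex_vertex _ _, (hM.arrow_vertex _ _).symm⟩
    · intro j' _ hne
      rw [if_neg fun h2 => hne (h.t_inj h2.2), if_neg, add_zero]
      rintro ⟨h2, h3⟩
      have h4 := h.first_eq j'
      have h5 := h.last_eq j
      rw [h3, ← h5, h2, hj] at h4
      simp [Letter.first, Letter.last] at h4
    · simp
  by_cases h2 : ∃ j, L j = Letter.inv α ∧ s j = i
  · obtain ⟨j, hj, rfl⟩ := h2
    have e1 : (τ (t j)).1 = α.left := by rw [← h.last_eq, hj]; rfl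
    have e2 : (τ (s j)).1 = α.right := by rw [← h.first_eq, hj]; rfl
    rw [Finset.sum_eq_single j]
    · rw [if_neg (by rw [hj]; simp), if_pos ⟨hj, rfl⟩, zero_add, e1, e2, hM.vertex_arrow,
        ← h.cochain j (M.arrow α y) (M.vertex α.left y), LinearEquiv.symm_apply_apply]
      rw [hj]
      exact M.mem_letterRel_inv.2 ⟨hM.vertex_vertex _ _, (hM.arrow_vertex _ _).symm⟩
    · intro j' _ hne
      rw [if_neg fun h2 => h1 ⟨j', h2⟩, if_neg fun h2 => hne (h.s_inj h2.2), add_zero]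
    · simp
  rw [Finset.sum_eq_zero fun j _ => by
    rw [if_neg fun h3 => h1 ⟨j, h3⟩, if_neg fun h3 => h2 ⟨j, h3⟩, add_zero]]
  by_cases hg : α.right = (τ i).1
  · rw [← hg, hM.vertex_arrow]
    rcases eq_or_eq_oppositeSide (τ := (Letter.inv α).first pol) hg with h3 | h3
    · refine (h.placed i).vanish_fwd 1 _ (arrow_mem_lo h3 (fun h4 => h2 ?_) y)
      obtain ⟨j, h5, h6⟩ := h.fwd_letter h3 h4
      exact ⟨j, h6, h5⟩
    · refine (h.placed i).vanish_back 1 _ (arrow_mem_lo h3 (fun h4 => h1 ?_) y)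
      obtain ⟨j, h5, h6⟩ := h.back_letter h3 h4
      exact ⟨j, h6, h5⟩
  · rw [← hM.vertex_arrow, hM.vertex_ne _ _ _ (Ne.symm hg), map_zero]

open Classical in
/-- The representation given by a pattern is isomorphic to every representation without nontrivial
idempotents in which the pattern occurs. -/
theorem iso [Fintype ι] [Nonempty ι] [Fintype κ] [Nontrivial G] [FiniteDimensional k G]
    (h : hM.IsPattern s t L ψ τ P D x p) (hconn : M.IsConnected) (Y : QuiverOps k Q (ι → G))
    (hYv : ∀ g v i, Y.vertex g v i = if (τ i).1 = g then v i else 0)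
    (hYa : ∀ α v i, Y.arrow α v i = ∑ j,
      ((if L j = Letter.dir α ∧ t j = i then ψ j (v (s j)) else 0) +
        (if L j = Letter.inv α ∧ s j = i then (ψ j).symm (v (t j)) else 0))) :
    M.Iso Y := by
  let f : (ι → G) →ₗ[k] V := ∑ i, x i ∘ₗ LinearMap.proj i
  have hf : ∀ v, f v = ∑ i, x i (v i) := fun v => by simp [f]
  -- By `arrow_apply` and `form_apply` the vectors give a morphism `f` into the representation and
  -- the forms a morphism `r` out of it. Injectivity of `r ∘ f` is the independence of different
  -- positions.
  let r : V →ₗ[k] (ι → G) := LinearMap.pi fun i => p i ∘ₗ M.vertex (τ i).1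
  have hr : ∀ y i, r y i = p i (M.vertex (τ i).1 y) := fun y i => rfl
  have hfhom : Y.IsHom M f := by
    constructor
    · intro g v
      rw [hf, hf, map_sum]
      refine Finset.sum_congr rfl fun i _ => ?_
      rw [hYv]
      split_ifs with hg
      · rw [← hg, (h.placed i).vertex_apply]
      · rw [map_zero, ← (h.placed i).vertex_apply, hM.vertex_ne _ _ _ (Ne.symm hg)]
    · intro α v
      rw [hf, hf, map_sum]
      simp_rw [h.arrow_apply, hYa, map_sum]
      refine Finset.sum_comm.trans ((Finset.sum_congr rfl fun j _ => ?_).trans Finset.sum_comm)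
      rw [Finset.sum_congr rfl fun i _ => map_add (x i) _ _, Finset.sum_add_distrib,
        Finset.sum_add_distrib]
      simp only [apply_ite (DFunLike.coe _), map_zero]
      congr 1
      · by_cases h1 : L j = Letter.dir α
        · simp [h1]
        · simp [h1]
      · by_cases h1 : L j = Letter.inv α
        · simp [h1]
        · simp [h1]
  refine hconn.iso hfhom (r := r) ⟨fun g y => funext fun i => ?_, fun α y => funext fun i => ?_⟩ ?_
  · rw [hYv, hr, hr]
    split_ifs with hg
    · rw [hg, hM.vertex_vertex]
    · rw [hM.vertex_ne _ _ _ hg, map_zero]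
  · rw [hr, h.form_apply, hYa]
    rfl
  · rw [← LinearMap.ker_eq_bot, LinearMap.ker_eq_bot']
    intro v hv
    refine hM.eq_zero_of_isPlaced τ P D x p h.placed h.ne h.ne' v fun j => ?_
    rw [← hf]
    exact congrFun hv j

end IsPattern

end IsPolarized

end QuiverOps

end

/-! ### Chains of nonzero vectors and walks along words -/

noncomputable section

namespace QuiverOps

variable {k : Type u} [Field k] {Q : Type u} [Quiver.{u} Q] {V : Type u}
    [AddCommGroup V] [Module k V]

/-- The operator given by the arrows of a path. -/
def pathAct (M : QuiverOps k Q V) {g : Q} : {h : Q} → Quiver.Path g h → V →ₗ[k] V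
  | _, .nil => LinearMap.id
  | _, .cons p α => M.arrow ⟨_, _, α⟩ ∘ₗ M.pathAct p

/-- There is a chain of nonzero vectors from `x` to `y` along the word `w`. -/
def Linked (M : QuiverOps k Q V) : V → List (Letter Q) → V → Prop
  | x, [], y => x = y
  | x, ℓ :: w, y => ∃ z, z ≠ 0 ∧ (x, z) ∈ M.letterRel ℓ ∧ M.Linked z w y

variable {M : QuiverOps k Q V}

theorem Linked.ne_zero {x y : V} {w : List (Letter Q)} (h : M.Linked x w y) (hx : x ≠ 0) :
    y ≠ 0 := by
  induction w generalizing x with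
  | nil => exact h ▸ hx
  | cons ℓ w ih =>
    obtain ⟨z, hz, -, h⟩ := h
    exact ih h hz

theorem linked_append {x y : V} {w w' : List (Letter Q)} :
    M.Linked x (w ++ w') y ↔ ∃ z, M.Linked x w z ∧ M.Linked z w' y := by
  induction w generalizing x with
  | nil => simp [Linked]
  | cons ℓ w ih =>
    simp only [List.cons_append, Linked, ih]
    constructor
    · rintro ⟨a, h1, h2, z, h3, h4⟩
      exact ⟨z, ⟨a, h1, h2, h3⟩, h4⟩
    · rintro ⟨z, ⟨a, h1, h2, h3⟩, h4⟩
      exact ⟨a, h1, h2, z, h3, h4⟩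

theorem Linked.inverse {x y : V} {w : List (Letter Q)} (h : M.Linked x w y) (hx : x ≠ 0) :
    M.Linked y (inverseSequence w) x := by
  induction w generalizing x with
  | nil => exact h.symm
  | cons ℓ w ih =>
    obtain ⟨z, hz, h1, h2⟩ := h
    rw [inverseSequence, List.map_cons, List.reverse_cons, linked_append]
    refine ⟨z, ih h2 hz, x, hx, ?_, rfl⟩
    rw [letterRel_inverse]
    exact h1

theorem Linked.pathAct_eq {x y : V} {g h : Q} {p : Quiver.Path g h}
    (hxy : M.Linked x (pathLetters p) y) : M.pathAct p x = y := by
  induction p generalizing y with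
  | nil => exact hxy
  | cons p α ih =>
    obtain ⟨z, h1, a, ha, h2, rfl⟩ := linked_append.1 hxy
    rw [pathAct, LinearMap.comp_apply, ih h1]
    exact (M.mem_letterRel_dir.1 h2).2.symm

/-- The part of the chain along the path begins and ends with nonzero vectors, and the path maps the
first to the last; for subwords of the inverse the chain is read backwards. This later shows that
the paths in a word lie in `B`. -/
theorem Linked.pathAct_ne_zero {x y : V} {w : List (Letter Q)} (hw : M.Linked x w y) (hx : x ≠ 0)
    {g h : Q} {p : Quiver.Path g h}
    (hp : pathLetters p <:+: w ∨ pathLetters p <:+: inverseSequence w) : M.pathAct p ≠ 0 := by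
  have key : ∀ {x y : V} {w : List (Letter Q)}, M.Linked x w y → x ≠ 0 →
      pathLetters p <:+: w → M.pathAct p ≠ 0 := by
    rintro x y w hw hx ⟨a, b, rfl⟩ h0
    obtain ⟨z, h1, -⟩ := linked_append.1 hw
    obtain ⟨z', h2, h3⟩ := linked_append.1 h1
    have := h3.pathAct_eq
    rw [h0] at this
    exact h3.ne_zero (h2.ne_zero hx) this.symm
  rcases hp with hp | hp
  · exact key hw hx hp
  · exact key (hw.inverse hx) (hw.ne_zero hx) hp

theorem Linked.of_chain {w : List (Letter Q)} (x : ℕ → V)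
    (h : ∀ (i : ℕ) (hi : i < w.length), (x i, x (i + 1)) ∈ M.letterRel w[i])
    (hx : ∀ i ≤ w.length, x i ≠ 0) : M.Linked (x 0) w (x w.length) := by
  induction w generalizing x with
  | nil => rfl
  | cons ℓ w ih =>
    refine ⟨x 1, hx 1 (by simp), h 0 (by simp), ?_⟩
    exact ih (fun i => x (i + 1)) (fun i hi => h (i + 1) (by simpa using hi))
      (fun i hi => hx (i + 1) (by simpa using hi))

end QuiverOps

section Walks

variable {Q : Type u} [Quiver.{u} Q]

/-- The word `w` leads from `τ` to `τ'`. -/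
def Walks (pol : Polarization Q) : Q × Bool → List (Letter Q) → Q × Bool → Prop
  | τ, [], τ' => τ = τ'
  | τ, ℓ :: w, τ' => ℓ.first pol = τ ∧ Walks pol (ℓ.last pol) w τ'

variable {pol : Polarization Q}

theorem walks_append {τ τ' : Q × Bool} {w w' : List (Letter Q)} :
    Walks pol τ (w ++ w') τ' ↔ ∃ σ, Walks pol τ w σ ∧ Walks pol σ w' τ' := by
  induction w generalizing τ with
  | nil => simp [Walks]
  | cons ℓ w ih => simp [Walks, ih, and_assoc]

/-- The inverse of a letter leaves on the side on which the letter arrived, whereas a walk goes on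
from the opposite side. Hence nothing cancels. -/
theorem Walks.isLetterSequence {τ τ' : Q × Bool} {w : List (Letter Q)}
    (h : Walks pol τ w τ') : IsLetterSequence w := by
  induction w generalizing τ with
  | nil => exact List.isChain_nil
  | cons a w ih =>
    have h2 := ih h.2
    cases w with
    | nil => exact List.isChain_singleton a
    | cons b w =>
      have h3 : b.first pol = a.last pol := h.2.1
      refine List.isChain_cons_cons.2 ⟨⟨?_, fun hb => ?_⟩, h2⟩
      · rw [← Letter.last_fst pol, ← Letter.first_fst pol, h3]
      · rw [hb, Letter.first_inverse] at h3
        exact oppositeSide_ne _ h3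

theorem Walks.of_getElem {w : List (Letter Q)} (τ : ℕ → Q × Bool)
    (h : ∀ (i : ℕ) (hi : i < w.length), w[i].first pol = τ i ∧ w[i].last pol = τ (i + 1)) :
    Walks pol (τ 0) w (τ w.length) := by
  induction w generalizing τ with
  | nil => rfl
  | cons ℓ w ih =>
    have h0 := h 0 (by simp)
    refine ⟨h0.1, ?_⟩
    rw [show ℓ.last pol = τ 1 from h0.2]
    exact ih (fun i => τ (i + 1)) (fun i hi => h (i + 1) (by simpa using hi))

end Walks

namespace QuiverOps.IsPolarized

open LinRel

variable {k : Type u} [Field k] {Q : Type u} [Quiver.{u} Q] {V : Type u}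
    [AddCommGroup V] [Module k V] {M : QuiverOps k Q V} {pol : Polarization Q}
    (hM : M.IsPolarized pol)

variable {hM} in
/-- The letters and sides along the first `n` steps from a position. -/
theorem IsGood.exists_letters {t : WordPosition Q} (ht : hM.IsGood t) {n : ℕ}
    (hn : ∀ i < n, t.fwd i ≠ 1) : ∃ (w : List (Letter Q)) (τ : ℕ → Q × Bool), w.length = n ∧
      (∀ i ≤ n, (hM.move^[i] t).state = some (τ i)) ∧
      ∀ (i : ℕ) (hi : i < w.length), w[i].digit = t.fwd i ∧ w[i].first pol = τ i ∧
        w[i].last pol = τ (i + 1) := by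
  have hnext := ht.exists_next_iterate hn
  choose ℓ hℓ using fun i : Fin n => hnext i i.2
  -- The values of `τ` beyond `n` play no role; `τ₀` is only a default for them.
  obtain ⟨τ₀, h0, -⟩ := id ht
  have hex : ∀ i, ∃ τ, i ≤ n → (hM.move^[i] t).state = some τ := by
    intro i
    by_cases hi : i ≤ n
    · obtain ⟨τ, hτ, -⟩ := ht.iterate_move (n := i) (fun j hj => hn j (by omega))
      exact ⟨τ, fun _ => hτ⟩
    · exact ⟨τ₀, fun h => absurd h hi⟩
  choose τ hτ using hex
  refine ⟨List.ofFn ℓ, τ, List.length_ofFn, hτ, fun i hi => ?_⟩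
  rw [List.length_ofFn] at hi
  rw [List.getElem_ofFn]
  refine ⟨?_, ?_, ?_⟩
  · rw [(hℓ ⟨i, hi⟩).2, fwd_iterate_move, Nat.add_zero]
  · exact Option.some_inj.1 ((hℓ ⟨i, hi⟩).1.symm.trans (hτ i hi.le))
  · refine Option.some_inj.1 (((hℓ ⟨i, hi⟩).state_move hM).symm.trans ?_)
    rw [← Function.iterate_succ_apply' hM.move]
    exact hτ (i + 1) hi

/-- Positions along a word do not coincide up to inversion. -/
theorem fwd_ne_back {t : WordPosition Q} {n : ℕ} (hnext : ∀ i < n, ∃ ℓ, IsNext pol (hM.move^[i] t) ℓ)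
    {τ : ℕ → Q × Bool} (hτ : ∀ i ≤ n, (hM.move^[i] t).state = some (τ i)) {i j : ℕ} (hi : i ≤ n)
    (hj : j ≤ n) (hij : τ j = oppositeSide (τ i))
    (h : (hM.move^[i] t).fwd = (hM.move^[j] t).back) :
    (hM.move^[i] t).back ≠ (hM.move^[j] t).fwd := by
  have key : ∀ i j, j ≤ n → i ≤ j → τ j = oppositeSide (τ i) →
      (hM.move^[i] t).fwd ≠ (hM.move^[j] t).back := by
    intro i j hj hij h1
    obtain ⟨m, rfl⟩ := Nat.exists_eq_add_of_le' hij
    rw [Function.iterate_add_apply]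
    refine hM.not_palindromic m _ (fun l hl => ?_) (τ i) (hτ i (by omega)) ?_
    · rw [← Function.iterate_add_apply]; exact hnext _ (by omega)
    · rw [← Function.iterate_add_apply, hτ _ hj, h1]
  intro h'
  rcases le_total i j with hle | hle
  · exact key i j hj hle hij h
  · exact key j i hi hle (by rw [hij, oppositeSide_oppositeSide]) h'.symm

theorem rels_eq_letterRel {t : WordPosition Q} {ℓ : Letter Q} {τ : Q × Bool} {i : ℕ}
    (hst : (hM.move^[i] t).state = some τ) (hd : ℓ.digit = t.fwd i) (hf : ℓ.first pol = τ) :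
    hM.system.rels t.state t.fwd i = M.letterRel ℓ := by
  rw [RelSystem.rels, ← hM.state_iterate_move, hst, ← hf, ← hd, system_R_letter]

section Steps

variable {G : Type*} [AddCommGroup G] [Module k G] {t : WordPosition Q} {ℓ : Letter Q}
  {x x' : V}

theorem mem_up_fwd (hd : ℓ.digit = t.fwd 0) (hx : (x, x') ∈ M.letterRel ℓ) {n : ℕ}
    (h : x' ∈ hM.system.up (some (ℓ.last pol)) (hM.move t).fwd n) :
    x ∈ hM.system.up (some (ℓ.first pol)) t.fwd (n + 1) := by
  rw [hM.up_letter ℓ _ hd.symm]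
  exact mem_img.2 ⟨x', h, hx⟩

theorem mem_up_back (hd : ℓ.digit = t.fwd 0) (hx : (x, x') ∈ M.letterRel ℓ) {n : ℕ}
    (h : x ∈ hM.system.up (some (oppositeSide (ℓ.first pol))) t.back n) :
    x' ∈ hM.system.up (some (oppositeSide (ℓ.last pol))) (hM.move t).back (n + 1) := by
  rw [move, ← hd, up_letter_inverse]
  exact mem_img.2 ⟨x, h, hx⟩

theorem vanish_lo_fwd (hd : ℓ.digit = t.fwd 0) {p p' : V →ₗ[k] G}
    (hp : ∀ x x', (x, x') ∈ M.letterRel ℓ → p x = p' x') {n : ℕ}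
    (h : ∀ y ∈ hM.system.lo (some (ℓ.last pol)) (hM.move t).fwd n, p' y = 0) :
    ∀ y ∈ hM.system.lo (some (ℓ.first pol)) t.fwd (n + 1), p y = 0 := by
  intro y hy
  rw [hM.lo_letter ℓ _ hd.symm] at hy
  obtain ⟨z, hz, hyz⟩ := mem_img.1 hy
  rw [hp y z hyz, h z hz]

theorem vanish_lo_back (hd : ℓ.digit = t.fwd 0) {p p' : V →ₗ[k] G}
    (hp : ∀ x x', (x, x') ∈ M.letterRel ℓ → p x = p' x') {n : ℕ}
    (h : ∀ y ∈ hM.system.lo (some (oppositeSide (ℓ.first pol))) t.back n, p y = 0) :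
    ∀ y ∈ hM.system.lo (some (oppositeSide (ℓ.last pol))) (hM.move t).back (n + 1),
      p' y = 0 := by
  intro y hy
  rw [move, ← hd, lo_letter_inverse] at hy
  obtain ⟨z, hz, hyz⟩ := mem_img.1 hy
  rw [← hp z y hyz, h z hz]

end Steps

/-- In the state `none` there are no letters, so the end relation is equality. Once a word has
ended, further digits `1` do not change the bounds. -/
theorem img_one_none (A : Submodule k V) : img (hM.system.R none 1) A = A := by
  have hK : img (outerRel M pol none 2) (⊥ : Submodule k V) = ⊤ := by
    rw [eq_top_iff]
    intro x _
    have h : letterAt pol none 2 = none := by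
      cases h : letterAt pol none 2 with
      | none => rfl
      | some ℓ => simp [letterAt_eq_some] at h
    exact mem_img.2 ⟨0, rfl, by rw [outerRel, h]; exact ⟨trivial, trivial⟩⟩
  have hI : img (outerRel M pol none 0) (⊤ : Submodule k V) = ⊥ := by
    rw [eq_bot_iff]
    intro x hx
    have h : letterAt pol none 0 = none := by
      cases h : letterAt pol none 0 with
      | none => rfl
      | some ℓ => simp [letterAt_eq_some] at h
    obtain ⟨y, -, hxy⟩ := mem_img.1 hx
    rw [outerRel, h] at hxy
    exact (Prod.mk_eq_zero.1 hxy).1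
  have hR : ∀ x y, (x, y) ∈ hM.system.R none 1 ↔ x = y := by
    intro x y
    change (x, y) ∈ (if (1 : Fin 3) = 1 then endRel M pol none else
      outerRel M pol none 1) ↔ _
    rw [if_pos rfl, mem_endRel, hK, hI, Submodule.mem_bot, sub_eq_zero]
    exact ⟨fun h => h.2, fun h => ⟨⟨trivial, trivial⟩, h⟩⟩
  ext x
  rw [mem_img]
  constructor
  · rintro ⟨y, hy, hxy⟩
    rwa [(hR _ _).1 hxy]
  · exact fun hx => ⟨x, hx, (hR _ _).2 rfl⟩

theorem up_ended (σ : Option (Q × Bool)) {D : ℕ → Fin 3} (hD : ∀ n, D n = 1) (n : ℕ) :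
    hM.system.up σ D (n + 1) = img (hM.system.R σ 1) ⊤ := by
  have h : ∀ n, hM.system.up none (fun i => D (i + 1)) n = ⊤ := by
    have hD' : (fun i => D (i + 1)) = fun _ => (1 : Fin 3) := funext fun i => hD _
    rw [hD']
    intro n
    induction n with
    | zero => exact hM.system.up_zero _ _
    | succ n ih =>
      rw [hM.system.up_succ', system_nx_one, ih, img_one_none]
  rw [hM.system.up_succ', hD, system_nx_one, h]

theorem lo_ended (σ : Option (Q × Bool)) {D : ℕ → Fin 3} (hD : ∀ n, D n = 1) (n : ℕ) :
    hM.system.lo σ D (n + 1) = img (hM.system.R σ 1) ⊥ := by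
  have h : ∀ n, hM.system.lo none (fun i => D (i + 1)) n = ⊥ := by
    have hD' : (fun i => D (i + 1)) = fun _ => (1 : Fin 3) := funext fun i => hD _
    rw [hD']
    intro n
    induction n with
    | zero => exact hM.system.lo_zero _ _
    | succ n ih =>
      rw [hM.system.lo_succ', system_nx_one, ih, img_one_none]
  rw [hM.system.lo_succ', hD, system_nx_one, h]

end QuiverOps.IsPolarized

end

/-! ### String modules from finite words -/

noncomputable section

open Classical in
theorem stringModule_vertex_apply (k : Type u) [Field k] {Q : Type u} [Quiver.{u} Q] (w : QWord Q)
    (g : Q) (v : Fin (w.letters.length + 1) → k) (i : Fin (w.letters.length + 1)) :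
    (stringModule k w).vertex g v i = if w.vertex i = g then v i else 0 := by
  simp only [stringModule, LinearMap.sum_apply, Finset.sum_apply]
  rw [Finset.sum_eq_single i]
  · split_ifs <;> simp
  · intro j _ hj
    split_ifs
    · simp [hj.symm]
    · simp
  · simp

open Classical in
theorem stringModule_arrow_apply (k : Type u) [Field k] {Q : Type u} [Quiver.{u} Q] (w : QWord Q)
    (α : Quiver.Total Q) (v : Fin (w.letters.length + 1) → k) (i : Fin (w.letters.length + 1)) :
    (stringModule k w).arrow α v i = ∑ j : Fin w.letters.length,
      ((if w.letters.get j = Letter.dir α ∧ j.succ = i then v j.castSucc else 0) +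
        (if w.letters.get j = Letter.inv α ∧ j.castSucc = i then v j.succ else 0)) := by
  simp only [stringModule, LinearMap.sum_apply, Finset.sum_apply]
  refine Finset.sum_congr rfl fun j _ => ?_
  rw [LinearMap.add_apply, Pi.add_apply]
  congr 1
  · by_cases h : w.letters.get j = Letter.dir α
    · simp only [h, if_true, true_and, LinearMap.comp_apply, LinearMap.proj_apply,
        LinearMap.coe_single, Pi.single_apply, eq_comm]
    · simp only [h, if_false, false_and, LinearMap.zero_apply, Pi.zero_apply]
  · by_cases h : w.letters.get j = Letter.inv α
    · simp only [h, if_true, true_and, LinearMap.comp_apply, LinearMap.proj_apply,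
        LinearMap.coe_single, Pi.single_apply, eq_comm]
    · simp only [h, if_false, false_and, LinearMap.zero_apply, Pi.zero_apply]

namespace QuiverOps.IsPolarized

open LinRel

variable {k : Type u} [Field k] {Q : Type u} [Quiver.{u} Q] {V : Type u}
    [AddCommGroup V] [Module k V] {M : QuiverOps k Q V} {pol : Polarization Q}
    {hM : M.IsPolarized pol}

/-- A position in a finite word yields a string module. -/
theorem IsGood.exists_string [FiniteDimensional k V] (hconn : M.IsConnected) {t : WordPosition Q}
    (ht : hM.IsGood t) (hb : t.back 0 = 1) {n : ℕ} (hn : ∀ i < n, t.fwd i ≠ 1)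
    (hn1 : t.fwd n = 1) :
    ∃ w : QWord Q, M.Iso (stringModule k w) ∧ ∃ x y, x ≠ 0 ∧ M.Linked x w.letters y := by
  obtain ⟨w, τ, rfl, hτ, hw⟩ := ht.exists_letters hn
  have hstate : t.state = some (τ 0) := hτ 0 (by omega)
  obtain ⟨x₀, p₀, hx₀⟩ : ∃ (x : k →ₗ[k] V) (p : V →ₗ[k] k),
      hM.IsPlaced (τ 0) t.back t.fwd x p := by
    refine IsGood.exists_isPlaced hM ?_
    rwa [← hstate]
  -- the chains of vectors and forms
  obtain ⟨z, hz⟩ := exists_linearMap_of_total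
    ((word (hM.system.rels t.state t.fwd) (w.length + 1)).comap (LinearMap.prodMap x₀ LinearMap.id))
    (fun c => by
      obtain ⟨z, -, hz⟩ := mem_img.1 (hx₀.mem_fwd (w.length + 1) c)
      rw [← hstate] at hz
      exact ⟨z, hz⟩)
  -- The chain is one step longer than the word: its last relation is the end relation at the final
  -- vertex, which provides the end condition for the last vector, and likewise for the last form.
  obtain ⟨x, hx0, -, hx⟩ := exists_chain (n := w.length + 1)
    (ρ := hM.system.rels t.state t.fwd) (s := x₀) (t := z) hz
  obtain ⟨q, hq⟩ := exists_linearMap_of_singleValued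
    ((word (hM.system.rels t.state t.fwd) (w.length + 1)).map
      ((LinearMap.snd k V V).prod (p₀ ∘ₗ LinearMap.fst k V V))) (by
    rintro g ⟨⟨a, b⟩, hab, h⟩
    obtain ⟨rfl, rfl⟩ := Prod.mk.inj h
    refine hx₀.vanish_fwd (w.length + 1) a (mem_img.2 ⟨_, rfl, ?_⟩)
    rw [← hstate]
    exact hab)
  obtain ⟨p, hp0, -, hp⟩ := exists_cochain (p := p₀) (q := q) (fun a b hab =>
    (hq (b, p₀ a) ⟨(a, b), hab, rfl⟩).symm)
  have hrel : ∀ (i : ℕ) (hi : i < w.length),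
      hM.system.rels t.state t.fwd i = M.letterRel w[i] := fun i hi =>
    hM.rels_eq_letterRel (hτ i hi.le) (hw i hi).1 (hw i hi).2.1
  have hrelN : hM.system.rels t.state t.fwd w.length = hM.system.R (some (τ w.length)) 1 := by
    rw [RelSystem.rels, ← hM.state_iterate_move, hτ _ le_rfl, hn1]
  have hxr : ∀ (i : ℕ) (hi : i < w.length) c, (x i c, x (i + 1) c) ∈ M.letterRel w[i] :=
    fun i hi c => hrel i hi ▸ hx i (by omega) c
  have hpr : ∀ (i : ℕ) (hi : i < w.length) a b, (a, b) ∈ M.letterRel w[i] → p i a = p (i + 1) b :=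
    fun i hi a b hab => hp i (by omega) a b (by rw [hrel i hi]; exact hab)
  have hdig : ∀ (i : ℕ) (hi : i < w.length), w[i].digit = (hM.move^[i] t).fwd 0 := fun i hi => by
    rw [(hw i hi).1, fwd_iterate_move, Nat.add_zero]
  have hlast : ∀ j, (hM.move^[w.length] t).fwd j = 1 := by
    refine (ht.iterate_move hn).fwd_eq_one ?_
    rw [fwd_iterate_move, Nat.add_zero, hn1]
  -- The forward conditions propagate from the end of the word to its start, beginning with the end
  -- relation; the backward conditions propagate from the start, where they hold by the choice of
  -- `x₀` and `p₀`.
  have hfwd : ∀ m i, i + m = w.length → ∀ N, (∀ c, x i c ∈ hM.system.up (some (τ i))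
      (hM.move^[i] t).fwd N) ∧ ∀ y ∈ hM.system.lo (some (τ i)) (hM.move^[i] t).fwd N,
      p i y = 0 := by
    intro m
    induction m with
    | zero =>
      rintro i hi N
      obtain rfl : i = w.length := by omega
      have hxN := fun c => hx w.length (by omega) c
      have hpN := hp w.length (by omega)
      rw [hrelN] at hxN hpN
      refine ⟨fun c => hM.system.up_antitone _ _ (Nat.le_succ N) ?_, fun y hy => ?_⟩
      · rw [up_ended hM _ hlast]
        exact mem_img.2 ⟨_, trivial, hxN c⟩
      · have hy' := hM.system.lo_monotone _ _ (Nat.le_succ N) hy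
        rw [Nat.succ_eq_add_one, lo_ended hM _ hlast] at hy'
        obtain ⟨b, rfl, hb⟩ := mem_img.1 hy'
        rw [hpN _ _ hb, map_zero]
    | succ m ih =>
      intro i hi N
      have hi' : i < w.length := by omega
      have h1 := ih (i + 1) (by omega) N
      rw [← (hw i hi').2.2, Function.iterate_succ_apply'] at h1
      rw [← (hw i hi').2.1]
      refine ⟨fun c => hM.system.up_antitone _ _ (Nat.le_succ N)
        (hM.mem_up_fwd (hdig i hi') (hxr i hi' c) (h1.1 c)), fun y hy => ?_⟩
      exact hM.vanish_lo_fwd (hdig i hi') (hpr i hi') h1.2 y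
        (hM.system.lo_monotone _ _ (Nat.le_succ N) hy)
  have hback : ∀ i ≤ w.length, ∀ N, (∀ c, x i c ∈ hM.system.up (some (oppositeSide (τ i)))
      (hM.move^[i] t).back N) ∧ ∀ y ∈ hM.system.lo (some (oppositeSide (τ i)))
      (hM.move^[i] t).back N, p i y = 0 := by
    intro i
    induction i with
    | zero =>
      intro _ N
      rw [hx0, hp0]
      exact ⟨hx₀.mem_back N, hx₀.vanish_back N⟩
    | succ i ih =>
      intro hi N
      have h1 := ih (by omega) N
      rw [← (hw i hi).2.1] at h1
      rw [← (hw i hi).2.2, Function.iterate_succ_apply']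
      refine ⟨fun c => hM.system.up_antitone _ _ (Nat.le_succ N)
        (hM.mem_up_back (hdig i hi) (hxr i hi c) (h1.1 c)), fun y hy => ?_⟩
      exact hM.vanish_lo_back (hdig i hi) (hpr i hi) h1.2 y
        (hM.system.lo_monotone _ _ (Nat.le_succ N) hy)
  have hpx : ∀ i ≤ w.length, ∀ c, p i (x i c) = c := by
    intro i
    induction i with
    | zero =>
      intro _ c
      rw [hx0, hp0, hx₀.comp_eq]
    | succ i ih =>
      intro hi c
      rw [← hpr i hi _ _ (hxr i hi c), ih (by omega)]
  have hpat : hM.IsPattern (Fin.castSucc : Fin w.length → _) Fin.succ w.get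
      (fun _ => LinearEquiv.refl k k) (fun i => τ i) (fun i => (hM.move^[i] t).back)
      (fun i => (hM.move^[i] t).fwd) (fun i => x i) (fun i => p i) :=
    { placed := fun i =>
        { mem_fwd := fun N c => (hfwd _ i (Nat.add_sub_of_le (Nat.le_of_lt_succ i.2)) N).1 c
          mem_back := fun N c => (hback i (Nat.le_of_lt_succ i.2) N).1 c
          vanish_fwd := fun N => (hfwd _ i (Nat.add_sub_of_le (Nat.le_of_lt_succ i.2)) N).2
          vanish_back := fun N => (hback i (Nat.le_of_lt_succ i.2) N).2
          comp_eq := hpx i (Nat.le_of_lt_succ i.2) }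
      ne := by
        -- Different positions are at different distances from the first forward digit `1`.
        have key : ∀ i j, i < j → j ≤ w.length →
            (hM.move^[i] t).fwd ≠ (hM.move^[j] t).fwd := by
          intro i j hij hj h
          have h1 := congrFun h (w.length - j)
          rw [fwd_iterate_move, fwd_iterate_move, Nat.add_sub_of_le hj, hn1] at h1
          exact hn (i + (w.length - j)) (by omega) h1
        intro i j hij _ _
        rcases lt_or_gt_of_ne (fun h => hij (Fin.ext h) : (i : ℕ) ≠ j) with h | h
        · exact key i j h (Nat.le_of_lt_succ j.2)
        · exact (key j i h (Nat.le_of_lt_succ i.2)).symm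
      ne' := fun i j => hM.fwd_ne_back (ht.exists_next_iterate hn) hτ (Nat.le_of_lt_succ i.2)
        (Nat.le_of_lt_succ j.2)
      s_inj := Fin.castSucc_injective _
      t_inj := Fin.succ_injective _
      first_eq := fun j => (hw j j.2).2.1
      digit_eq := fun j => hdig j j.2
      last_eq := fun j => (hw j j.2).2.2
      rev_digit_eq := fun j => by
        change _ = (hM.move^[(j : ℕ) + 1] t).back 0
        rw [Function.iterate_succ_apply']
        exact congrArg Fin.rev (hdig j j.2)
      fwd_end := fun i hi => by
        refine ⟨⟨i, lt_of_le_of_ne (Nat.le_of_lt_succ i.2) fun h => hi ?_⟩, rfl⟩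
        rw [h]
        exact hlast 0
      back_end := fun i hi => by
        refine ⟨i.pred fun h => hi ?_, Fin.succ_pred _ _⟩
        rw [h]
        exact hb
      chain := fun j c => hxr j j.2 c
      cochain := fun j a b hab => hpr j j.2 a b hab }
  have hwalk : Walks pol (τ 0) w (τ w.length) := Walks.of_getElem τ fun i hi => (hw i hi).2
  let W : QWord Q :=
    { start := (τ 0).1
      letters := w
      start_eq := by
        intro a ha
        cases w with
        | nil => simp at ha
        | cons b w =>
          obtain rfl : b = a := by simpa using ha
          rw [← Letter.first_fst pol, hwalk.1]
      isLetterSequence := hwalk.isLetterSequence }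
  refine ⟨W, hpat.iso hconn (stringModule k W) (fun g v i => ?_) (fun α v i => ?_), ?_⟩
  · rw [stringModule_vertex_apply]
    have : W.vertex i = (τ i).1 := by
      refine Fin.cases rfl (fun j => ?_) i
      change (w.get j).tgt = (τ (j + 1)).1
      rw [← Letter.last_fst pol, List.get_eq_getElem, (hw j j.2).2.2]
    rw [this]
  · rw [stringModule_arrow_apply]
    refine Finset.sum_congr rfl fun j _ => ?_
    congr!
  · have hne : ∀ i ≤ w.length, x i 1 ≠ 0 := fun i hi h => by
      have := hpx i hi 1
      rw [h, map_zero] at this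
      exact zero_ne_one this
    exact ⟨_, _, hne 0 (by omega), Linked.of_chain (fun i => x i 1) (fun i hi => hxr i hi 1) hne⟩

end QuiverOps.IsPolarized

end

/-! ### Cyclic words and band modules -/

noncomputable section

theorem cyclicSucc_eq {X : Type u} {l : List X} (i : Fin l.length) :
    (cyclicSucc i : ℕ) = if (i : ℕ) + 1 = l.length then 0 else (i : ℕ) + 1 := by
  have hi := i.2
  simp only [cyclicSucc]
  split_ifs with h
  · rw [h, Nat.mod_self]
  · exact Nat.mod_eq_of_lt (by omega)

theorem apply_cyclicSucc {X : Type u} {l : List X} {A : Type*} (i : Fin l.length) (f : ℕ → A)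
    (hf : f l.length = f 0) : f (cyclicSucc i) = f (i + 1) := by
  rw [cyclicSucc_eq]
  split_ifs with h
  · rw [h, hf]
  · rfl

theorem cyclicSucc_injective {X : Type u} {l : List X} :
    Function.Injective (cyclicSucc : Fin l.length → Fin l.length) := by
  intro i j h
  have h1 := congrArg Fin.val h
  rw [cyclicSucc_eq, cyclicSucc_eq] at h1
  ext
  split_ifs at h1 <;> omega

section BandModule

variable {k : Type u} [Field k] {Q : Type u} [Quiver.{u} Q] (w : List (Letter Q))
    {V : Type u} [AddCommGroup V] [Module k V] (φ : V ≃ₗ[k] V)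

open Classical in
theorem bandModule_vertex_apply (g : Q) (v : Fin w.length → V) (i : Fin w.length) :
    (bandModule w φ).vertex g v i = if (w.get i).src = g then v i else 0 := by
  simp only [bandModule, LinearMap.sum_apply, Finset.sum_apply]
  rw [Finset.sum_eq_single i]
  · split_ifs <;> simp
  · intro j _ hj
    split_ifs
    · simp [hj.symm]
    · simp
  · simp

open Classical in
theorem bandModule_arrow_apply (α : Quiver.Total Q) (v : Fin w.length → V) (i : Fin w.length) :
    (bandModule w φ).arrow α v i = ∑ j : Fin w.length,
      ((if w.get j = Letter.dir α ∧ cyclicSucc j = i then bandTransport φ j (v j) else 0) +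
        (if w.get j = Letter.inv α ∧ j = i then
          (bandTransport φ j).symm (v (cyclicSucc j)) else 0)) := by
  simp only [bandModule, LinearMap.sum_apply, Finset.sum_apply]
  refine Finset.sum_congr rfl fun j _ => ?_
  rw [LinearMap.add_apply, Pi.add_apply]
  congr 1
  · by_cases h : w.get j = Letter.dir α
    · simp only [h, if_true, true_and, LinearMap.comp_apply, LinearMap.proj_apply,
        LinearMap.coe_single, Pi.single_apply, eq_comm, LinearEquiv.coe_coe]
    · simp only [h, if_false, false_and, LinearMap.zero_apply, Pi.zero_apply]
  · by_cases h : w.get j = Letter.inv α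
    · simp only [h, if_true, true_and, LinearMap.comp_apply, LinearMap.proj_apply,
        LinearMap.coe_single, Pi.single_apply, eq_comm, LinearEquiv.coe_coe]
    · simp only [h, if_false, false_and, LinearMap.zero_apply, Pi.zero_apply]

/-- An endomorphism of `(V, φ)` acts on the band module. -/
theorem bandModule_isHom (f : V →ₗ[k] V) (hf : ∀ x, f (φ x) = φ (f x)) :
    (bandModule w φ).IsHom (bandModule w φ) (LinearMap.pi fun i => f ∘ₗ LinearMap.proj i) := by
  classical
  have hf' : ∀ j x, f (bandTransport φ j x) = bandTransport φ j (f x) := by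
    intro j x
    unfold bandTransport
    split_ifs
    · exact hf x
    · rfl
  have hf'' : ∀ j x, f ((bandTransport φ j).symm x) = (bandTransport φ j).symm (f x) := by
    intro j x
    rw [LinearEquiv.eq_symm_apply, ← hf', LinearEquiv.apply_symm_apply]
  constructor
  · intro g v
    funext i
    rw [bandModule_vertex_apply]
    simp only [LinearMap.pi_apply, LinearMap.comp_apply, LinearMap.proj_apply,
      bandModule_vertex_apply]
    split_ifs <;> simp
  · intro α v
    funext i
    rw [bandModule_arrow_apply]
    simp only [LinearMap.pi_apply, LinearMap.comp_apply, LinearMap.proj_apply,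
      bandModule_arrow_apply, map_sum, map_add]
    refine Finset.sum_congr rfl fun j _ => ?_
    congr 1
    · split_ifs
      · exact hf' _ _
      · exact map_zero f
    · split_ifs
      · exact hf'' _ _
      · exact map_zero f

/-- The projection of a `φ`-stable decomposition commutes with `φ`; applied to all copies of `V` at
once it is an idempotent endomorphism of the band module. -/
theorem isIndecomposableAut_of_isConnected (hw : w ≠ []) [Nontrivial V]
    (h : (bandModule w φ).IsConnected) : IsIndecomposableAut φ := by
  refine ⟨inferInstance, fun U W hU hW hUW => ?_⟩
  have hmem : ∀ {A : Submodule k V}, A.map φ.toLinearMap = A → ∀ x ∈ A, φ x ∈ A :=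
    fun hA x hx => hA.le ⟨x, hx, rfl⟩
  have hUx : ∀ x ∈ U, U.projection W hUW x = x := fun x hx => by
    exact Submodule.projection_apply_of_mem_left hUW hx
  have hWx : ∀ x ∈ W, U.projection W hUW x = 0 := fun x hx => by
    exact Submodule.projection_apply_of_mem_right hUW hx
  have hcomm : ∀ x, U.projection W hUW (φ x) = φ (U.projection W hUW x) := by
    intro x
    obtain ⟨a, ha, b, hb, rfl⟩ := Submodule.mem_sup.1 (hUW.codisjoint.eq_top.ge
      (Submodule.mem_top (x := x)))
    rw [map_add, map_add, map_add, hUx _ (hmem hU a ha), hWx _ (hmem hW b hb), hUx a ha, hWx b hb,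
      add_zero, add_zero]
  have i₀ : Fin w.length := ⟨0, List.length_pos_iff.2 hw⟩
  rcases h.idempotent _ (bandModule_isHom w φ _ hcomm) (by
    refine LinearMap.ext fun v => funext fun i => ?_
    obtain ⟨a, ha, b, hb, hab⟩ := Submodule.mem_sup.1 (hUW.codisjoint.eq_top.ge
      (Submodule.mem_top (x := v i)))
    simp only [LinearMap.comp_apply, LinearMap.pi_apply, LinearMap.proj_apply]
    rw [← hab, map_add, hUx a ha, hWx b hb, add_zero, hUx a ha]) with h0 | h1
  · left
    rw [eq_bot_iff]
    intro x hx
    have := congrFun (LinearMap.congr_fun h0 (fun _ => x)) i₀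
    simp only [LinearMap.pi_apply, LinearMap.comp_apply, LinearMap.proj_apply,
      LinearMap.zero_apply, Pi.zero_apply] at this
    rw [hUx x hx] at this
    exact this
  · right
    rw [eq_bot_iff]
    intro x hx
    have := congrFun (LinearMap.congr_fun h1 (fun _ => x)) i₀
    simp only [LinearMap.pi_apply, LinearMap.comp_apply, LinearMap.proj_apply,
      LinearMap.id_apply] at this
    rw [hWx x hx] at this
    exact this.symm

end BandModule

theorem QuiverOps.IsConnected.of_iso {k : Type u} [Field k] {Q : Type u} [Quiver.{u} Q]
    {V W : Type u} [AddCommGroup V] [Module k V] [AddCommGroup W] [Module k W]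
    {X : QuiverOps k Q V} {Y : QuiverOps k Q W} (hX : X.IsConnected) (h : X.Iso Y) :
    Y.IsConnected := by
  obtain ⟨e, hv, ha⟩ := h
  have := hX.nontrivial
  have hv' : ∀ g y, e.symm (Y.vertex g y) = X.vertex g (e.symm y) := fun g y => by
    rw [LinearEquiv.symm_apply_eq, hv, LinearEquiv.apply_symm_apply]
  have ha' : ∀ g y, e.symm (Y.arrow g y) = X.arrow g (e.symm y) := fun g y => by
    rw [LinearEquiv.symm_apply_eq, ha, LinearEquiv.apply_symm_apply]
  refine ⟨e.symm.toEquiv.nontrivial, fun f hf hff => ?_⟩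
  rcases hX.idempotent (e.symm.toLinearMap ∘ₗ f ∘ₗ e.toLinearMap)
    ⟨fun g x => by simp [hv, hf.vertex, hv'], fun g x => by simp [ha, hf.arrow, ha']⟩
    (LinearMap.ext fun x => by
      have := LinearMap.congr_fun hff (e x)
      simpa using this) with h | h
  · left
    refine LinearMap.ext fun y => ?_
    have := LinearMap.congr_fun h (e.symm y)
    simpa using this
  · right
    refine LinearMap.ext fun y => ?_
    have := LinearMap.congr_fun h (e.symm y)
    simpa using this

theorem Walks.replicate {Q : Type u} [Quiver.{u} Q] {pol : Polarization Q} {τ : Q × Bool}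
    {w : List (Letter Q)} (h : Walks pol τ w τ) (m : ℕ) :
    Walks pol τ (List.replicate m w).flatten τ := by
  induction m with
  | zero => rfl
  | succ m ih =>
    rw [List.replicate_succ, List.flatten_cons, walks_append]
    exact ⟨τ, h, ih⟩

namespace QuiverOps.IsPolarized

open LinRel

variable {k : Type u} [Field k] {Q : Type u} [Quiver.{u} Q] {V : Type u}
    [AddCommGroup V] [Module k V] {M : QuiverOps k Q V} {pol : Polarization Q}
    {hM : M.IsPolarized pol}

theorem up_add (σ : Option (Q × Bool)) (D : ℕ → Fin 3) (m n : ℕ) :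
    hM.system.up σ D (m + n) = img (word (hM.system.rels σ D) m)
      (hM.system.up (hM.system.st σ D m) (fun i => D (m + i)) n) := by
  induction m generalizing σ D with
  | zero => simp [img_word_zero, RelSystem.st]
  | succ m ih =>
    rw [show m + 1 + n = m + n + 1 by omega, hM.system.up_succ', ih, hM.system.word_rels_succ',
      img_comp, hM.system.st_succ']
    congr 4
    funext i
    congr 1
    omega

theorem lo_add (σ : Option (Q × Bool)) (D : ℕ → Fin 3) (m n : ℕ) :
    hM.system.lo σ D (m + n) = img (word (hM.system.rels σ D) m)
      (hM.system.lo (hM.system.st σ D m) (fun i => D (m + i)) n) := by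
  induction m generalizing σ D with
  | zero => simp [img_word_zero, RelSystem.st]
  | succ m ih =>
    rw [show m + 1 + n = m + n + 1 by omega, hM.system.lo_succ', ih, hM.system.word_rels_succ',
      img_comp, hM.system.st_succ']
    congr 4
    funext i
    congr 1
    omega

/-- The letters already passed are read backwards and inverted. At a periodic position the whole
backward sequence is thereby determined by the forward one. -/
theorem back_iterate_move (t : WordPosition Q) {i j : ℕ} (h : j < i) :
    (hM.move^[i] t).back j = Fin.rev (t.fwd (i - 1 - j)) := by
  induction i generalizing j with
  | zero => omega
  | succ i ih =>
    rw [Function.iterate_succ_apply']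
    rcases j with _ | j
    · change Fin.rev ((hM.move^[i] t).fwd 0) = _
      rw [fwd_iterate_move]
      rfl
    · change (hM.move^[i] t).back j = _
      rw [ih (by omega)]
      congr 2
      omega

end QuiverOps.IsPolarized

end

/-! ### Band modules from periodic words -/

noncomputable section

namespace QuiverOps.IsPolarized

open LinRel

variable {k : Type u} [Field k] {Q : Type u} [Quiver.{u} Q] {V : Type u}
    [AddCommGroup V] [Module k V] {M : QuiverOps k Q V} {pol : Polarization Q}
    {hM : M.IsPolarized pol}

/-- The word of a position that recurs for the first time is not a proper power. -/
theorem primitive_of_minimal {t : WordPosition Q} {w : List (Letter Q)} {τ : ℕ → Q × Bool}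
    (hτ : ∀ i ≤ w.length, (hM.move^[i] t).state = some (τ i))
    (hw : ∀ (i : ℕ) (hi : i < w.length), w[i].digit = t.fwd i ∧ w[i].first pol = τ i ∧
        w[i].last pol = τ (i + 1))
    (hpos : 0 < w.length) (hper : hM.move^[w.length] t = t)
    (hmin : ∀ q, 0 < q → hM.move^[q] t = t → w.length ≤ q) (v : List (Letter Q)) (m : ℕ)
    (hv : w = (List.replicate m v).flatten) : m = 1 := by
  obtain ⟨m, rfl⟩ : ∃ m', m = m' + 1 := by
    refine Nat.exists_eq_succ_of_ne_zero fun h => ?_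
    rw [h] at hv
    rw [hv] at hpos
    simp at hpos
  set r := (List.replicate m v).flatten with hr
  have h1 : w = v ++ r := by rw [hv, List.replicate_succ, List.flatten_cons]
  have h2 : w = r ++ v := by
    rw [hv, List.replicate_succ', List.flatten_append, List.flatten_singleton]
  by_contra hm
  have hlen : w.length = v.length + r.length := by rw [h1, List.length_append]
  have hlr : r.length = m * v.length := by simp [hr]
  have hv0 : 0 < v.length := by
    rcases Nat.eq_zero_or_pos v.length with h | h
    · rw [h, mul_zero] at hlr
      omega
    · exact h
  have hr0 : 0 < r.length := by rw [hlr]; exact Nat.mul_pos (by omega) hv0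
  have hD : Function.Periodic t.fwd w.length := fun i => by
    rw [Nat.add_comm, ← hM.fwd_iterate_move, hper]
  -- From `w = v ++ r` and `w = r ++ v` it follows that the cyclic word is invariant under rotation
  -- by `v.length`, which is then a period of the position smaller than the minimal one.
  have hget : ∀ (i : ℕ) (hi : i < w.length) (hi' : (i + v.length) % w.length < w.length),
      w[(i + v.length) % w.length] = w[i] := by
    intro i hi hi'
    rcases lt_or_ge i r.length with h | h
    · have e : (i + v.length) % w.length = i + v.length := Nat.mod_eq_of_lt (by omega)
      simp only [e]
      have e1 : w[i + v.length]'(by omega) = r[i] := by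
        simp only [h1]
        rw [List.getElem_append_right (by omega)]
        congr 1
        omega
      have e2 : w[i] = r[i] := by
        simp only [h2]
        rw [List.getElem_append_left]
      rw [e1, e2]
    · have e : (i + v.length) % w.length = i - r.length := by
        rw [Nat.mod_eq_sub_mod (by omega), Nat.mod_eq_of_lt (by omega)]
        omega
      simp only [e]
      have e1 : w[i - r.length]'(by omega) = v[i - r.length]'(by omega) := by
        simp only [h1]
        rw [List.getElem_append_left]
      have e2 : w[i] = v[i - r.length]'(by omega) := by
        simp only [h2]
        rw [List.getElem_append_right h]
      rw [e1, e2]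
  have hDq : ∀ i, t.fwd (i + v.length) = t.fwd i := by
    intro i
    have h3 := Nat.mod_lt i hpos
    have h4 := Nat.mod_lt (i % w.length + v.length) hpos
    have h5 := hget _ h3 h4
    have h6 := (hw _ h4).1
    rw [h5, (hw _ h3).1, hD.map_mod_nat, hD.map_mod_nat] at h6
    rw [h6, ← hD.map_mod_nat (i % w.length + v.length), Nat.mod_add_mod, hD.map_mod_nat]
  have hq : hM.move^[v.length] t = t := by
    have hs : (hM.move^[v.length] t).state = t.state := by
      rw [hτ _ (by omega), show t.state = some (τ 0) from hτ 0 (by omega),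
        ← (hw v.length (by omega)).2.1, ← (hw 0 hpos).2.1]
      have h5 := hget 0 hpos (Nat.mod_lt _ hpos)
      simp only [Nat.zero_add, Nat.mod_eq_of_lt (show v.length < w.length by omega)] at h5
      rw [h5]
    have hf : (hM.move^[v.length] t).fwd = t.fwd := by
      funext i
      rw [fwd_iterate_move, Nat.add_comm, hDq]
    have hb : (hM.move^[v.length] t).back = t.back := by
      funext j
      -- This many steps lead back to `t` and are more than `j`, so the `j`-th backward digit is a
      -- reversed forward digit.
      have hper' : hM.move^[w.length * (j + 1)] t = t := by
        rw [Function.iterate_mul]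
        exact Function.iterate_fixed hper _
      have hjlt : j < w.length * (j + 1) :=
        lt_of_lt_of_le (Nat.lt_succ_self j) (Nat.le_mul_of_pos_left _ hpos)
      have e1 : t.back j = Fin.rev (t.fwd (w.length * (j + 1) - 1 - j)) := by
        conv_lhs => rw [← hper']
        rw [back_iterate_move t hjlt]
      have e2 : (hM.move^[v.length] t).back j =
          Fin.rev (t.fwd (v.length + w.length * (j + 1) - 1 - j)) := by
        conv_lhs => rw [← hper', ← Function.iterate_add_apply]
        rw [back_iterate_move t (by omega)]
      rw [e1, e2, ← hDq (w.length * (j + 1) - 1 - j)]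
      congr 2
      omega
    cases h : hM.move^[v.length] t
    rw [h] at hs hf hb
    cases t
    simp only at hs hf hb
    rw [hs, hf, hb]
  have := hmin v.length hv0 hq
  omega

/-- A position that recurs yields a band module. -/
theorem IsGood.exists_band [FiniteDimensional k V] (hconn : M.IsConnected) {t : WordPosition Q}
    (ht : hM.IsGood t) (hinf : ∀ i, t.fwd i ≠ 1) (hrec : t ∈ Function.periodicPts hM.move) :
    ∃ (w : List (Letter Q)) (d : ℕ) (φ : (Fin d → k) ≃ₗ[k] (Fin d → k)), w ≠ [] ∧
      (∀ m : ℕ, IsLetterSequence (List.replicate m w).flatten) ∧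
      (∀ (v : List (Letter Q)) (m : ℕ), w = (List.replicate m v).flatten → m = 1) ∧
      (∀ m : ℕ, ∃ x y, x ≠ 0 ∧ M.Linked x (List.replicate m w).flatten y) ∧
      IsIndecomposableAut φ ∧ M.Iso (bandModule w φ) := by
  -- Minimality of the period makes the word primitive; injectivity below the period makes the
  -- positions of the pattern different.
  obtain ⟨n, hpos, hper, hmin, hinj⟩ : ∃ n, 0 < n ∧ hM.move^[n] t = t ∧
      (∀ q, 0 < q → hM.move^[q] t = t → n ≤ q) ∧
      ∀ i < n, ∀ j < n, hM.move^[i] t = hM.move^[j] t → i = j :=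
    ⟨_, Function.minimalPeriod_pos_of_mem_periodicPts hrec, Function.iterate_minimalPeriod,
      fun q hq h => Function.IsPeriodicPt.minimalPeriod_le hq h,
      fun i hi j hj h => Function.iterate_injOn_Iio_minimalPeriod hi hj h⟩
  obtain ⟨w, τ, rfl, hτ, hw⟩ := ht.exists_letters (n := n) (fun i _ => hinf i)
  have hstate : t.state = some (τ 0) := hτ 0 (by omega)
  have hτN : τ w.length = τ 0 := by
    have := hτ w.length le_rfl
    rw [hper, hstate] at this
    exact (Option.some_inj.1 this).symm
  have hD : ∀ i, t.fwd (w.length + i) = t.fwd i := fun i => by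
    rw [← hM.fwd_iterate_move, hper]
  have hdig : ∀ (i : ℕ) (hi : i < w.length), w[i].digit = (hM.move^[i] t).fwd 0 := fun i hi => by
    rw [(hw i hi).1, fwd_iterate_move, Nat.add_zero]
  have hrel : ∀ (i : ℕ) (hi : i < w.length),
      hM.system.rels t.state t.fwd i = M.letterRel w[i] := fun i hi =>
    hM.rels_eq_letterRel (hτ i hi.le) (hw i hi).1 (hw i hi).2.1
  -- the relation of the cyclic word and its iterates
  set R := word (hM.system.rels t.state t.fwd) w.length with hR
  have hst : hM.system.st t.state t.fwd w.length = t.state := by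
    rw [← hM.state_iterate_move, hper]
  have hup : ∀ n, hM.system.up t.state t.fwd (w.length + n) =
      img R (hM.system.up t.state t.fwd n) := fun n => by
    rw [up_add, hst]
    simp only [hD]
    rfl
  have hlo : ∀ n, hM.system.lo t.state t.fwd (w.length + n) =
      img R (hM.system.lo t.state t.fwd n) := fun n => by
    rw [lo_add, hst]
    simp only [hD]
    rfl
  have hbk : ∀ i ≤ w.length, ∀ n,
      hM.system.up (some (oppositeSide (τ i))) (hM.move^[i] t).back (i + n) =
        img (inv (word (hM.system.rels t.state t.fwd) i))
          (hM.system.up (some (oppositeSide (τ 0))) t.back n) ∧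
      hM.system.lo (some (oppositeSide (τ i))) (hM.move^[i] t).back (i + n) =
        img (inv (word (hM.system.rels t.state t.fwd) i))
          (hM.system.lo (some (oppositeSide (τ 0))) t.back n) := by
    intro i
    induction i with
    | zero =>
      intro _ n
      rw [word_inv]
      simp [img_word_zero]
    | succ i ih =>
      intro hi n
      have ih' := ih (by omega) n
      rw [← (hw i hi).2.1] at ih'
      rw [show i + 1 + n = i + n + 1 by omega, ← (hw i hi).2.2, Function.iterate_succ_apply',
        QuiverOps.IsPolarized.move,
        ← hdig i hi, up_letter_inverse, lo_letter_inverse, ih'.1, ih'.2, ← hrel i hi,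
        ← img_comp, ← img_comp, ← inv_comp]
      exact ⟨rfl, rfl⟩
  have hubk : ∀ n, hM.system.up (some (oppositeSide (τ 0))) t.back (w.length + n) =
      img (inv R) (hM.system.up (some (oppositeSide (τ 0))) t.back n) := fun n => by
    have := (hbk w.length le_rfl n).1
    rwa [hper, hτN] at this
  have hlbk : ∀ n, hM.system.lo (some (oppositeSide (τ 0))) t.back (w.length + n) =
      img (inv R) (hM.system.lo (some (oppositeSide (τ 0))) t.back n) := fun n => by
    have := (hbk w.length le_rfl n).2
    rwa [hper, hτN] at this
  -- After `N` periods the upper bound lies in the `N`-th iterated image of the whole space, and the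
  -- lower bound contains that of zero.
  have hiter : ∀ (S : Submodule k (V × V)) (a b : ℕ → Submodule k V),
      (∀ n, a (w.length + n) = img S (a n)) → (∀ n, b (w.length + n) = img S (b n)) → b 0 = ⊥ →
      ∀ N, a (w.length * N) ≤ (img S)^[N] ⊤ ∧ (img S)^[N] ⊥ ≤ b (w.length * N) := by
    intro S a b ha hb hb0 N
    induction N with
    | zero => exact ⟨le_top, bot_le⟩
    | succ N ih =>
      rw [show w.length * (N + 1) = w.length + w.length * N by ring, ha, hb,
        Function.iterate_succ_apply', Function.iterate_succ_apply']
      exact ⟨img_mono S ih.1, img_mono S ih.2⟩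
  -- If the stable images of `R` and its inverse met only inside the sum of the nilpotent parts,
  -- these inclusions would make the subquotient of the good position `t` zero.
  obtain ⟨d, φ, s, q, hd, hqs, hsR, hqR⟩ := exists_automorphism_summand R (fun N hle => by
    obtain ⟨τ', h1, h2⟩ := id ht
    obtain rfl := Option.some_inj.1 (h1.symm.trans hstate)
    have hf := hiter R _ _ hup hlo (hM.system.lo_zero _ _) N
    have hb := hiter (inv R) _ _ hubk hlbk (hM.system.lo_zero _ _) N
    rw [hstate] at hf
    refine h2 (w.length * N) ((inf_comm _ _).trans_le ((inf_le_inf hf.1 hb.1).trans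
      (hle.trans ((sup_le_sup hf.2 hb.2).trans (sup_comm _ _).le))))
  )
  have : Nonempty (Fin d) := ⟨⟨0, hd⟩⟩
  -- After one turn around the cyclic word the family of vectors comes back twisted by `φ`, and the
  -- family of forms by `φ⁻¹`.
  obtain ⟨x, hx0, hxN, hx⟩ := exists_chain (n := w.length)
    (ρ := hM.system.rels t.state t.fwd) (s := s) (t := s ∘ₗ φ.toLinearMap) hsR
  obtain ⟨p, hp0, hpN, hp⟩ := exists_cochain (n := w.length)
    (ρ := hM.system.rels t.state t.fwd) (p := q) (q := φ.symm.toLinearMap ∘ₗ q) (fun a b hab => by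
      rw [LinearMap.comp_apply, hqR a b hab, LinearEquiv.coe_coe, LinearEquiv.symm_apply_apply])
  have hxr : ∀ (i : ℕ) (hi : i < w.length) c, (x i c, x (i + 1) c) ∈ M.letterRel w[i] :=
    fun i hi c => hrel i hi ▸ hx i hi c
  have hpr : ∀ (i : ℕ) (hi : i < w.length) a b, (a, b) ∈ M.letterRel w[i] → p i a = p (i + 1) b :=
    fun i hi a b hab => hp i hi a b (by rw [hrel i hi]; exact hab)
  have hxN' : ∀ c, x w.length c = x 0 (φ c) := fun c => by rw [hxN, hx0]; rfl
  have hpN' : ∀ a, p 0 a = φ (p w.length a) := fun a => by rw [hpN, hp0]; simp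
  have hpx : ∀ i ≤ w.length, ∀ c, p i (x i c) = c := by
    intro i
    induction i with
    | zero =>
      intro _ c
      rw [hx0, hp0]
      exact LinearMap.congr_fun hqs c
    | succ i ih =>
      intro hi c
      rw [← hpr i hi _ _ (hxr i hi c), ih (by omega)]
  -- There is no end to start from, so the induction is on the number `N` of digits, for all
  -- positions at once. At the last letter it passes to position `0`; the twist does no harm because
  -- the claim concerns the whole family.
  have hfwd : ∀ N, ∀ i < w.length, (∀ c, x i c ∈ hM.system.up (some (τ i))
      (hM.move^[i] t).fwd N) ∧ ∀ y ∈ hM.system.lo (some (τ i)) (hM.move^[i] t).fwd N,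
      p i y = 0 := by
    intro N
    induction N with
    | zero =>
      intro i hi
      refine ⟨fun c => ?_, fun y hy => ?_⟩
      · rw [hM.system.up_zero, ← (hw i hi).2.1]
        refine hM.mem_stateSpace.2 ?_
        rw [Letter.first_fst]
        exact (hM.mem_of_mem_letterRel (hxr i hi c)).1
      · rw [hM.system.lo_zero] at hy
        rw [(Submodule.mem_bot k).1 hy, map_zero]
    | succ N ih =>
      have ih' : ∀ i ≤ w.length, (∀ c, x i c ∈ hM.system.up (some (τ i))
          (hM.move^[i] t).fwd N) ∧ ∀ y ∈ hM.system.lo (some (τ i)) (hM.move^[i] t).fwd N,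
          p i y = 0 := by
        intro i hi
        rcases hi.lt_or_eq with h | rfl
        · exact ih i h
        · rw [hτN, hper]
          refine ⟨fun c => ?_, fun y hy => ?_⟩
          · rw [hxN']
            exact (ih 0 hpos).1 _
          · have := (ih 0 hpos).2 y hy
            rw [hpN'] at this
            simpa using this
      intro i hi
      have h1 := ih' (i + 1) hi
      rw [← (hw i hi).2.2, Function.iterate_succ_apply'] at h1
      rw [← (hw i hi).2.1]
      exact ⟨fun c => hM.mem_up_fwd (hdig i hi) (hxr i hi c) (h1.1 c),
        hM.vanish_lo_fwd (hdig i hi) (hpr i hi) h1.2⟩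
  have hback : ∀ N, ∀ i ≤ w.length, (∀ c, x i c ∈ hM.system.up (some (oppositeSide (τ i)))
      (hM.move^[i] t).back N) ∧ ∀ y ∈ hM.system.lo (some (oppositeSide (τ i)))
      (hM.move^[i] t).back N, p i y = 0 := by
    intro N
    induction N with
    | zero =>
      intro i hi
      refine ⟨fun c => ?_, fun y hy => ?_⟩
      · rw [hM.system.up_zero]
        refine hM.mem_stateSpace.2 ?_
        rcases hi.lt_or_eq with h | rfl
        · have := (hM.mem_of_mem_letterRel (hxr i h c)).1
          rwa [← Letter.first_fst pol, (hw i h).2.1] at this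
        · rw [hτN, hxN']
          have := (hM.mem_of_mem_letterRel (hxr 0 hpos (φ c))).1
          rwa [← Letter.first_fst pol, (hw 0 hpos).2.1] at this
      · rw [hM.system.lo_zero] at hy
        rw [(Submodule.mem_bot k).1 hy, map_zero]
    | succ N ih =>
      have key : ∀ i, i + 1 ≤ w.length → (∀ c, x (i + 1) c ∈
          hM.system.up (some (oppositeSide (τ (i + 1)))) (hM.move^[i + 1] t).back (N + 1)) ∧
          ∀ y ∈ hM.system.lo (some (oppositeSide (τ (i + 1)))) (hM.move^[i + 1] t).back (N + 1),
          p (i + 1) y = 0 := by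
        intro i hi
        have h1 := ih i (by omega)
        rw [← (hw i hi).2.1] at h1
        rw [← (hw i hi).2.2, Function.iterate_succ_apply']
        exact ⟨fun c => hM.mem_up_back (hdig i hi) (hxr i hi c) (h1.1 c),
          hM.vanish_lo_back (hdig i hi) (hpr i hi) h1.2⟩
      intro i hi
      -- Position `0` is reached from the last letter, that is, as position `w.length` corrected by
      -- `φ`.
      rcases i with _ | i
      · have h1 := key (w.length - 1) (by omega)
        rw [show w.length - 1 + 1 = w.length by omega, hτN, hper] at h1
        refine ⟨fun c => ?_, fun y hy => ?_⟩
        · have := h1.1 (φ.symm c)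
          rwa [hxN', LinearEquiv.apply_symm_apply] at this
        · rw [hpN', h1.2 y hy, map_zero]
      · exact key i hi
  -- the twisted families
  let x' : ℕ → (Fin d → k) →ₗ[k] V := fun i => if i = 0 then x 0 else x i ∘ₗ φ.symm.toLinearMap
  let p' : ℕ → V →ₗ[k] (Fin d → k) := fun i => if i = 0 then p 0 else φ.toLinearMap ∘ₗ p i
  -- Before the change `φ` appears where the cycle closes, after the last letter. Twisting all
  -- positions except `0` moves it to the first letter, as `bandTransport` requires.
  have hx'0 : x' 0 = x 0 := if_pos rfl
  have hp'0 : p' 0 = p 0 := if_pos rfl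
  have hx's : ∀ i, x' (i + 1) = x (i + 1) ∘ₗ φ.symm.toLinearMap := fun i => if_neg (by omega)
  have hp's : ∀ i, p' (i + 1) = φ.toLinearMap ∘ₗ p (i + 1) := fun i => if_neg (by omega)
  have hx'N : x' w.length = x' 0 := by
    obtain ⟨n, hn⟩ : ∃ n, w.length = n + 1 := ⟨w.length - 1, by omega⟩
    rw [hn, hx's, hx'0, ← hn]
    refine LinearMap.ext fun c => ?_
    rw [LinearMap.comp_apply, hxN']
    simp
  have hp'N : p' w.length = p' 0 := by
    obtain ⟨n, hn⟩ : ∃ n, w.length = n + 1 := ⟨w.length - 1, by omega⟩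
    rw [hn, hp's, hp'0, ← hn]
    exact LinearMap.ext fun a => (hpN' a).symm
  have hpat : hM.IsPattern (id : Fin w.length → Fin w.length) cyclicSucc w.get
      (fun i => bandTransport φ i) (fun i => τ i) (fun i => (hM.move^[i] t).back)
      (fun i => (hM.move^[i] t).fwd) (fun i => x' i) (fun i => p' i) :=
    { placed := fun i => by
        have hf := fun N => hfwd N i i.2
        have hb := fun N => hback N i i.2.le
        have hpxi := hpx i i.2.le
        obtain ⟨i, hi⟩ := i
        rcases i with _ | i
        · simp only [hx'0, hp'0]
          exact ⟨fun N => (hf N).1, fun N => (hb N).1, fun N => (hf N).2, fun N => (hb N).2, hpxi⟩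
        · simp only [hx's, hp's]
          exact ⟨fun N c => (hf N).1 _, fun N c => (hb N).1 _,
            fun N y hy => by simp [(hf N).2 y hy], fun N y hy => by simp [(hb N).2 y hy],
            fun c => by simp [hpxi]⟩
      ne := fun i j hij h1 h2 h3 => hij (Fin.ext (hinj i i.2 j j.2 (by
        have hi := hτ i i.2.le
        have hj := hτ j j.2.le
        rw [h1, ← hj] at hi
        cases hA : hM.move^[i] t
        cases hB : hM.move^[j] t
        simp only [hA, hB] at hi h2 h3
        rw [hi, h2, h3])))
      ne' := fun i j => hM.fwd_ne_back (ht.exists_next_iterate (n := w.length) fun i _ => hinf i)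
        hτ i.2.le j.2.le
      s_inj := Function.injective_id
      t_inj := cyclicSucc_injective
      first_eq := fun j => (hw j j.2).2.1
      digit_eq := fun j => hdig j j.2
      last_eq := fun j =>
        (hw j j.2).2.2.trans (apply_cyclicSucc j τ hτN).symm
      rev_digit_eq := fun j => by
        have := apply_cyclicSucc j (fun i => (hM.move^[i] t).back) (by rw [hper]; rfl)
        simp only [this, Function.iterate_succ_apply']
        exact congrArg Fin.rev (hdig j j.2)
      fwd_end := fun i _ => ⟨i, rfl⟩
      back_end := fun i _ => Finite.injective_iff_surjective.1 cyclicSucc_injective i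
      chain := fun j c => by
        rw [apply_cyclicSucc j x' hx'N, id]
        obtain ⟨j, hj⟩ := j
        rcases j with _ | j
        · rw [hx's, hx'0]
          simpa [bandTransport] using hxr 0 hj c
        · rw [hx's, hx's]
          simpa [bandTransport] using hxr (j + 1) hj (φ.symm c)
      cochain := fun j a b hab => by
        rw [apply_cyclicSucc j p' hp'N, id]
        obtain ⟨j, hj⟩ := j
        have h1 := hpr j hj a b hab
        rcases j with _ | j
        · rw [hp's, hp'0]
          simp [bandTransport, h1]
        · rw [hp's, hp's]
          simp [bandTransport, h1] }
  have : Nonempty (Fin w.length) := ⟨⟨0, hpos⟩⟩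
  have hiso := hpat.iso hconn (bandModule w φ) (fun g v i => by
    rw [bandModule_vertex_apply, ← Letter.first_fst pol, List.get_eq_getElem, (hw i i.2).2.1])
    (fun α v i => by
      rw [bandModule_arrow_apply]
      refine Finset.sum_congr rfl fun j _ => ?_
      congr!)
  have hwalk : Walks pol (τ 0) w (τ 0) := by
    have := Walks.of_getElem τ fun i hi => (hw i hi).2
    rwa [hτN] at this
  have hne : w ≠ [] := List.length_pos_iff.1 hpos
  refine ⟨w, d, φ, hne, fun m => (hwalk.replicate m).isLetterSequence,
    primitive_of_minimal hτ hw hpos hper hmin, fun m => ?_,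
    isIndecomposableAut_of_isConnected w φ hne (hconn.of_iso hiso), hiso⟩
  have hxne : ∀ i ≤ w.length, ∀ c, c ≠ 0 → x i c ≠ 0 := fun i hi c hc h => hc (by
    rw [← hpx i hi c, h, map_zero])
  have hlink : ∀ c, c ≠ 0 → M.Linked (x 0 c) w (x 0 (φ c)) := fun c hc => by
    rw [← hxN']
    exact Linked.of_chain (fun i => x i c) (fun i hi => hxr i hi c) (fun i hi => hxne i hi c hc)
  have hlinks : ∀ m c, c ≠ 0 → ∃ y, M.Linked (x 0 c) (List.replicate m w).flatten y := by
    intro m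
    induction m with
    | zero => exact fun c _ => ⟨_, rfl⟩
    | succ m ih =>
      intro c hc
      obtain ⟨y, hy⟩ := ih (φ c) (by simpa using hc)
      refine ⟨y, ?_⟩
      rw [List.replicate_succ, List.flatten_cons, linked_append]
      exact ⟨_, hlink c hc, hy⟩
  obtain ⟨c, hc⟩ := exists_ne (0 : Fin d → k)
  obtain ⟨y, hy⟩ := hlinks m c hc
  exact ⟨_, y, hxne 0 (by omega) c hc, hy⟩

/-- An infinite word yields a band module. -/
theorem IsGood.exists_band_of_infinite [FiniteDimensional k V] (hconn : M.IsConnected)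
    {t : WordPosition Q} (ht : hM.IsGood t) (hinf : ∀ i, t.fwd i ≠ 1) :
    ∃ (w : List (Letter Q)) (d : ℕ) (φ : (Fin d → k) ≃ₗ[k] (Fin d → k)), w ≠ [] ∧
      (∀ m : ℕ, IsLetterSequence (List.replicate m w).flatten) ∧
      (∀ (v : List (Letter Q)) (m : ℕ), w = (List.replicate m v).flatten → m = 1) ∧
      (∀ m : ℕ, ∃ x y, x ≠ 0 ∧ M.Linked x (List.replicate m w).flatten y) ∧
      IsIndecomposableAut φ ∧ M.Iso (bandModule w φ) := by
  obtain ⟨i, j, hij, h⟩ := hM.exists_repetition ht hinf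
  refine (ht.iterate_move (n := i) fun j _ => hinf j).exists_band hconn (fun l => ?_) ?_
  · rw [fwd_iterate_move]
    exact hinf _
  · refine ⟨j - i, by omega, ?_⟩
    rw [Function.IsPeriodicPt, Function.IsFixedPt, ← Function.iterate_add_apply,
      Nat.sub_add_cancel hij.le, h]

/-- A finite-dimensional representation without nontrivial idempotents is a string module or a band
module. -/
theorem string_or_band [FiniteDimensional k V] (hM : M.IsPolarized pol) (hconn : M.IsConnected)
    (hvert : ∀ x, (∀ g, M.vertex g x = 0) → x = 0) :
    (∃ w : QWord Q, M.Iso (stringModule k w) ∧ ∃ x y, x ≠ 0 ∧ M.Linked x w.letters y) ∨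
    ∃ (w : List (Letter Q)) (d : ℕ) (φ : (Fin d → k) ≃ₗ[k] (Fin d → k)), w ≠ [] ∧
      (∀ m : ℕ, IsLetterSequence (List.replicate m w).flatten) ∧
      (∀ (v : List (Letter Q)) (m : ℕ), w = (List.replicate m v).flatten → m = 1) ∧
      (∀ m : ℕ, ∃ x y, x ≠ 0 ∧ M.Linked x (List.replicate m w).flatten y) ∧
      IsIndecomposableAut φ ∧ M.Iso (bandModule w φ) := by
  have := hconn.nontrivial
  obtain ⟨x, hx⟩ := exists_ne (0 : V)
  obtain ⟨g, hg⟩ : ∃ g, M.vertex g x ≠ 0 := by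
    by_contra! h
    exact hx (hvert x h)
  obtain ⟨t, ht⟩ := hM.exists_isGood hg
  by_cases hinf : ∀ i, t.fwd i ≠ 1
  · exact Or.inr (ht.exists_band_of_infinite hconn hinf)
  push Not at hinf
  classical
  have h1 := Nat.find_spec hinf
  have h2 : ∀ i < Nat.find hinf, t.fwd i ≠ 1 := fun i hi => Nat.find_min hinf hi
  generalize Nat.find hinf = n at h1 h2
  -- The forward word is finite: the position is moved to its end and turned around. The word now
  -- starts at an end and either runs on forever, giving a band, or ends as well, giving a string.
  have ht' := ht.iterate_move h2
  have h3 : (hM.move^[n] t).fwd 0 = 1 := by rw [fwd_iterate_move, Nat.add_zero, h1]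
  generalize hM.move^[n] t = t' at ht' h3
  obtain ⟨τ, P, D⟩ := t'
  obtain ⟨τ', hτ', -⟩ := id ht'
  obtain rfl : τ = some τ' := hτ'
  have ht'' := ht'.swap
  by_cases hinf' : ∀ i, P i ≠ 1
  · exact Or.inr (ht''.exists_band_of_infinite hconn hinf')
  push Not at hinf'
  left
  exact ht''.exists_string hconn h3 (n := Nat.find hinf')
    (fun i hi => Nat.find_min hinf' hi) (Nat.find_spec hinf')

end QuiverOps.IsPolarized

end

noncomputable section

/-! ## The polarization of a string coalgebra -/

theorem exists_injective_bool {X : Type u} (h : ENat.card X ≤ 2) :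
    ∃ f : X → Bool, Function.Injective f := by
  have hfin : Finite X := by
    rw [← ENat.card_lt_top]
    exact h.trans_lt (by decide)
  have := Fintype.ofFinite X
  have h2 : Fintype.card X ≤ Fintype.card Bool := by
    rw [ENat.card_eq_coe_fintype_card] at h
    rw [Fintype.card_bool]
    exact_mod_cast h
  obtain ⟨e⟩ := Function.Embedding.nonempty_of_card_le h2
  exact ⟨e, e.injective⟩

/-- A partial matching of two sets with at most two elements is compatible with suitable
injective colourings of these sets by two colours. -/
theorem exists_colouring {X Y : Type u} (hX : ENat.card X ≤ 2) (hY : ENat.card Y ≤ 2)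
    (r : X → Y → Prop) (h1 : ∀ x y y', r x y → r x y' → y = y')
    (h2 : ∀ x x' y, r x y → r x' y → x = x') :
    ∃ c : (X → Bool) × (Y → Bool), Function.Injective c.1 ∧ Function.Injective c.2 ∧
      ∀ x y, c.1 x = c.2 y → ¬ r x y := by
  obtain ⟨f, hf⟩ := exists_injective_bool hX
  obtain ⟨h, hh⟩ := exists_injective_bool hY
  by_cases hr : ∃ x y, r x y
  · obtain ⟨x₀, y₀, h₀⟩ := hr
    -- The colouring of `Y` is flipped if necessary, so that the matched pair `x₀`, `y₀` gets
    -- different colours. Any other matched pair avoids both elements, hence has the two remaining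
    -- colours, which differ as well.
    have hinj : Function.Injective fun y => xor (h y) (h y₀ == f x₀) := fun a b hab =>
      hh (by simpa using hab)
    refine ⟨(f, fun y => xor (h y) (h y₀ == f x₀)), hf, hinj, fun x y hxy hrxy => ?_⟩
    simp only at hxy
    by_cases hx : x = x₀
    · subst hx
      obtain rfl := h1 _ _ _ h₀ hrxy
      revert hxy
      cases f x <;> cases h y₀ <;> simp
    · have hy : y ≠ y₀ := by
        rintro rfl
        exact hx (h2 _ _ _ hrxy h₀)
      have h3 := hf.ne hx
      have h4 := hh.ne hy
      revert hxy h3 h4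
      cases f x <;> cases f x₀ <;> cases h y <;> cases h y₀ <;> simp
  · push Not at hr
    exact ⟨(f, h), hf, hh, fun x y _ => hr x y⟩

/-- At each vertex (S2) says that the pairs of an incoming and an outgoing arrow whose composite
appears form a partial matching, and (S1) that there are at most two arrows of each kind. The two
colours given by `exists_colouring` are the sides. -/
theorem AdmissibleEmbedding.IsString.exists_polarization {k : Type u} [Field k] {B : Type u}
    [AddCommGroup B] [Module k B] [Coalgebra k B] {Q : Type u} [Quiver.{u} Q]
    {ι : AdmissibleEmbedding k B Q} (hι : ι.IsString) :
    ∃ pol : Polarization Q, ∀ (a b c : Q) (β : a ⟶ b) (α : b ⟶ c),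
      pol.sin ⟨a, b, β⟩ = pol.sout ⟨b, c, α⟩ → ¬ ι.Appears (β.toPath.comp α.toPath) := by
  have key : ∀ g : Q, ∃ c : ((h : Q) × (h ⟶ g) → Bool) × ((h : Q) × (g ⟶ h) → Bool),
      Function.Injective c.1 ∧ Function.Injective c.2 ∧
      ∀ β α, c.1 β = c.2 α → ¬ ι.Appears (β.2.toPath.comp α.2.toPath) := fun g =>
    exists_colouring (hι.ends g) (hι.starts g) (fun β α => ι.Appears (β.2.toPath.comp α.2.toPath))
      (fun β α α' h h' => hι.after _ _ β.2 h h') (fun β β' α h h' => hι.before _ _ α.2 h h')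
  choose c h1 h2 h3 using key
  refine ⟨{
    sin := fun α => (c α.right).1 ⟨α.left, α.hom⟩
    sout := fun α => (c α.left).2 ⟨α.right, α.hom⟩
    sin_inj := ?_
    sout_inj := ?_ }, fun a b d β α h => h3 b ⟨a, β⟩ ⟨d, α⟩ h⟩
  · rintro ⟨a, b, α⟩ ⟨a', b', α'⟩ h h'
    obtain rfl : b = b' := h
    cases h1 b h'
    rfl
  · rintro ⟨a, b, α⟩ ⟨a', b', α'⟩ h h'
    obtain rfl : a = a' := h
    cases h2 a h'
    rfl

end

noncomputable section

/-! ## The operators given by linear forms on the coalgebra -/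

namespace RightComod

variable {k : Type u} [Field k] {C : Type u} [AddCommGroup C] [Module k C] [Coalgebra k C]

/-- The operator `x ↦ ∑ f(x₍₁₎) x₍₀₎` given by a linear form `f` on the coalgebra. -/
def act (M : RightComod k C) (f : C →ₗ[k] k) : M →ₗ[k] M :=
  (TensorProduct.rid k M).toLinearMap ∘ₗ f.lTensor M ∘ₗ M.coact

/-- Coassociativity turns the composition of operators into the convolution of linear forms. -/
theorem act_act (M : RightComod k C) (f g : C →ₗ[k] k) (x : M) :
    M.act f (M.act g x) =
      M.act ((TensorProduct.lid k k).toLinearMap ∘ₗ TensorProduct.map f g ∘ₗ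
        Coalgebra.comul) x := by
  have h1 : ∀ t : M ⊗[k] C, M.act f (TensorProduct.rid k M (g.lTensor M t)) =
      TensorProduct.rid k M (((TensorProduct.lid k k).toLinearMap ∘ₗ
        TensorProduct.map f g).lTensor M
        (TensorProduct.assoc k M C C (M.coact.rTensor C t))) := by
    intro t
    induction t with
    | zero => simp
    | add a b ha hb => simp only [map_add, ha, hb]
    | tmul m c =>
      simp only [LinearMap.lTensor_tmul, TensorProduct.rid_tmul, map_smul, act,
        LinearMap.comp_apply, LinearEquiv.coe_coe, LinearMap.rTensor_tmul]
      generalize M.coact m = s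
      induction s with
      | zero => simp
      | add a b ha hb => simp only [map_add, smul_add, ha, hb, TensorProduct.add_tmul]
      | tmul n c' => simp [smul_smul, mul_comm]
  change M.act f (TensorProduct.rid k M (g.lTensor M (M.coact x))) = _
  have h2 := LinearMap.congr_fun M.coassoc x
  simp only [LinearMap.comp_apply, LinearEquiv.coe_coe] at h2
  rw [h1, h2]
  simp only [act, LinearMap.comp_apply, LinearEquiv.coe_coe, ← LinearMap.lTensor_comp_apply,
    LinearMap.comp_assoc]

theorem act_counit (M : RightComod k C) (x : M) : M.act Coalgebra.counit x = x :=
  LinearMap.congr_fun M.counit_coact x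

end RightComod

namespace QPath

variable {Q : Type u} [Quiver.{u} Q]

theorem mk_cons_inj {a b c a' b' c' : Q} {p : Quiver.Path a b} {α : b ⟶ c}
    {p' : Quiver.Path a' b'} {α' : b' ⟶ c'} : (⟨p.cons α⟩ : QPath Q) = ⟨p'.cons α'⟩ ↔
      (⟨p⟩ : QPath Q) = ⟨p'⟩ ∧ (⟨α.toPath⟩ : QPath Q) = ⟨α'.toPath⟩ := by
  constructor
  · intro h
    cases h
    exact ⟨rfl, rfl⟩
  · rintro ⟨h, h'⟩
    cases h
    cases h'
    rfl

theorem mk_cons_ne_nil {a b c d : Q} {p : Quiver.Path a b} {α : b ⟶ c} :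
    (⟨p.cons α⟩ : QPath Q) ≠ ⟨(Quiver.Path.nil : Quiver.Path d d)⟩ := by
  intro h
  cases h

theorem mk_cons_cons_ne_toPath {a b c d x y : Q} {p : Quiver.Path a b} {α : b ⟶ c} {β : c ⟶ d}
    {γ : x ⟶ y} : (⟨(p.cons α).cons β⟩ : QPath Q) ≠ ⟨γ.toPath⟩ := by
  intro h
  cases h

end QPath

namespace PathCoalgebra

variable {k : Type u} [Field k] {Q : Type u} [Quiver.{u} Q]

open Classical in
theorem coeff_ofPath {a b c d : Q} (p : Quiver.Path a b) (q : Quiver.Path c d) :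
    coeff k p (ofPath k q) = if (⟨q⟩ : QPath Q) = ⟨p⟩ then 1 else 0 :=
  Finsupp.single_apply

/-- The convolution product of the coefficient forms of two paths. -/
def coeffMul (k : Type u) [Field k] {Q : Type u} [Quiver.{u} Q] {a b c d : Q}
    (q : Quiver.Path c d) (p : Quiver.Path a b) : PathCoalgebra k Q →ₗ[k] k :=
  (TensorProduct.lid k k).toLinearMap ∘ₗ TensorProduct.map (coeff k q) (coeff k p) ∘ₗ
    Coalgebra.comul

theorem coeffMul_ofPath {a b c d x y : Q} (q : Quiver.Path c d) (p : Quiver.Path a b)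
    (r : Quiver.Path x y) : coeffMul k q p (ofPath k r) = QPath.cutSum r fun _ p₁ p₂ =>
      coeff k q (ofPath k p₂) * coeff k p (ofPath k p₁) := by
  simp only [coeffMul, LinearMap.comp_apply, comul_ofPath, map_cutSum, TensorProduct.map_tmul,
    LinearEquiv.coe_coe, TensorProduct.lid_tmul, smul_eq_mul]

-- Only the factorization with trivial terminal part contributes to the convolution.
open Classical in
theorem coeffMul_nil {a b : Q} (c : Q) (p : Quiver.Path a b) :
    coeffMul k (Quiver.Path.nil : Quiver.Path c c) p = if b = c then coeff k p else 0 := by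
  refine hom_ext fun x y r => ?_
  rw [coeffMul_ofPath]
  have h : (QPath.cutSum r fun _ p₁ p₂ =>
      coeff k (Quiver.Path.nil : Quiver.Path c c) (ofPath k p₂) * coeff k p (ofPath k p₁)) =
      coeff k (Quiver.Path.nil : Quiver.Path c c) (ofPath k (Quiver.Path.nil : Quiver.Path y y)) *
        coeff k p (ofPath k r) := by
    cases r with
    | nil => rfl
    | cons r e =>
      rw [QPath.cutSum]
      simp only [coeff_ofPath, if_neg QPath.mk_cons_ne_nil, zero_mul, QPath.cutSum_zero, add_zero]
  rw [h, coeff_ofPath, coeff_ofPath]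
  by_cases hp : (⟨r⟩ : QPath Q) = ⟨p⟩
  · cases hp
    by_cases hc : b = c
    · subst hc
      rw [if_pos rfl, if_pos rfl, if_pos rfl, coeff_ofPath, if_pos rfl, one_mul]
    · have : (⟨(Quiver.Path.nil : Quiver.Path b b)⟩ : QPath Q) ≠
          ⟨(Quiver.Path.nil : Quiver.Path c c)⟩ := by
        intro h
        exact hc (congrArg QPath.source h)
      rw [if_neg this, if_neg hc, zero_mul, LinearMap.zero_apply]
  · rw [if_neg hp, mul_zero]
    split_ifs
    · rw [coeff_ofPath, if_neg hp]
    · rfl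

/-- Only the factorization whose terminal part is a single arrow contributes. Consequently the
operator of a path is the composite of the operators of its arrows. -/
theorem coeffMul_toPath {a b c : Q} (p : Quiver.Path a b) (α : b ⟶ c) :
    coeffMul k α.toPath p = coeff k (p.cons α) := by
  classical
  refine hom_ext fun x y r => ?_
  rw [coeffMul_ofPath]
  cases r with
  | nil =>
    simp only [QPath.cutSum, coeff_ofPath]
    rw [if_neg (c := _ = (⟨α.toPath⟩ : QPath Q)) QPath.mk_cons_ne_nil.symm, zero_mul,
      if_neg QPath.mk_cons_ne_nil.symm]
  | cons s e =>
    have h : (QPath.cutSum (s.cons e) fun _ p₁ p₂ =>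
        coeff k α.toPath (ofPath k p₂) * coeff k p (ofPath k p₁)) =
        coeff k α.toPath (ofPath k e.toPath) * coeff k p (ofPath k s) := by
      rw [QPath.cutSum, coeff_ofPath, if_neg (c := _ = (⟨α.toPath⟩ : QPath Q))
        QPath.mk_cons_ne_nil.symm, zero_mul, zero_add]
      cases s with
      | nil => rfl
      | cons s f =>
        rw [QPath.cutSum]
        simp only [coeff_ofPath, if_neg QPath.mk_cons_cons_ne_toPath, zero_mul,
          QPath.cutSum_zero, add_zero]
        rfl
    rw [h]
    simp only [coeff_ofPath, QPath.mk_cons_inj]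
    split_ifs <;> simp_all

end PathCoalgebra

namespace AdmissibleEmbedding

open PathCoalgebra

variable {k : Type u} [Field k] {B : Type u} [AddCommGroup B] [Module k B] [Coalgebra k B]
  {Q : Type u} [Quiver.{u} Q] (ι : AdmissibleEmbedding k B Q) (M : RightComod k B)

theorem pathOp_eq_act {a b : Q} (p : Quiver.Path a b) : ι.pathOp M p =
    M.act (coeff k p ∘ₗ (ι.incl : B →ₗ[k] PathCoalgebra k Q)) := rfl

theorem pathOp_pathOp {a b c d : Q} (q : Quiver.Path c d) (p : Quiver.Path a b) (x : M) :
    ι.pathOp M q (ι.pathOp M p x) =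
      M.act (coeffMul k q p ∘ₗ (ι.incl : B →ₗ[k] PathCoalgebra k Q)) x := by
  rw [pathOp_eq_act, pathOp_eq_act, RightComod.act_act, TensorProduct.map_comp, coeffMul]
  refine congrArg (fun l : B →ₗ[k] k => M.act l x) ?_
  simp only [LinearMap.comp_assoc]
  exact congrArg (fun l => (TensorProduct.lid k k).toLinearMap ∘ₗ
    TensorProduct.map (coeff k q) (coeff k p) ∘ₗ l) ι.incl.map_comp_comul

theorem pathOp_nil_self {a b : Q} (p : Quiver.Path a b) (x : M) :
    ι.pathOp M (Quiver.Path.nil : Quiver.Path b b) (ι.pathOp M p x) = ι.pathOp M p x := by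
  rw [pathOp_pathOp, coeffMul_nil, if_pos rfl]
  rfl

theorem pathOp_nil_of_ne {a b c : Q} (h : b ≠ c) (p : Quiver.Path a b) (x : M) :
    ι.pathOp M (Quiver.Path.nil : Quiver.Path c c) (ι.pathOp M p x) = 0 := by
  rw [pathOp_pathOp, coeffMul_nil, if_neg h, LinearMap.zero_comp]
  simp [RightComod.act]

theorem pathOp_toPath {a b c : Q} (p : Quiver.Path a b) (α : b ⟶ c) (x : M) :
    ι.pathOp M α.toPath (ι.pathOp M p x) = ι.pathOp M (p.cons α) x := by
  rw [pathOp_pathOp, coeffMul_toPath]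
  rfl

theorem pathOp_nil {a b : Q} (p : Quiver.Path a b) (x : M) :
    ι.pathOp M p (ι.pathOp M (Quiver.Path.nil : Quiver.Path a a) x) = ι.pathOp M p x := by
  induction p with
  | nil => exact ι.pathOp_nil_self M _ x
  | cons p α ih => rw [← pathOp_toPath, ih, pathOp_toPath]

/-- An element of `V ⊗ B` is determined by its coefficients at the paths of `Q`. -/
theorem tensor_eq_zero {V : Type u} [AddCommGroup V] [Module k V] (t : V ⊗[k] B)
    (h : ∀ (a b : Q) (p : Quiver.Path a b), TensorProduct.rid k V
      ((coeff k p ∘ₗ (ι.incl : B →ₗ[k] PathCoalgebra k Q)).lTensor V t) = 0) : t = 0 := by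
  classical
  have hinj : Function.Injective ((ι.incl : B →ₗ[k] PathCoalgebra k Q).lTensor V) :=
    Module.Flat.lTensor_preserves_injective_linearMap _ ι.injective
  apply hinj
  rw [map_zero]
  refine (TensorProduct.finsuppScalarRight k k V (QPath Q)).injective
    (Eq.trans ?_ (map_zero _).symm)
  ext p
  refine (TensorProduct.finsuppScalarRight_apply (R := k) (S := k) _ p).trans ?_
  have := h _ _ p.path
  rw [LinearMap.lTensor_comp_apply] at this
  exact this

variable {M} in
theorem eq_zero_of_pathOp {x : M}
    (h : ∀ g : Q, ι.pathOp M (Quiver.Path.nil : Quiver.Path g g) x = 0) : x = 0 := by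
  have h0 : M.coact x = 0 := ι.tensor_eq_zero _ fun a b p => by
    change ι.pathOp M p x = 0
    rw [← pathOp_nil, h, map_zero]
  rw [← M.act_counit x, RightComod.act, LinearMap.comp_apply, LinearMap.comp_apply, h0, map_zero,
    map_zero]

/-- The operators of vertices and arrows generate those of all paths, and the coaction is determined
by the path operators, by `tensor_eq_zero`. -/
theorem mem_homs_of_isHom {N : RightComod k B} {f : M →ₗ[k] N} (hf : (ι.rep M).IsHom (ι.rep N) f) :
    f ∈ RightComod.homs M N := by
  have h1 : ∀ (a b : Q) (p : Quiver.Path a b) x, f (ι.pathOp M p x) = ι.pathOp N p (f x) := by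
    intro a b p x
    induction p with
    | nil => exact hf.vertex a x
    | cons p α ih => rw [← pathOp_toPath, ← pathOp_toPath, ← ih]; exact hf.arrow ⟨_, _, α⟩ _
  refine LinearMap.ext fun x => sub_eq_zero.1 (ι.tensor_eq_zero _ fun a b p => ?_)
  rw [map_sub, map_sub, sub_eq_zero]
  refine Eq.trans ?_ (h1 a b p x)
  change _ = f (TensorProduct.rid k M (LinearMap.lTensor M _ (M.coact x)))
  rw [LinearMap.comp_apply]
  generalize M.coact x = t
  induction t with
  | zero => simp
  | add a b ha hb => simp only [map_add, ha, hb]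
  | tmul m c => simp

variable {M}

theorem appears_of_pathOp_ne_zero {a b : Q} {p : Quiver.Path a b} (h : ι.pathOp M p ≠ 0) :
    ι.Appears p := by
  by_contra hp
  simp only [Appears, not_exists, not_not] at hp
  apply h
  have : coeff k p ∘ₗ (ι.incl : B →ₗ[k] PathCoalgebra k Q) = 0 := LinearMap.ext hp
  rw [pathOp, this]
  simp

variable {ι}

/-- The coefficient form of a path outside the spanning set of paths vanishes on that set, hence on
all of `B`. -/
theorem IsString.contains (hι : ι.IsString) {a b : Q} {p : Quiver.Path a b} (h : ι.Appears p) :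
    ι.Contains p := by
  classical
  obtain ⟨S, hS⟩ := hι.spanned
  obtain ⟨x, hx⟩ := h
  by_cases hp : (⟨p⟩ : QPath Q) ∈ S
  · have : ofPath k p ∈ LinearMap.range (ι.incl : B →ₗ[k] PathCoalgebra k Q) := by
      rw [hS]
      exact Submodule.subset_span ⟨⟨p⟩, hp, rfl⟩
    exact this
  · refine absurd ?_ hx
    have h1 : LinearMap.range (ι.incl : B →ₗ[k] PathCoalgebra k Q) ≤ LinearMap.ker (coeff k p) := by
      rw [hS, Submodule.span_le]
      rintro _ ⟨q, hq, rfl⟩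
      rw [SetLike.mem_coe, LinearMap.mem_ker, coeff_ofPath, if_neg]
      rintro h
      exact hp (h ▸ hq)
    exact h1 ⟨x, rfl⟩

theorem isPolarized_rep {pol : Polarization Q}
    (hpol : ∀ (a b c : Q) (β : a ⟶ b) (α : b ⟶ c), pol.sin ⟨a, b, β⟩ = pol.sout ⟨b, c, α⟩ →
      ¬ ι.Appears (β.toPath.comp α.toPath)) : (ι.rep M).IsPolarized pol where
  vertex_vertex g x := ι.pathOp_nil_self M _ x
  vertex_ne g h x hgh := ι.pathOp_nil_of_ne M hgh.symm _ x
  vertex_arrow α x := ι.pathOp_nil_self M _ x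
  arrow_vertex α x := ι.pathOp_nil M _ x
  arrow_arrow := by
    rintro ⟨b, c, α⟩ ⟨a, b', β⟩ x h h'
    obtain rfl : b' = b := h
    refine (ι.pathOp_toPath M β.toPath α x).trans ?_
    by_contra h0
    exact hpol _ _ _ β α h' (ι.appears_of_pathOp_ne_zero fun h1 => h0 (LinearMap.congr_fun h1 x))

theorem pathAct_rep {a b c : Q} (p : Quiver.Path a b) (α : b ⟶ c) :
    (ι.rep M).pathAct (p.cons α) = ι.pathOp M (p.cons α) := by
  induction p generalizing c with
  | nil => rfl
  | cons p β ih =>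
    rw [QuiverOps.pathAct, ih]
    exact LinearMap.ext fun x => ι.pathOp_toPath M _ α x

/-- Paths of positive length in the word act nontrivially on the comodule, so they appear in `B` and
hence lie in it. Trivial paths lie in `B` by admissibility. -/
theorem IsString.subpathsIn (hι : ι.IsString) {w : List (Letter Q)} {x y : M} (hx : x ≠ 0)
    (h : (ι.rep M).Linked x w y) : SubpathsIn ι w := by
  intro a b p hp
  cases p with
  | nil => exact ι.vertex_mem a
  | cons p α =>
    have := h.pathAct_ne_zero hx hp
    rw [pathAct_rep] at this
    exact hι.contains (ι.appears_of_pathOp_ne_zero this)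

end AdmissibleEmbedding

end

noncomputable section

/-! ## Subcomodules and homomorphisms -/

namespace RightComod

variable {k : Type u} [Field k] {C : Type u} [AddCommGroup C] [Module k C] [Coalgebra k C]

/-- The linear map of a morphism of comodules. -/
def toLin {M N : RightComod k C} (f : M ⟶ N) : M →ₗ[k] N := Subtype.val (p := (· ∈ homs M N)) f

/-- The morphism given by a linear map that commutes with the coactions. -/
def ofLin {M N : RightComod k C} (f : M →ₗ[k] N) (hf : f ∈ homs M N) : M ⟶ N :=
  (⟨f, hf⟩ : homs M N)

theorem hom_ext {M N : RightComod k C} {f g : M ⟶ N} (h : toLin f = toLin g) : f = g :=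
  Subtype.ext h

theorem rTensor_toLin {M N : RightComod k C} (f : M ⟶ N) (x : M) :
    (toLin f).rTensor C (M.coact x) = N.coact (toLin f x) :=
  LinearMap.congr_fun (Subtype.prop (p := (· ∈ homs M N)) f) x

theorem mono_of_injective {M N : RightComod k C} (f : M ⟶ N)
    (hf : Function.Injective (toLin f)) : Mono f where
  right_cancellation g h hgh := by
    refine hom_ext (LinearMap.ext fun x => hf ?_)
    exact LinearMap.congr_fun (congrArg toLin hgh) x

theorem isIso_of_bijective {M N : RightComod k C} (f : M ⟶ N)
    (hf : Function.Bijective (toLin f)) : IsIso f := by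
  let e := LinearEquiv.ofBijective (toLin f) hf
  have he : ∀ x, toLin f (e.symm x) = x := e.apply_symm_apply
  have he' : ∀ x, e.symm (toLin f x) = x := e.symm_apply_apply
  have h1 : e.symm.toLinearMap ∘ₗ toLin f = LinearMap.id := LinearMap.ext he'
  refine ⟨ofLin e.symm.toLinearMap (LinearMap.ext fun x => ?_), hom_ext h1,
    hom_ext (LinearMap.ext he)⟩
  simp only [LinearMap.comp_apply, LinearEquiv.coe_coe]
  conv_lhs => rw [← he x, ← rTensor_toLin, ← LinearMap.rTensor_comp_apply, h1,
    LinearMap.rTensor_id, LinearMap.id_apply]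

theorem bijective_of_isIso {M N : RightComod k C} (f : M ⟶ N) [IsIso f] :
    Function.Bijective (toLin f) := by
  have h1 := congrArg toLin (IsIso.hom_inv_id f)
  have h2 := congrArg toLin (IsIso.inv_hom_id f)
  exact Function.bijective_iff_has_inverse.2
    ⟨toLin (inv f), LinearMap.congr_fun h1, LinearMap.congr_fun h2⟩

/-- `C` is flat over `k`, so tensoring with it preserves the kernel. -/
theorem isSubcomodule_ker {M N : RightComod k C} (f : M ⟶ N) :
    M.IsSubcomodule (LinearMap.ker (toLin f)) := by
  intro x hx
  have h := Module.Flat.rTensor_exact C (LinearMap.exact_subtype_ker_map (toLin f))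
  refine (h _).1 ?_
  rw [rTensor_toLin, LinearMap.mem_ker.1 hx, map_zero]

theorem IsSubcomodule.sup {M : RightComod k C} {U W : Submodule k M} (hU : M.IsSubcomodule U)
    (hW : M.IsSubcomodule W) : M.IsSubcomodule (U ⊔ W) := by
  have key : ∀ {A B : Submodule k M}, A ≤ B →
      LinearMap.range (A.subtype.rTensor C) ≤ LinearMap.range (B.subtype.rTensor C) := by
    intro A B h
    rw [← Submodule.subtype_comp_inclusion A B h, LinearMap.rTensor_comp]
    exact LinearMap.range_comp_le_range _ _
  intro x hx
  obtain ⟨u, hu, w, hw, rfl⟩ := Submodule.mem_sup.1 hx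
  rw [map_add]
  exact add_mem (key le_sup_left (hU u hu)) (key le_sup_right (hW w hw))

theorem coact_act (M : RightComod k C) (f : C →ₗ[k] k) (x : M) : M.coact (M.act f x) =
    ((TensorProduct.rid k C).toLinearMap ∘ₗ f.lTensor C ∘ₗ Coalgebra.comul).lTensor M
      (M.coact x) := by
  have h1 : ∀ t : M ⊗[k] C, M.coact (TensorProduct.rid k M (f.lTensor M t)) =
      ((TensorProduct.rid k C).toLinearMap ∘ₗ f.lTensor C).lTensor M
        (TensorProduct.assoc k M C C (M.coact.rTensor C t)) := by
    intro t
    induction t with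
    | zero => simp
    | add a b ha hb => simp only [map_add, ha, hb]
    | tmul m c =>
      simp only [LinearMap.lTensor_tmul, TensorProduct.rid_tmul, map_smul, LinearMap.rTensor_tmul]
      generalize M.coact m = s
      induction s with
      | zero => simp
      | add a b ha hb => simp only [map_add, smul_add, ha, hb, TensorProduct.add_tmul]
      | tmul n c' => simp
  change M.coact (TensorProduct.rid k M (f.lTensor M (M.coact x))) = _
  have h2 := LinearMap.congr_fun M.coassoc x
  simp only [LinearMap.comp_apply, LinearEquiv.coe_coe] at h2
  rw [h1, h2, ← LinearMap.lTensor_comp_apply, LinearMap.comp_assoc]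

/-- Every element of a comodule lies in a finite-dimensional subcomodule. -/
theorem exists_finite_subcomodule (M : RightComod k C) (x : M) :
    ∃ U : Submodule k M, M.IsSubcomodule U ∧ FiniteDimensional k U ∧ x ∈ U := by
  classical
  let b := Module.Basis.ofVectorSpace k C
  obtain ⟨v, hv⟩ := TensorProduct.eq_repr_basis_right b (M.coact x)
  -- The span of the coefficients of `M.coact x` in a basis of `C`. Each coefficient is the value at
  -- `x` of the operator of a coordinate form, so `coact_act` shows that `U` is a subcomodule, and
  -- the counit shows that it contains `x`.
  let U := Submodule.span k ((v.support.image v : Finset M) : Set M)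
  have hvU : ∀ i, v i ∈ U := by
    intro i
    by_cases hi : i ∈ v.support
    · exact Submodule.subset_span (Finset.mem_coe.2 (Finset.mem_image_of_mem v hi))
    · rw [Finsupp.notMem_support_iff.1 hi]
      exact zero_mem _
  have hact : ∀ f : C →ₗ[k] k, M.act f x = v.sum fun i m => f (b i) • m := by
    intro f
    simp only [act, LinearMap.comp_apply, ← hv, Finsupp.sum, map_sum, LinearMap.lTensor_tmul,
      LinearEquiv.coe_coe, TensorProduct.rid_tmul]
  have hx : M.coact x ∈ LinearMap.range (U.subtype.rTensor C) := by
    rw [← hv]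
    exact sum_mem fun i _ => ⟨⟨v i, hvU i⟩ ⊗ₜ b i, rfl⟩
  have hcoord : ∀ i, M.act (b.coord i) x = v i := by
    intro i
    rw [hact, Finsupp.sum]
    simpa [Finsupp.single_apply] using fun h => h.symm
  refine ⟨U, fun y hy => ?_, FiniteDimensional.span_finset k _, ?_⟩
  · have hle : U ≤ (LinearMap.range (U.subtype.rTensor C)).comap M.coact := by
      refine Submodule.span_le.2 fun y hy => ?_
      obtain ⟨i, -, rfl⟩ := Finset.mem_image.1 (Finset.mem_coe.1 hy)
      rw [SetLike.mem_coe, Submodule.mem_comap]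
      obtain ⟨t, ht⟩ := hx
      rw [← hcoord, coact_act, ← ht, ← LinearMap.comp_apply, LinearMap.lTensor_comp_rTensor,
        ← LinearMap.rTensor_comp_lTensor]
      exact ⟨_, rfl⟩
    exact hle hy
  · rw [← M.act_counit x, hact]
    exact sum_mem fun i _ => U.smul_mem _ (hvU i)

section Restrict

variable (M : RightComod k C) (U : Submodule k M)

theorem rTensor_subtype_injective (D : Type u) [AddCommGroup D] [Module k D] :
    Function.Injective (U.subtype.rTensor D) :=
  Module.Flat.rTensor_preserves_injective_linearMap _ U.injective_subtype

/-- The coaction on a subcomodule. -/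
def restrictCoact (hU : M.IsSubcomodule U) : U →ₗ[k] U ⊗[k] C :=
  (LinearEquiv.ofInjective _ (M.rTensor_subtype_injective U C)).symm.toLinearMap ∘ₗ
    (M.coact ∘ₗ U.subtype).codRestrict _ fun x => hU x x.2

theorem rTensor_restrictCoact (hU : M.IsSubcomodule U) (x : U) :
    U.subtype.rTensor C (M.restrictCoact U hU x) = M.coact x :=
  congrArg Subtype.val ((LinearEquiv.ofInjective _
    (M.rTensor_subtype_injective U C)).apply_symm_apply ⟨M.coact x, hU x x.2⟩)

/-- A subcomodule as a comodule. -/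
def restrict (hU : M.IsSubcomodule U) : RightComod k C where
  carrier := U
  coact := M.restrictCoact U hU
  coassoc := by
    refine LinearMap.ext fun x => M.rTensor_subtype_injective U (C ⊗[k] C) ?_
    have h1 : ∀ t : U ⊗[k] C, U.subtype.rTensor (C ⊗[k] C) (TensorProduct.assoc k U C C
        ((M.restrictCoact U hU).rTensor C t)) =
        TensorProduct.assoc k M C C (M.coact.rTensor C (U.subtype.rTensor C t)) := by
      intro t
      induction t with
      | zero => simp
      | add a b ha hb => simp only [map_add, ha, hb]
      | tmul m c =>
        simp only [LinearMap.rTensor_tmul, Submodule.subtype_apply]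
        rw [← M.rTensor_restrictCoact U hU m]
        generalize M.restrictCoact U hU m = s
        induction s with
        | zero => simp
        | add a b ha hb => simp only [map_add, ha, hb, TensorProduct.add_tmul]
        | tmul n c' => simp
    have h2 := LinearMap.congr_fun M.coassoc x
    simp only [LinearMap.comp_apply, LinearEquiv.coe_coe] at h2 ⊢
    rw [h1, rTensor_restrictCoact, h2, ← M.rTensor_restrictCoact U hU x,
      ← LinearMap.comp_apply, LinearMap.lTensor_comp_rTensor, ← LinearMap.rTensor_comp_lTensor]
    rfl
  counit_coact := by
    refine LinearMap.ext fun x => U.injective_subtype ?_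
    have h1 : ∀ t : U ⊗[k] C, U.subtype (TensorProduct.rid k U
        ((Coalgebra.counit (R := k) (A := C)).lTensor U t)) = TensorProduct.rid k M
        ((Coalgebra.counit (R := k) (A := C)).lTensor M (U.subtype.rTensor C t)) := by
      intro t
      induction t with
      | zero => simp
      | add a b ha hb => simp only [map_add, ha, hb]
      | tmul m c => simp
    simp only [LinearMap.comp_apply, LinearEquiv.coe_coe]
    rw [h1, rTensor_restrictCoact]
    exact M.act_counit x

variable {M} {U}

/-- The inclusion of a subcomodule. -/
def subtypeHom (hU : M.IsSubcomodule U) : M.restrict U hU ⟶ M :=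
  ofLin (M := M.restrict U hU) U.subtype (LinearMap.ext fun x => M.rTensor_restrictCoact U hU x)

theorem toLin_subtypeHom_injective (hU : M.IsSubcomodule U) :
    Function.Injective (toLin (subtypeHom hU)) := U.injective_subtype

/-- The inclusion of a subcomodule into a larger one. -/
def inclusionHom {W : Submodule k M} (hU : M.IsSubcomodule U) (hW : M.IsSubcomodule W)
    (h : U ≤ W) : M.restrict U hU ⟶ M.restrict W hW :=
  ofLin (M := M.restrict U hU) (N := M.restrict W hW) (Submodule.inclusion h)
    (LinearMap.ext fun x => M.rTensor_subtype_injective W C (by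
      change W.subtype.rTensor C ((Submodule.inclusion h).rTensor C (M.restrictCoact U hU x)) =
        W.subtype.rTensor C (M.restrictCoact W hW (Submodule.inclusion h x))
      rw [rTensor_restrictCoact, ← LinearMap.rTensor_comp_apply,
        Submodule.subtype_comp_inclusion]
      exact M.rTensor_restrictCoact U hU x))

end Restrict

/-- The kernel is a subcomodule whose inclusion composes with `f` to zero. Together with
`mono_of_injective` this makes injectivity a categorical property, preserved by equivalences. -/
theorem injective_of_mono {M N : RightComod k C} (f : M ⟶ N) [Mono f] :
    Function.Injective (toLin f) := by
  rw [← LinearMap.ker_eq_bot, eq_bot_iff]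
  intro x hx
  have h : subtypeHom (isSubcomodule_ker f) = 0 := by
    rw [← cancel_mono f, Limits.zero_comp]
    exact hom_ext (LinearMap.ext fun x => x.2)
  exact LinearMap.congr_fun (congrArg toLin h) ⟨x, hx⟩

/-- The kernels of `e` and of `1 - e` are complementary subcomodules, so one of them is zero. -/
theorem IsIndecomposable.idempotent {M : RightComod k C} (hM : M.IsIndecomposable) (e : M ⟶ M)
    (he : e ≫ e = e) : e = 0 ∨ e = 𝟙 M := by
  have h1 : ∀ x, toLin e (toLin e x) = toLin e x := LinearMap.congr_fun (congrArg toLin he)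
  have h2 : ∀ x, toLin (𝟙 M - e) x = x - toLin e x := fun x => rfl
  have hc : IsCompl (LinearMap.ker (toLin e)) (LinearMap.ker (toLin (𝟙 M - e))) := by
    refine ⟨Submodule.disjoint_def.2 fun x hx hx' => ?_, Submodule.codisjoint_iff_exists_add_eq.2 fun x =>
      ⟨x - toLin e x, toLin e x, ?_, ?_, sub_add_cancel _ _⟩⟩
    · rw [LinearMap.mem_ker] at hx hx'
      rwa [h2, hx, sub_zero] at hx'
    · rw [LinearMap.mem_ker, map_sub, h1, sub_self]
    · rw [LinearMap.mem_ker, h2, h1, sub_self]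
  rcases hM.2 _ _ (isSubcomodule_ker e) (isSubcomodule_ker (𝟙 M - e)) hc with h | h
  · refine Or.inr (hom_ext (LinearMap.ext fun x => ?_))
    refine LinearMap.ker_eq_bot.1 h ?_
    rw [h1]
    rfl
  · refine Or.inl (hom_ext (LinearMap.ext fun x => ?_))
    refine LinearMap.ker_eq_bot.1 h ?_
    rw [h2, h1, sub_self]
    exact (map_zero _).symm

/-! ## Equivalences of comodule categories -/

section Equivalence

variable {D : Type u} [AddCommGroup D] [Module k D] [Coalgebra k D]

theorem nontrivial_of_equivalence (F : RightComod k C ≌ RightComod k D) {M : RightComod k C}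
    [F.functor.Additive] (hM : Nontrivial M) : Nontrivial (F.functor.obj M) := by
  by_contra h
  rw [not_nontrivial_iff_subsingleton] at h
  have h1 : F.functor.map (𝟙 M) = F.functor.map 0 :=
    hom_ext (LinearMap.ext fun x => Subsingleton.elim _ _)
  obtain ⟨x, hx⟩ := exists_ne (0 : M)
  exact hx (LinearMap.congr_fun (congrArg toLin (F.functor.map_injective h1)) x)

theorem IsIndecomposable.idempotent_of_equivalence (F : RightComod k C ≌ RightComod k D)
    [F.functor.Additive] {M : RightComod k C} (hM : M.IsIndecomposable)
    (e : F.functor.obj M ⟶ F.functor.obj M) (he : e ≫ e = e) :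
    e = 0 ∨ e = 𝟙 (F.functor.obj M) := by
  obtain ⟨e, rfl⟩ := F.functor.map_surjective e
  rw [← F.functor.map_comp] at he
  rcases hM.idempotent e (F.functor.map_injective he) with rfl | rfl
  · exact Or.inl (F.functor.map_zero _ _)
  · exact Or.inr (F.functor.map_id M)

/-- The inverse functor embeds every finite-dimensional subcomodule of the image into `M`, which
bounds the dimensions obtained. Choose `U` with the largest one. Enlarging `U` by a
finite-dimensional subcomodule becomes an isomorphism under the inverse functor, hence is one, so
`U` contains every element. -/
theorem finiteDimensional_of_equivalence (F : RightComod k C ≌ RightComod k D)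
    (M : RightComod k C) [FiniteDimensional k M] : FiniteDimensional k (F.functor.obj M) := by
  set N := F.functor.obj M with hN
  let toM : ∀ (U : Submodule k N) (hU : N.IsSubcomodule U), F.inverse.obj (N.restrict U hU) ⟶ M :=
    fun U hU => F.inverse.map (subtypeHom hU) ≫ F.unitInv.app M
  have hinj : ∀ U hU, Function.Injective (toLin (toM U hU)) := by
    intro U hU
    have := mono_of_injective _ (toLin_subtypeHom_injective hU)
    have : Mono (toM U hU) := mono_comp _ _
    exact injective_of_mono _
  let S : Set ℕ := {n | ∃ (U : Submodule k N) (hU : N.IsSubcomodule U), FiniteDimensional k U ∧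
    Module.finrank k (F.inverse.obj (N.restrict U hU)) = n}
  have hS : S.Nonempty := by
    obtain ⟨U, hU, hfin, -⟩ := N.exists_finite_subcomodule 0
    exact ⟨_, U, hU, hfin, rfl⟩
  have hb : BddAbove S := by
    refine ⟨Module.finrank k M, ?_⟩
    rintro _ ⟨U, hU, -, rfl⟩
    exact LinearMap.finrank_le_finrank_of_injective (hinj U hU)
  obtain ⟨U, hU, hfin, hUmax⟩ := Nat.sSup_mem hS hb
  suffices h : U = ⊤ by
    subst h
    exact Module.Finite.equiv Submodule.topEquiv
  refine eq_top_iff.2 fun x _ => ?_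
  obtain ⟨W, hW, hfin', hx⟩ := N.exists_finite_subcomodule x
  have hle := le_csSup hb ⟨U ⊔ W, hU.sup hW, inferInstance, rfl⟩
  rw [← hUmax] at hle
  have hUW : U ≤ U ⊔ W := le_sup_left
  let j := inclusionHom hU (hU.sup hW) hUW
  have : Mono j := mono_of_injective j (Submodule.inclusion_injective hUW)
  have hj := injective_of_mono (F.inverse.map j)
  have : FiniteDimensional k (F.inverse.obj (N.restrict (U ⊔ W) (hU.sup hW))) :=
    FiniteDimensional.of_injective _ (hinj (U ⊔ W) (hU.sup hW))
  have : IsIso (F.inverse.map j) := isIso_of_bijective _ ⟨hj, LinearMap.range_eq_top.1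
    (Submodule.eq_top_of_finrank_eq (le_antisymm (Submodule.finrank_le _) (by
      rwa [LinearMap.finrank_range_of_inj hj])))⟩
  have : IsIso j := isIso_of_reflects_iso j F.inverse
  obtain ⟨y, hy⟩ := (bijective_of_isIso j).2 ⟨x, Submodule.mem_sup_right hx⟩
  have hyx : U.subtype y = x := congrArg Subtype.val hy
  exact hyx ▸ Subtype.prop (p := (· ∈ U)) y

end Equivalence

end RightComod

end

/-! ### The classification of finite-dimensional indecomposable comodules -/

noncomputable section

theorem AdmissibleEmbedding.isConnected_rep {k : Type u} [Field k] {B : Type u} [AddCommGroup B]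
    [Module k B] [Coalgebra k B] {Q : Type u} [Quiver.{u} Q] (ι : AdmissibleEmbedding k B Q)
    {N : RightComod k B} (hN : Nontrivial N)
    (h : ∀ e : N ⟶ N, e ≫ e = e → e = 0 ∨ e = 𝟙 N) : (ι.rep N).IsConnected where
  nontrivial := hN
  idempotent f hf hff := by
    rcases h (RightComod.ofLin f (ι.mem_homs_of_isHom N hf)) (RightComod.hom_ext hff) with h | h
    · exact Or.inl (congrArg RightComod.toLin h)
    · exact Or.inr (congrArg RightComod.toLin h)

end

theorem proposition1p3p3 {k : Type u} [Field k] {C : Type u} [AddCommGroup C] [Module k C]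
    [Coalgebra k C] (P : BasicPresentation k C) (hP : P.IsString)
    (M : RightComod k C) (hfin : FiniteDimensional k M) (hM : M.IsIndecomposable) :
    P.IsStringComodule M ∨ P.IsBandComodule M := by
  have := P.additive
  have hι : P.emb.IsString := hP
  obtain ⟨pol, hpol⟩ := hι.exists_polarization
  have := RightComod.finiteDimensional_of_equivalence P.equiv M
  have hconn := P.emb.isConnected_rep (RightComod.nontrivial_of_equivalence P.equiv hM.1)
    (hM.idempotent_of_equivalence P.equiv)
  rcases (AdmissibleEmbedding.isPolarized_rep hpol).string_or_band hconn
      (fun x hx => P.emb.eq_zero_of_pathOp hx) with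
    ⟨w, hiso, x, y, hx, hw⟩ | ⟨w, d, φ, hne, hpow, hprim, hsub, hφ, hiso⟩
  · exact Or.inl ⟨w, hι.subpathsIn hx hw, hiso⟩
  · refine Or.inr ⟨w, d, φ, ⟨hne, hpow, hprim, fun m => ?_⟩, hφ, hiso⟩
    obtain ⟨x, y, hx, hw⟩ := hsub m
    exact hι.subpathsIn hx hw
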